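/- Let $1<q<\infty$; all norms are over $\mathbb{R}^3$. A locally integrable vector field $a$ on $\mathbb{R}^3$ is called divergence-free, $\nabla\cdot a=0$, if $\int a\cdot\nabla\varphi=0$ for all $\varphi\in C_c^\infty(\mathbb{R}^3)$, and $g\in L^q(\mathbb{R}^3;\mathbb{R}^3)$ is called a gradient if $\int g\cdot w=0$ for all divergence-free $w\in C_c^\infty(\mathbb{R}^3;\mathbb{R}^3)$. Call $C_q\ge 1$ a Helmholtz constant for $L^q$ if every $w\in L^q(\mathbb{R}^3;\mathbb{R}^3)$ has a unique decomposition $w=a+g$ with $a\in L^q$ divergence-free and $g\in L^q$ a gradient, and $\|a\|_{L^q}\le C_q\|w\|_{L^q}$, $\|g\|_{L^q}\le C_q\|w\|_{L^q}$ for all such $w$. Then a Helmholtz constant for $L^q$ exists. Moreover, let $C_q$ be any Helmholtz constant for $L^q$, let $u:\mathbb{R}^3\to\mathbb{R}^3$ be a locally integrable divergence-free vector field whose weak gradient $\nabla u$ exists and lies in $L^q$, let $\omega=\nabla\times u$ be its vorticity and $S_{ij}=\tfrac12(\partial_iu_j+\partial_ju_i)$ its strain, and let $v\in\mathbb{R}^3$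 be any unit vector. Then $$\|(v\cdot\nabla)u\|_{L^q}\le C_q\|v\times\omega\|_{L^q},\qquad \|(v\cdot\nabla)u\|_{L^q}\le C_q\|2Sv\|_{L^q},$$ $$\|\nabla(u\cdot v)\|_{L^q}\le C_q\|v\times\omega\|_{L^q},\qquad \|\nabla(u\cdot v)\|_{L^q}\le C_q\|2Sv\|_{L^q},$$ and $$\frac1{2C_q}\|v\times\omega\|_{L^q}\le\|2Sv\|_{L^q}\le 2C_q\|v\times\omega\|_{L^q}.$$ -/

import Mathlib

open MeasureTheory
open scoped ENNReal NNReal ContDiff Matrix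

noncomputable section

/-- Three-dimensional Euclidean space. -/
abbrev E3 : Type := EuclideanSpace ℝ (Fin 3)

/-- The classical partial derivative `∂ⱼ φ` of a scalar function. -/
def partialD (j : Fin 3) (φ : E3 → ℝ) (x : E3) : ℝ :=
  fderiv ℝ φ x (EuclideanSpace.single j 1)

/-- Scalar test functions: smooth with compact support. -/
def IsTestFunction (φ : E3 → ℝ) : Prop :=
  ContDiff ℝ ∞ φ ∧ HasCompactSupport φ

/-- Divergence-free vector test fields: smooth, compactly supported, with zero divergence. -/
def IsDivFreeTestField (w : E3 → E3) : Prop :=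
  ContDiff ℝ ∞ w ∧ HasCompactSupport w ∧ ∀ x, ∑ i, partialD i (fun y => w y i) x = 0

/-- `∇ · a = 0` in the weak sense: `∫ a · ∇φ = 0` for every test function `φ`. -/
def IsWeaklyDivFree (a : E3 → E3) : Prop :=
  ∀ φ : E3 → ℝ, IsTestFunction φ → ∫ x, ∑ i, a x i * partialD i φ x = 0

/-- `g` is a gradient in the weak sense: `∫ g · w = 0` for every divergence-free
test field `w`. -/
def IsWeakGradientField (g : E3 → E3) : Prop :=
  ∀ w : E3 → E3, IsDivFreeTestField w → ∫ x, ∑ i, g x i * w x i = 0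

/-- `w = a + g` is a Helmholtz decomposition in `L^q`: `a ∈ L^q` is divergence-free and
`g ∈ L^q` is a gradient. -/
structure IsHelmholtzDecomposition (q : ℝ≥0∞) (w a g : E3 → E3) : Prop where
  memLp_divFree : MemLp a q volume
  memLp_gradient : MemLp g q volume
  divFree : IsWeaklyDivFree a
  gradient : IsWeakGradientField g
  sum_eq : w =ᵐ[volume] fun x => a x + g x

/-- `C ≥ 1` is a constant for the Helmholtz decomposition in `L^q`: each `w ∈ L^q` has a Helmholtz
decomposition `w = a + g`, it is unique up to null sets, and both parts (the images of `w` under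
the projections onto divergence-free fields and onto gradients) are bounded in `L^q` by
`C ‖w‖_{L^q}`. -/
def IsHelmholtzConstant (q : ℝ≥0∞) (C : ℝ≥0) : Prop :=
  1 ≤ C ∧ ∀ w : E3 → E3, MemLp w q volume →
    ∃ a g : E3 → E3, IsHelmholtzDecomposition q w a g ∧
      (∀ a' g' : E3 → E3, IsHelmholtzDecomposition q w a' g' →
        a' =ᵐ[volume] a ∧ g' =ᵐ[volume] g) ∧
      eLpNorm a q volume ≤ C * eLpNorm w q volume ∧
      eLpNorm g q volume ≤ C * eLpNorm w q volume

/-- `g` is the weak partial derivative `∂ⱼ f`; both are locally integrable. -/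
structure IsWeakPartial (j : Fin 3) (f g : E3 → ℝ) : Prop where
  locInt : LocallyIntegrable f volume
  locInt_deriv : LocallyIntegrable g volume
  integral_eq : ∀ φ : E3 → ℝ, IsTestFunction φ →
    ∫ x, f x * partialD j φ x = -∫ x, g x * φ x

open Classical in
/-- The weak partial derivative `∂ⱼ f` (well defined up to null sets, see
`IsWeakPartial.weakPartial_ae_eq`); zero by convention if there is none. -/
def weakPartial (j : Fin 3) (f : E3 → ℝ) : E3 → ℝ :=
  if h : ∃ g, IsWeakPartial j f g then h.choose else 0

theorem IsWeakPartial.weakPartial_spec {j : Fin 3} {f g : E3 → ℝ} (h : IsWeakPartial j f g) :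
    IsWeakPartial j f (weakPartial j f) := by
  have h' : ∃ g, IsWeakPartial j f g := ⟨g, h⟩
  rw [weakPartial, dif_pos h']
  exact h'.choose_spec

theorem IsWeakPartial.weakPartial_ae_eq {j : Fin 3} {f g : E3 → ℝ} (h : IsWeakPartial j f g) :
    weakPartial j f =ᵐ[volume] g := by
  refine ae_eq_of_integral_contDiff_smul_eq h.weakPartial_spec.locInt_deriv h.locInt_deriv ?_
  intro φ hφ hc
  have h1 := h.weakPartial_spec.integral_eq φ ⟨hφ, hc⟩
  have h2 := h.integral_eq φ ⟨hφ, hc⟩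
  rw [h1] at h2
  simpa only [smul_eq_mul, mul_comm] using neg_injective h2

/-- `∇u ∈ L^q`: all weak partial derivatives `∂ⱼ uᵢ` exist and belong to `L^q`. -/
def WeakGradMemLp (q : ℝ≥0∞) (u : E3 → E3) : Prop :=
  ∀ i j : Fin 3, ∃ g : E3 → ℝ, IsWeakPartial j (fun x => u x i) g ∧ MemLp g q volume

/-- The weak gradient `∇f` of a scalar function. -/
def weakGrad (f : E3 → ℝ) (x : E3) : E3 :=
  WithLp.toLp 2 fun j => weakPartial j f x

/-- The directional derivative `(v · ∇)u`, with components `∑ⱼ vⱼ ∂ⱼ uᵢ`. -/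
def dirDeriv (v : E3) (u : E3 → E3) (x : E3) : E3 :=
  WithLp.toLp 2 fun i => ∑ j, v j * weakPartial j (fun y => u y i) x

/-- The strain `Sᵢⱼ = (∂ᵢ uⱼ + ∂ⱼ uᵢ) / 2`. -/
def strain (u : E3 → E3) (x : E3) : Matrix (Fin 3) (Fin 3) ℝ :=
  Matrix.of fun i j =>
    (1 / 2 : ℝ) * (weakPartial i (fun y => u y j) x + weakPartial j (fun y => u y i) x)

/-- The vector field `S v`. -/
def strainApply (u : E3 → E3) (v : E3) (x : E3) : E3 :=
  WithLp.toLp 2 (strain u x *ᵥ v.ofLp)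

/-- The vorticity `ω = ∇ × u`. -/
def vorticity (u : E3 → E3) (x : E3) : E3 :=
  !₂[weakPartial 1 (fun y => u y 2) x - weakPartial 2 (fun y => u y 1) x,
     weakPartial 2 (fun y => u y 0) x - weakPartial 0 (fun y => u y 2) x,
     weakPartial 0 (fun y => u y 1) x - weakPartial 1 (fun y => u y 0) x]

/-- The vector field `v × ω`. -/
def crossVorticity (u : E3 → E3) (v : E3) (x : E3) : E3 :=
  WithLp.toLp 2 (crossProduct v.ofLp (vorticity u x).ofLp)

end

/-! The inequalities come from two pointwise identities. With `a = (v·∇)u` and `g = ∇(u·v)` one has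
`2Sv = a + g` and `v × ω = -a + g`. The field `g` is a gradient, and `a` is divergence-free because
`u` is and `v` is constant. Hence both are Helmholtz decompositions, with the same parts up to sign.
Uniqueness lets a Helmholtz constant bound `a` and `g` by either sum, and the triangle inequality
then compares the two sums with factor `2C`.

The long part is the existence of a Helmholtz constant, in essence the `L^q` boundedness of the
second-order Riesz transforms. It is obtained from the heat semigroup `Pₜ = exp(tΔ/2)` instead of
singular integrals. The operator `(-Δ)⁻¹` is truncated to `∫_s^T P_{2t} dt`. Since `P_{2t} = Pₜ Pₜ`
and `Pₜ` is self-adjoint, pairing `∂ᵢ∂ⱼ` of the truncation of `f` with `h` gives, up to sign, `∫_s^T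
∫ ∂ⱼPₜf ∂ᵢPₜh`. A bound uniform in `s` and `T` is thus a bilinear embedding
(`integral_heat_mul_heat_le`, `exists_heatPairing_le`).

The embedding is proved with a Bellman function `Q(x, y)` of Nazarov–Treil type: `0 ≤ Q ≤ 2(x^p +
y^q)`, while its Hessian form dominates a multiple of `|ab|` (`Bellman.hess_sum_ge`). Along the
flow, `½Δ - ∂ₜ` applied to `Q(Pₜf, Pₜh)` is half the Hessian form summed over the gradients, so
integration over space-time leaves at most the mass of `Q` at the initial time. The classical
correction term `x² y^(2-q)` is replaced by `x² (x^p + y^q)^(1-2/p)`, which scales in the same way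
and is smooth on the whole open quadrant, so no case distinction is needed.

For a test function `f`, the field `(P_{2s}f - P_{2T}f) eₖ` splits explicitly into the row
divergence of an antisymmetric matrix and a gradient (`rowDiv_add_gradField`). Tested against such
fields, any divergence-free `a` and gradient `g` satisfy `‖g‖ ≤ C‖a + g‖`
(`exists_gradient_part_bound`). This makes the sum of the two closed subspaces closed, and the
explicit splittings make it dense; hence it is all of `L^q`. -/

open Filter Topology Set ProbabilityTheory

noncomputable section

/-! ### Calculus of test functions and partial derivatives -/

namespace IsTestFunction

variable {φ ψ : E3 → ℝ}

theorem continuous (h : IsTestFunction φ) : Continuous φ := h.1.continuous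

theorem differentiable (h : IsTestFunction φ) : Differentiable ℝ φ :=
  h.1.differentiable (by simp)

theorem integrable (h : IsTestFunction φ) : Integrable φ volume :=
  h.continuous.integrable_of_hasCompactSupport h.2

theorem memLp (h : IsTestFunction φ) (p : ℝ≥0∞) : MemLp φ p volume :=
  h.continuous.memLp_of_hasCompactSupport h.2

theorem exists_bound (h : IsTestFunction φ) : ∃ M, 0 ≤ M ∧ ∀ x, ‖φ x‖ ≤ M := by
  obtain ⟨M, hM⟩ := h.2.exists_bound_of_continuous h.continuous
  exact ⟨M, (norm_nonneg _).trans (hM 0), hM⟩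

theorem add (h : IsTestFunction φ) (h' : IsTestFunction ψ) :
    IsTestFunction (fun x => φ x + ψ x) := ⟨h.1.add h'.1, h.2.add h'.2⟩

theorem neg (h : IsTestFunction φ) : IsTestFunction (fun x => - φ x) := by
  refine ⟨h.1.neg, h.2.mono' ?_⟩
  simp only [Function.support_fun_neg]
  exact subset_closure

theorem sub (h : IsTestFunction φ) (h' : IsTestFunction ψ) :
    IsTestFunction (fun x => φ x - ψ x) := by
  simpa only [sub_eq_add_neg] using h.add h'.neg

theorem mul_right (h : IsTestFunction φ) (hψ : ContDiff ℝ ∞ ψ) :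
    IsTestFunction (fun x => φ x * ψ x) := ⟨h.1.mul hψ, h.2.mul_right⟩

theorem const_mul (h : IsTestFunction φ) (c : ℝ) : IsTestFunction (fun x => c * φ x) :=
  ⟨contDiff_const.mul h.1, h.2.mul_left⟩

theorem fderiv_contDiff (h : IsTestFunction φ) : ContDiff ℝ ∞ (fderiv ℝ φ) :=
  h.1.fderiv_right (by simp)

theorem partialD (h : IsTestFunction φ) (j : Fin 3) : IsTestFunction (partialD j φ) :=
  ⟨h.fderiv_contDiff.clm_apply contDiff_const, h.2.fderiv_apply (𝕜 := ℝ) _⟩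

end IsTestFunction

theorem contDiff_partialD {f : E3 → ℝ} {n : ℕ∞} (hf : ContDiff ℝ (n + 1) f) (i : Fin 3) :
    ContDiff ℝ n (partialD i f) :=
  (hf.fderiv_right le_rfl).clm_apply contDiff_const

theorem contDiff_infty_partialD {f : E3 → ℝ} (hf : ContDiff ℝ ∞ f) (i : Fin 3) :
    ContDiff ℝ ∞ (partialD i f) :=
  (hf.fderiv_right (by simp)).clm_apply contDiff_const

theorem partialD_mul {f g : E3 → ℝ} (hf : Differentiable ℝ f) (hg : Differentiable ℝ g)
    (i : Fin 3) (x : E3) :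
    partialD i (fun y => f y * g y) x = f x * partialD i g x + partialD i f x * g x := by
  unfold partialD
  rw [fderiv_fun_mul (hf x) (hg x)]
  simp [mul_comm]

theorem partialD_sub {f g : E3 → ℝ} (hf : Differentiable ℝ f) (hg : Differentiable ℝ g)
    (i : Fin 3) (x : E3) :
    partialD i (fun y => f y - g y) x = partialD i f x - partialD i g x := by
  unfold partialD
  rw [fderiv_fun_sub (hf x) (hg x)]
  simp

theorem partialD_neg (f : E3 → ℝ) (i : Fin 3) (x : E3) :
    partialD i (fun y => - f y) x = - partialD i f x := by
  unfold partialD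
  rw [fderiv_fun_neg]
  simp

theorem partialD_sum {ι : Type*} (s : Finset ι) {f : ι → E3 → ℝ}
    (hf : ∀ k ∈ s, Differentiable ℝ (f k)) (i : Fin 3) (x : E3) :
    partialD i (fun y => ∑ k ∈ s, f k y) x = ∑ k ∈ s, partialD i (f k) x := by
  unfold partialD
  rw [fderiv_fun_sum fun k hk => hf k hk x]
  simp

theorem partialD_comm {f : E3 → ℝ} (hf : ContDiff ℝ 2 f) (i j : Fin 3) :
    partialD i (partialD j f) = partialD j (partialD i f) := by
  funext x
  -- Both iterated partials are values of the second derivative, which is symmetric.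
  have hd : DifferentiableAt ℝ (fderiv ℝ f) x :=
    (hf.fderiv_right (m := 1) (by norm_num)).differentiable (by simp) x
  have key : ∀ a b : Fin 3, partialD a (partialD b f) x =
      fderiv ℝ (fderiv ℝ f) x (EuclideanSpace.single a 1) (EuclideanSpace.single b 1) := by
    intro a b
    unfold partialD
    rw [fderiv_clm_apply hd (differentiableAt_const _)]
    simp
  rw [key, key]
  exact (hf.contDiffAt.isSymmSndFDerivAt (by simp)) _ _

/-- Integration by parts against a compactly supported function. -/
theorem integral_mul_partialD {f φ : E3 → ℝ} (hf : ContDiff ℝ 1 f) (hφ : ContDiff ℝ 1 φ)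
    (hc : HasCompactSupport φ) (i : Fin 3) :
    ∫ x, f x * partialD i φ x = - ∫ x, partialD i f x * φ x := by
  have hf' : Continuous (partialD i f) := (contDiff_partialD (n := 0) (by simpa using hf) i).continuous
  have hφ' : Continuous (partialD i φ) := (contDiff_partialD (n := 0) (by simpa using hφ) i).continuous
  have hc' : HasCompactSupport (partialD i φ) := hc.fderiv_apply (𝕜 := ℝ) _
  refine integral_mul_fderiv_eq_neg_fderiv_mul_of_integrable ?_ ?_ ?_
    (fun x _ => hf.differentiable (by simp) x) (fun x _ => hφ.differentiable (by simp) x)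
  · exact (hf'.mul hφ.continuous).integrable_of_hasCompactSupport hc.mul_left
  · exact (hf.continuous.mul hφ').integrable_of_hasCompactSupport hc'.mul_left
  · exact (hf.continuous.mul hφ.continuous).integrable_of_hasCompactSupport hc.mul_left

/-! ### Cutoff functions -/

/-- A sequence of smooth cutoffs exhausting space, with derivatives tending to zero. -/
structure IsCutoffSeq (χ : ℕ → E3 → ℝ) : Prop where
  test : ∀ n, IsTestFunction (χ n)
  nonneg : ∀ n x, 0 ≤ χ n x
  le_one : ∀ n x, χ n x ≤ 1
  tendsto : ∀ x, Tendsto (fun n => χ n x) atTop (𝓝 1)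
  deriv_le : ∃ C, 0 ≤ C ∧ ∀ n x i, |partialD i (χ n) x| ≤ C / (n + 1)
  deriv2_le : ∃ C, 0 ≤ C ∧ ∀ n x i, |partialD i (partialD i (χ n)) x| ≤ C / (n + 1)

theorem partialD_comp_smul {f : E3 → ℝ} (hf : Differentiable ℝ f) (c : ℝ) (i : Fin 3) (x : E3) :
    partialD i (fun y => f (c • y)) x = c * partialD i f (c • x) := by
  unfold partialD
  have h1 : HasFDerivAt (fun y : E3 => c • y) (c • ContinuousLinearMap.id ℝ E3) x :=
    (hasFDerivAt_id x).const_smul c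
  have h2 := (hf (c • x)).hasFDerivAt.comp x h1
  have h3 : fderiv ℝ (fun y => f (c • y)) x = _ := h2.fderiv
  rw [h3]
  simp

/-- Dilations of one bump function by the factor `n + 1`: each derivative produces a factor `1 / (n
+ 1)`. -/
theorem exists_isCutoffSeq : ∃ χ, IsCutoffSeq χ := by
  let b : ContDiffBump (0 : E3) := ⟨1, 2, one_pos, one_lt_two⟩
  have hb : IsTestFunction b := ⟨b.contDiff, b.hasCompactSupport⟩
  have hpos : ∀ n : ℕ, (0 : ℝ) < (n : ℝ) + 1 := fun n => by positivity
  have hB : ∀ φ : E3 → ℝ, IsTestFunction φ → ∃ C, 0 ≤ C ∧ ∀ x, |φ x| ≤ C :=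
    fun φ hφ => hφ.exists_bound
  have hd1 : ∀ (n : ℕ) i, partialD i (fun x => b (((n : ℝ) + 1)⁻¹ • x)) =
      fun x => ((n : ℝ) + 1)⁻¹ * partialD i b (((n : ℝ) + 1)⁻¹ • x) := by
    intro n i
    funext x
    exact partialD_comp_smul hb.differentiable _ i x
  have hd2 : ∀ (n : ℕ) i, partialD i (partialD i (fun x => b (((n : ℝ) + 1)⁻¹ • x))) =
      fun x => ((n : ℝ) + 1)⁻¹ * (((n : ℝ) + 1)⁻¹ *
        partialD i (partialD i b) (((n : ℝ) + 1)⁻¹ • x)) := by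
    intro n i
    funext x
    rw [hd1]
    have hT := hb.partialD i
    have h0 : Differentiable ℝ (fun y : E3 => partialD i b (((n : ℝ) + 1)⁻¹ • y)) :=
      hT.differentiable.comp (by fun_prop)
    rw [partialD_mul (differentiable_const _) h0, partialD_comp_smul hT.differentiable]
    simp [partialD]
  choose C1 h1 h1' using fun i => hB _ (hb.partialD i)
  choose C2 h2 h2' using fun i => hB _ ((hb.partialD i).partialD i)
  refine ⟨fun n x => b (((n : ℝ) + 1)⁻¹ • x), ?_, fun n x => b.nonneg, fun n x => b.le_one, ?_,
    ⟨∑ i, C1 i, Finset.sum_nonneg fun i _ => h1 i, ?_⟩,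
    ⟨∑ i, C2 i, Finset.sum_nonneg fun i _ => h2 i, ?_⟩⟩
  · intro n
    refine ⟨hb.1.comp (by fun_prop), ?_⟩
    exact hb.2.comp_smul (inv_ne_zero (hpos n).ne')
  · intro x
    have ht : Tendsto (fun n : ℕ => ((n : ℝ) + 1)⁻¹ • x) atTop (𝓝 ((0 : ℝ) • x)) :=
      (by simpa using tendsto_one_div_add_atTop_nhds_zero_nat (𝕜 := ℝ) :
        Tendsto (fun n : ℕ => ((n : ℝ) + 1)⁻¹) atTop (𝓝 0)).smul_const x
    rw [zero_smul] at ht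
    have := (b.continuous.tendsto 0).comp ht
    rwa [b.one_of_mem_closedBall (by simp [b.rIn_pos.le])] at this
  · intro n x i
    rw [hd1, abs_mul, abs_of_pos (inv_pos.2 (hpos n)), div_eq_inv_mul]
    gcongr
    exact (h1' i _).trans (Finset.single_le_sum (fun i _ => h1 i) (Finset.mem_univ i))
  · intro n x i
    rw [hd2, abs_mul, abs_mul, abs_of_pos (inv_pos.2 (hpos n)), div_eq_inv_mul]
    gcongr
    -- One of the two factors is discarded; decay of order `1 / (n + 1)` is enough.
    have hle : ((n : ℝ) + 1)⁻¹ ≤ 1 := inv_le_one_of_one_le₀ (by simp)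
    calc _ ≤ 1 * |partialD i (partialD i b) (((n : ℝ) + 1)⁻¹ • x)| := by gcongr
      _ ≤ _ := by
        rw [one_mul]
        exact (h2' i _).trans (Finset.single_le_sum (fun i _ => h2 i) (Finset.mem_univ i))

namespace IsCutoffSeq

variable {χ : ℕ → E3 → ℝ}

theorem tendsto_integral_mul (h : IsCutoffSeq χ) {F : E3 → ℝ} (hF : Integrable F volume) :
    Tendsto (fun n => ∫ x, χ n x * F x) atTop (𝓝 (∫ x, F x)) := by
  refine tendsto_integral_of_dominated_convergence (fun x => ‖F x‖)
    (fun n => (h.test n).continuous.aestronglyMeasurable.mul hF.1) hF.norm ?_ ?_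
  · intro n
    filter_upwards with x
    rw [norm_mul, Real.norm_of_nonneg (h.nonneg n x)]
    exact mul_le_of_le_one_left (norm_nonneg _) (h.le_one n x)
  · filter_upwards with x
    simpa using (h.tendsto x).mul_const (F x)

theorem tendsto_div_add_one (C : ℝ) : Tendsto (fun n : ℕ => C / ((n : ℝ) + 1)) atTop (𝓝 0) :=
  by simpa [div_eq_mul_inv] using
    (tendsto_one_div_add_atTop_nhds_zero_nat (𝕜 := ℝ)).const_mul C

theorem tendsto_integral_partialD_mul (h : IsCutoffSeq χ) {F : E3 → ℝ} (hF : Integrable F volume)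
    (i : Fin 3) : Tendsto (fun n => ∫ x, partialD i (χ n) x * F x) atTop (𝓝 0) := by
  obtain ⟨C, hC0, hC⟩ := h.deriv_le
  refine squeeze_zero_norm (a := fun n : ℕ => C / ((n : ℝ) + 1) * ∫ x, ‖F x‖) ?_ ?_
  · intro n
    refine (norm_integral_le_of_norm_le (hF.norm.const_mul (C / ((n : ℝ) + 1))) ?_).trans_eq
      (integral_const_mul _ _)
    filter_upwards with x
    rw [norm_mul]
    exact mul_le_mul_of_nonneg_right (hC n x i) (norm_nonneg _)
  · simpa using (tendsto_div_add_one C).mul_const (∫ x, ‖F x‖)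

end IsCutoffSeq

/-! ### Averages of translates against a finite measure -/

section Average

variable {F : Type} [NormedAddCommGroup F]

/-- The average of the translates of `f` with respect to the measure `ν`. -/
def translateAvg [NormedSpace ℝ F] (ν : Measure E3) (f : E3 → F) (x : E3) : F := ∫ y, f (x + y) ∂ν

variable (ν : Measure E3)

theorem translateAvg_nonneg {f : E3 → ℝ} (hf : ∀ x, 0 ≤ f x) (x : E3) : 0 ≤ translateAvg ν f x :=
  integral_nonneg fun _ => hf _

theorem abs_translateAvg_le {f : E3 → ℝ} (x : E3) :
    |translateAvg ν f x| ≤ translateAvg ν (fun y => |f y|) x := by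
  unfold translateAvg
  exact abs_integral_le_integral_abs

variable [IsFiniteMeasure ν]

theorem integrable_translate {f : E3 → F} (hf : Continuous f) {M : ℝ} (hM : ∀ x, ‖f x‖ ≤ M)
    (x : E3) : Integrable (fun y => f (x + y)) ν :=
  .of_bound (by fun_prop : Continuous fun y => f (x + y)).aestronglyMeasurable M (.of_forall fun _ => hM _)

variable [NormedSpace ℝ F]

theorem continuous_translateAvg {f : E3 → F} (hf : Continuous f) {M : ℝ} (hM : ∀ x, ‖f x‖ ≤ M) :
    Continuous (translateAvg ν f) :=
  continuous_of_dominated (bound := fun _ => M)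
    (fun x => (integrable_translate ν hf hM x).1) (fun _ => .of_forall fun _ => hM _)
    (integrable_const M) (.of_forall fun _ => by fun_prop)

theorem norm_translateAvg_le {f : E3 → F} {M : ℝ} (hM : ∀ x, ‖f x‖ ≤ M) (x : E3) :
    ‖translateAvg ν f x‖ ≤ M * ν.real univ := by
  unfold translateAvg
  exact norm_integral_le_of_norm_le_const (.of_forall fun _ => hM _)

theorem hasFDerivAt_translateAvg {f : E3 → F} (hf : ContDiff ℝ 1 f) (hc : HasCompactSupport f)
    (x : E3) : HasFDerivAt (translateAvg ν f) (translateAvg ν (fderiv ℝ f) x) x := by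
  have hf' : Continuous (fderiv ℝ f) := hf.continuous_fderiv (by simp)
  obtain ⟨M, hM⟩ := hc.exists_bound_of_continuous hf.continuous
  obtain ⟨M', hM'⟩ := (hc.fderiv (𝕜 := ℝ)).exists_bound_of_continuous hf'
  refine hasFDerivAt_integral_of_dominated_of_fderiv_le (bound := fun _ => M')
    (F' := fun x y => fderiv ℝ f (x + y)) univ_mem
    (.of_forall fun x => (integrable_translate ν hf.continuous hM x).1)
    (integrable_translate ν hf.continuous hM x) (integrable_translate ν hf' hM' x).1
    (.of_forall fun _ _ _ => hM' _) (integrable_const _) (.of_forall fun y z _ => ?_)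
  exact (hasFDerivAt_comp_add_right y).2 (hf.differentiable (by simp) (z + y)).hasFDerivAt

theorem fderiv_translateAvg {f : E3 → F} (hf : ContDiff ℝ 1 f) (hc : HasCompactSupport f) :
    fderiv ℝ (translateAvg ν f) = translateAvg ν (fderiv ℝ f) :=
  funext fun x => (hasFDerivAt_translateAvg ν hf hc x).fderiv

theorem contDiff_translateAvg {f : E3 → F} (hf : ContDiff ℝ ∞ f) (hc : HasCompactSupport f) :
    ContDiff ℝ ∞ (translateAvg ν f) := by
  rw [contDiff_infty]
  intro n
  -- The codomain must vary, since the induction passes from `f` to `fderiv ℝ f`.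
  induction n generalizing F with
  | zero =>
    obtain ⟨M, hM⟩ := hc.exists_bound_of_continuous hf.continuous
    exact contDiff_zero.2 (continuous_translateAvg ν hf.continuous hM)
  | succ n ih =>
    have h1 : ContDiff ℝ 1 f := hf.of_le (by exact_mod_cast le_top)
    have : ContDiff ℝ ((n : ℕ∞ω) + 1) (translateAvg ν f) := by
      rw [contDiff_succ_iff_fderiv]
      refine ⟨fun x => (hasFDerivAt_translateAvg ν h1 hc x).differentiableAt, by simp, ?_⟩
      rw [fderiv_translateAvg ν h1 hc]
      exact ih (hf.fderiv_right (by simp)) (hc.fderiv (𝕜 := ℝ))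
    exact_mod_cast this

theorem partialD_translateAvg {f : E3 → ℝ} (hf : IsTestFunction f) (i : Fin 3) :
    partialD i (translateAvg ν f) = translateAvg ν (partialD i f) := by
  funext x
  have h1 : ContDiff ℝ 1 f := hf.1.of_le (by exact_mod_cast le_top)
  have hf' : Continuous (fderiv ℝ f) := h1.continuous_fderiv (by simp)
  obtain ⟨M', hM'⟩ := (hf.2.fderiv (𝕜 := ℝ)).exists_bound_of_continuous hf'
  unfold partialD
  rw [fderiv_translateAvg ν h1 hf.2]
  exact ContinuousLinearMap.integral_apply (integrable_translate ν hf' hM' x) _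

theorem integrable_translate_prod {f : E3 → ℝ} (hf : Continuous f) (hi : Integrable f volume) :
    Integrable (fun z : E3 × E3 => f (z.1 + z.2)) (volume.prod ν) := by
  have hm : AEStronglyMeasurable (fun z : E3 × E3 => f (z.1 + z.2)) (volume.prod ν) :=
    (by fun_prop : Continuous fun z : E3 × E3 => f (z.1 + z.2)).aestronglyMeasurable
  rw [integrable_prod_iff' hm]
  refine ⟨.of_forall fun y => hi.comp_add_right y, ?_⟩
  have : (fun y : E3 => ∫ x : E3, ‖f (x + y)‖) = fun _ => ∫ x, ‖f x‖ := by
    funext y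
    exact integral_add_right_eq_self (fun x => ‖f x‖) y
  simp only [this]
  exact integrable_const _

theorem integrable_translateAvg {f : E3 → ℝ} (hf : Continuous f) (hi : Integrable f volume) :
    Integrable (translateAvg ν f) volume :=
  (integrable_translate_prod ν hf hi).integral_prod_left

theorem integral_translateAvg {f : E3 → ℝ} (hf : Continuous f) (hi : Integrable f volume) :
    ∫ x, translateAvg ν f x = ν.real univ * ∫ x, f x := by
  unfold translateAvg
  rw [integral_integral_swap (integrable_translate_prod ν hf hi)]
  simp only [integral_add_right_eq_self f, integral_const, smul_eq_mul]

theorem integral_abs_translateAvg_le {f : E3 → ℝ} (hf : Continuous f) (hi : Integrable f volume) :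
    ∫ x, |translateAvg ν f x| ≤ ν.real univ * ∫ x, |f x| := by
  rw [← integral_translateAvg ν hf.abs hi.abs]
  exact integral_mono (integrable_translateAvg ν hf hi).abs (integrable_translateAvg ν hf.abs hi.abs)
    fun x => abs_translateAvg_le ν x

/-- Self-adjointness: Fubini, translation of the inner integral by `y`, then the symmetry of `ν` to
replace `-y` by `y`. -/
theorem integral_translateAvg_mul {f g : E3 → ℝ} (hf : Continuous f) {M : ℝ} (hM : ∀ x, ‖f x‖ ≤ M)
    (hg : Continuous g) (hi : Integrable g volume) (hν : ν.map (fun y => -y) = ν) :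
    ∫ x, translateAvg ν f x * g x = ∫ x, f x * translateAvg ν g x := by
  have hI : Integrable (fun z : E3 × E3 => f (z.1 + z.2) * g z.1) (volume.prod ν) := by
    have hg' : Integrable (fun z : E3 × E3 => g z.1) (volume.prod ν) := hi.comp_fst ν
    refine hg'.bdd_mul (c := M) ?_ (.of_forall fun z => hM _)
    exact (by fun_prop : Continuous fun z : E3 × E3 => f (z.1 + z.2)).aestronglyMeasurable
  have hI' : Integrable (fun z : E3 × E3 => f z.1 * g (z.1 + z.2)) (volume.prod ν) := by
    refine (integrable_translate_prod ν hg hi).bdd_mul (c := M) ?_ (.of_forall fun z => hM _)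
    exact (by fun_prop : Continuous fun z : E3 × E3 => f z.1).aestronglyMeasurable
  have h1 : ∀ x, translateAvg ν f x * g x = ∫ y, f (x + y) * g x ∂ν := fun x =>
    (integral_mul_const _ _).symm
  have h2 : ∀ x, f x * translateAvg ν g x = ∫ y, f x * g (x + y) ∂ν := fun x =>
    (integral_const_mul _ _).symm
  simp only [h1, h2]
  rw [integral_integral_swap hI,
    integral_integral_swap (f := fun x y => f x * g (x + y)) hI']
  have h3 : ∀ y, ∫ x : E3, f (x + y) * g x = ∫ x : E3, f x * g (x + -y) := by
    intro y
    rw [← integral_add_right_eq_self (fun x => f x * g (x + -y)) y]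
    simp
  simp only [h3]
  have h4 : AEStronglyMeasurable (fun y => ∫ x : E3, f x * g (x + y)) ν :=
    hI'.swap.integral_prod_left.1
  have h5 := integral_map (μ := ν) (φ := fun y : E3 => -y) (by fun_prop) (hν.symm ▸ h4)
  rw [hν] at h5
  exact h5.symm

end Average

/-! ### Interpolation and Jensen's inequality -/

/-- Interpolation between `L^1` and `L^∞`, from `|f|^r ≤ M^(r-1) |f|`. -/
theorem eLpNorm_le_of_bound {f : E3 → ℝ} {M : ℝ} (hM : ∀ x, ‖f x‖ ≤ M) {r : ℝ≥0∞} (hr : 1 ≤ r)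
    (hr' : r ≠ ⊤) : eLpNorm f r volume ≤
      (ENNReal.ofReal M ^ (r.toReal - 1) * eLpNorm f 1 volume) ^ (1 / r.toReal) := by
  have hr1 : 1 ≤ r.toReal := by
    rw [← ENNReal.toReal_one]
    exact ENNReal.toReal_mono hr' hr
  rw [eLpNorm_eq_lintegral_rpow_enorm_toReal (by positivity) hr', eLpNorm_one_eq_lintegral_enorm,
    ← lintegral_const_mul' _ _ (ENNReal.rpow_ne_top_of_nonneg (by linarith) ENNReal.ofReal_ne_top)]
  gcongr with x
  calc ‖f x‖ₑ ^ r.toReal = ‖f x‖ₑ ^ (r.toReal - 1) * ‖f x‖ₑ := by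
        conv_rhs => rw [← ENNReal.rpow_one ‖f x‖ₑ, ← ENNReal.rpow_mul, one_mul,
          ← ENNReal.rpow_add_of_nonneg _ _ (by linarith) zero_le_one]
        simp
    _ ≤ _ := by
        gcongr
        rw [← ofReal_norm]
        exact ENNReal.ofReal_le_ofReal (hM x)

theorem memLp_of_integrable_of_bound {f : E3 → ℝ} (hf : Integrable f volume) {M : ℝ}
    (hM : ∀ x, ‖f x‖ ≤ M) {r : ℝ≥0∞} (hr : 1 ≤ r) (hr' : r ≠ ⊤) : MemLp f r volume := by
  have hr1 : 1 ≤ r.toReal := by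
    rw [← ENNReal.toReal_one]
    exact ENNReal.toReal_mono hr' hr
  refine ⟨hf.1, (eLpNorm_le_of_bound hM hr hr').trans_lt ?_⟩
  refine ENNReal.rpow_lt_top_of_nonneg (by positivity) (ENNReal.mul_ne_top ?_ ?_)
  · exact ENNReal.rpow_ne_top_of_nonneg (by linarith) ENNReal.ofReal_ne_top
  · exact (memLp_one_iff_integrable.2 hf).2.ne

/-- Jensen's inequality for the convex function `y ↦ y^p`; this is where total mass one is needed.
-/
theorem rpow_translateAvg_le (ν : Measure E3) [IsProbabilityMeasure ν] {f : E3 → ℝ}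
    (hf : IsTestFunction f) (h0 : ∀ x, 0 ≤ f x) {p : ℝ} (hp : 1 ≤ p) (x : E3) :
    translateAvg ν f x ^ p ≤ translateAvg ν (fun y => f y ^ p) x := by
  obtain ⟨M, hM0, hM⟩ := hf.exists_bound
  have hc : Continuous fun y => f y ^ p := hf.continuous.rpow_const fun _ => .inr (by linarith)
  have hM' : ∀ y, ‖f y ^ p‖ ≤ M ^ p := fun y => by
    rw [Real.norm_of_nonneg (Real.rpow_nonneg (h0 y) p)]
    exact Real.rpow_le_rpow (h0 y) ((le_abs_self _).trans (hM y)) (by linarith)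
  exact (convexOn_rpow hp).map_integral_le (μ := ν) (f := fun y => f (x + y))
    (g := fun y : ℝ => y ^ p)
    (continuousOn_id.rpow_const fun _ _ => .inr (by linarith)) isClosed_Ici
    (.of_forall fun y => h0 _) (integrable_translate ν hf.continuous hM x)
    (integrable_translate ν hc hM' x)

theorem integrable_rpow {f : E3 → ℝ} (hf : IsTestFunction f) {p : ℝ} (hp : 1 ≤ p) :
    Integrable (fun y => |f y| ^ p) volume := by
  have hc : Continuous fun y => |f y| ^ p :=
    hf.continuous.abs.rpow_const fun _ => .inr (by linarith)
  refine hc.integrable_of_hasCompactSupport (hf.2.mono fun x hx => ?_)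
  contrapose! hx
  have : f x = 0 := by simpa using hx
  simp [this, Real.zero_rpow (by linarith : p ≠ 0)]

theorem integrable_rpow_translateAvg (ν : Measure E3) [IsProbabilityMeasure ν] {f : E3 → ℝ}
    (hf : IsTestFunction f) (h0 : ∀ x, 0 ≤ f x) {p : ℝ} (hp : 1 ≤ p) :
    Integrable (fun x => translateAvg ν f x ^ p) volume ∧
      ∫ x, translateAvg ν f x ^ p ≤ ∫ x, f x ^ p := by
  obtain ⟨M, hM0, hM⟩ := hf.exists_bound
  have hc : Continuous fun y => f y ^ p := hf.continuous.rpow_const fun _ => .inr (by linarith)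
  have hi : Integrable (fun y => f y ^ p) volume := by
    simpa only [abs_of_nonneg (h0 _)] using integrable_rpow hf hp
  have hI := integrable_translateAvg ν hc hi
  have hc' : Continuous fun x => translateAvg ν f x ^ p :=
    (continuous_translateAvg ν hf.continuous hM).rpow_const fun _ => .inr (by linarith)
  have h1 : Integrable (fun x => translateAvg ν f x ^ p) volume := by
    refine hI.mono' hc'.aestronglyMeasurable (.of_forall fun x => ?_)
    rw [Real.norm_of_nonneg (Real.rpow_nonneg (translateAvg_nonneg ν h0 x) p)]
    exact rpow_translateAvg_le ν hf h0 hp x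
  refine ⟨h1, ?_⟩
  calc _ ≤ ∫ x, translateAvg ν (fun y => f y ^ p) x :=
        integral_mono h1 hI fun x => rpow_translateAvg_le ν hf h0 hp x
    _ = _ := by rw [integral_translateAvg ν hc hi]; simp

/-! ### The Gaussian measure and the heat semigroup -/

/-- The density of the standard Gaussian measure on `E3`. -/
def gaussDensity (y : E3) : ℝ := (2 * Real.pi) ^ (-(3 / 2) : ℝ) * Real.exp (-(1 / 2) * ‖y‖ ^ 2)

theorem gaussDensity_pos (y : E3) : 0 < gaussDensity y := by
  unfold gaussDensity
  positivity

theorem contDiff_gaussDensity : ContDiff ℝ ∞ gaussDensity := by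
  unfold gaussDensity
  exact contDiff_const.mul (Real.contDiff_exp.comp (contDiff_const.mul (contDiff_norm_sq ℝ)))

theorem gaussDensity_le (y : E3) : gaussDensity y ≤ (2 * Real.pi) ^ (-(3 / 2) : ℝ) := by
  unfold gaussDensity
  refine mul_le_of_le_one_right (by positivity) (Real.exp_le_one_iff.2 ?_)
  nlinarith [sq_nonneg ‖y‖]

theorem partialD_gaussDensity (i : Fin 3) (y : E3) :
    partialD i gaussDensity y = - (y i * gaussDensity y) := by
  unfold partialD gaussDensity
  have h1 : HasFDerivAt (fun y : E3 => ‖y‖ ^ 2) (2 • innerSL ℝ y) y :=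
    (hasStrictFDerivAt_norm_sq y).hasFDerivAt
  have h2 := ((h1.const_mul (-(1 / 2) : ℝ)).exp).const_mul ((2 * Real.pi) ^ (-(3 / 2) : ℝ))
  rw [h2.fderiv]
  simp [EuclideanSpace.inner_single_right]
  ring

/-- The two measures have the same characteristic function. The density is needed for integration by
parts and for the decay in time. -/
theorem withDensity_gaussDensity :
    volume.withDensity (fun y => ENNReal.ofReal (gaussDensity y)) = stdGaussian E3 := by
  have hm : Measurable fun y => ENNReal.ofReal (gaussDensity y) :=
    contDiff_gaussDensity.continuous.measurable.ennreal_ofReal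
  have hi : ∫ y, gaussDensity y = 1 := by
    unfold gaussDensity
    rw [integral_const_mul, GaussianFourier.integral_rexp_neg_mul_sq_norm (by norm_num)]
    rw [show Real.pi / (1 / 2) = 2 * Real.pi by ring, ← Real.rpow_add (by positivity)]
    simp
  -- A non-integrable function would have integral `0` by convention, contradicting the value `1`.
  have hint : Integrable gaussDensity volume := by
    by_contra h
    rw [integral_undef h] at hi
    norm_num at hi
  have : IsFiniteMeasure (volume.withDensity (fun y => ENNReal.ofReal (gaussDensity y))) :=
    isFiniteMeasure_withDensity_ofReal hint.2
  refine Measure.ext_of_charFun (funext fun t => ?_)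
  rw [charFun_stdGaussian, charFun_apply,
    integral_withDensity_eq_integral_toReal_smul hm (.of_forall fun _ => ENNReal.ofReal_lt_top)]
  have h := GaussianFourier.integral_cexp_neg_mul_sq_norm_add (b := 1 / 2) (V := E3) (by norm_num)
    Complex.I t
  have h2 : ((2 * Real.pi : ℝ) : ℂ) = Real.pi / (1 / 2) := by push_cast; ring
  calc _ = ∫ y : E3, ((2 * Real.pi : ℝ) : ℂ) ^ (-(3 / 2) : ℂ) *
      Complex.exp (-(1 / 2) * ‖y‖ ^ 2 + Complex.I * ((inner ℝ t y : ℝ) : ℂ)) := by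
        congr 1
        funext y
        rw [ENNReal.toReal_ofReal (gaussDensity_pos y).le, Complex.exp_add, gaussDensity,
          Complex.real_smul, real_inner_comm]
        push_cast [Complex.ofReal_cpow (by positivity : (0 : ℝ) ≤ 2 * Real.pi)]
        ring_nf
    _ = _ := by
        rw [integral_const_mul, h, ← h2, ← mul_assoc, ← Complex.cpow_add _ _ (by
          simp [Real.pi_ne_zero])]
        simp only [finrank_euclideanSpace, Fintype.card_fin, Nat.cast_ofNat, neg_add_cancel,
          Complex.cpow_zero, one_mul, Complex.I_sq]
        congr 1
        ring

theorem integral_stdGaussian (F : E3 → ℝ) :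
    ∫ y, F y ∂(stdGaussian E3) = ∫ y, gaussDensity y * F y := by
  have hm : Measurable fun y => ENNReal.ofReal (gaussDensity y) :=
    contDiff_gaussDensity.continuous.measurable.ennreal_ofReal
  rw [← withDensity_gaussDensity,
    integral_withDensity_eq_integral_toReal_smul hm (.of_forall fun _ => ENNReal.ofReal_lt_top)]
  simp [ENNReal.toReal_ofReal (gaussDensity_pos _).le]

/-- Gaussian integration by parts. -/
theorem integral_coord_mul_stdGaussian {F : E3 → ℝ} (hF : IsTestFunction F) (i : Fin 3) :
    ∫ y, y i * F y ∂(stdGaussian E3) = ∫ y, partialD i F y ∂(stdGaussian E3) := by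
  rw [integral_stdGaussian, integral_stdGaussian, integral_mul_partialD
    (contDiff_gaussDensity.of_le (by exact_mod_cast le_top))
    (hF.1.of_le (by exact_mod_cast le_top)) hF.2, ← integral_neg]
  congr 1
  funext y
  rw [partialD_gaussDensity]
  ring

/-- The Gaussian measure of variance `t`. -/
def gaussMeasure (t : ℝ) : Measure E3 := (stdGaussian E3).map (fun y => √t • y)

instance (t : ℝ) : IsProbabilityMeasure (gaussMeasure t) :=
  Measure.isProbabilityMeasure_map (by fun_prop)

theorem gaussMeasure_neg (t : ℝ) : (gaussMeasure t).map (fun y => -y) = gaussMeasure t := by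
  unfold gaussMeasure
  rw [Measure.map_map (by fun_prop) (by fun_prop)]
  conv_rhs => rw [← stdGaussian_map (LinearIsometryEquiv.neg ℝ (E := E3))]
  rw [Measure.map_map (by fun_prop) (by fun_prop)]
  congr 1
  funext y
  simp

/-- The characteristic function is `exp(-t‖ξ‖²/2)`, so convolution adds the variances; this is the
semigroup law. -/
theorem gaussMeasure_conv {s t : ℝ} (hs : 0 ≤ s) (ht : 0 ≤ t) :
    gaussMeasure s ∗ gaussMeasure t = gaussMeasure (s + t) := by
  refine Measure.ext_of_charFun (funext fun ξ => ?_)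
  have h : ∀ r : ℝ, 0 ≤ r → charFun (gaussMeasure r) ξ = Complex.exp (-(r * ‖ξ‖ ^ 2) / 2) := by
    intro r hr
    unfold gaussMeasure
    rw [charFun_map_smul, charFun_stdGaussian, norm_smul, Real.norm_of_nonneg (Real.sqrt_nonneg r)]
    congr 2
    push_cast
    rw [mul_pow, ← Complex.ofReal_pow, Real.sq_sqrt hr]
  rw [charFun_conv, h s hs, h t ht, h _ (add_nonneg hs ht), ← Complex.exp_add]
  congr 1
  push_cast
  ring

/-- The heat semigroup, generated by half of the Laplacian. -/
def heat (t : ℝ) (f : E3 → ℝ) : E3 → ℝ := translateAvg (gaussMeasure t) f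

theorem heat_apply {f : E3 → ℝ} (hf : Continuous f) (t : ℝ) (x : E3) :
    heat t f x = ∫ y, f (x + √t • y) ∂(stdGaussian E3) := by
  unfold heat translateAvg gaussMeasure
  rw [integral_map (by fun_prop)]
  exact (by fun_prop : Continuous fun y => f (x + y)).aestronglyMeasurable

theorem heat_heat {f : E3 → ℝ} (hf : Continuous f) {M : ℝ} (hM : ∀ x, ‖f x‖ ≤ M) {s t : ℝ}
    (hs : 0 ≤ s) (ht : 0 ≤ t) : heat s (heat t f) = heat (s + t) f := by
  funext x
  unfold heat translateAvg
  rw [← gaussMeasure_conv hs ht, integral_conv]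
  · simp only [add_assoc]
  · exact .of_bound (by fun_prop : Continuous fun y => f (x + y)).aestronglyMeasurable M
      (.of_forall fun _ => hM _)

theorem continuous_heat {f : E3 → ℝ} (hf : Continuous f) {M : ℝ} (hM : ∀ x, ‖f x‖ ≤ M) :
    Continuous fun z : ℝ × E3 => heat z.1 f z.2 := by
  simp only [heat_apply hf]
  refine continuous_of_dominated (bound := fun _ => M) (fun x => ?_)
    (fun _ => .of_forall fun _ => hM _) (integrable_const M) (.of_forall fun _ => by fun_prop)
  exact Continuous.aestronglyMeasurable (by fun_prop)

theorem IsTestFunction.comp_affine {f : E3 → ℝ} (hf : IsTestFunction f) (x : E3) {c : ℝ}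
    (hc : c ≠ 0) : IsTestFunction fun y => f (x + c • y) := by
  refine ⟨hf.1.comp (by fun_prop), ?_⟩
  have h1 : HasCompactSupport fun y => f (x + y) :=
    hf.2.comp_homeomorph (Homeomorph.addLeft x)
  exact h1.comp_smul hc

theorem partialD_comp_affine {f : E3 → ℝ} (hf : Differentiable ℝ f) (x : E3) (c : ℝ) (i : Fin 3)
    (y : E3) : partialD i (fun y => f (x + c • y)) y = c * partialD i f (x + c • y) := by
  have h := partialD_comp_smul (f := fun y => f (x + y)) (hf.comp (by fun_prop)) c i y
  rw [h]
  unfold partialD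
  rw [fderiv_comp_add_left]

theorem fderiv_apply_eq_sum {f : E3 → ℝ} (x y : E3) :
    fderiv ℝ f x y = ∑ i, y i * partialD i f x := by
  conv_lhs => rw [← (EuclideanSpace.basisFun (Fin 3) ℝ).sum_repr y]
  simp [partialD]

/-- The Laplacian. -/
def lap (f : E3 → ℝ) (x : E3) : ℝ := ∑ i, partialD i (partialD i f) x

theorem isTestFunction_lap {f : E3 → ℝ} (hf : IsTestFunction f) : IsTestFunction (lap f) := by
  have : lap f = fun x => partialD 0 (partialD 0 f) x + partialD 1 (partialD 1 f) x +
      partialD 2 (partialD 2 f) x := by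
    funext x
    simp [lap, Fin.sum_univ_three]
  rw [this]
  exact (((hf.partialD 0).partialD 0).add ((hf.partialD 1).partialD 1)).add
    ((hf.partialD 2).partialD 2)

/-- The heat equation. -/
theorem hasDerivAt_heat {f : E3 → ℝ} (hf : IsTestFunction f) {t : ℝ} (ht : 0 < t) (x : E3) :
    HasDerivAt (fun s => heat s f x) (1 / 2 * heat t (lap f) x) t := by
  have h1 : ContDiff ℝ 1 f := hf.1.of_le (by exact_mod_cast le_top)
  have hf' : Continuous (fderiv ℝ f) := h1.continuous_fderiv (by simp)
  obtain ⟨M, hM0, hM⟩ := hf.exists_bound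
  obtain ⟨M', hM'⟩ := (hf.2.fderiv (𝕜 := ℝ)).exists_bound_of_continuous hf'
  have hst : 0 < √(t / 2) := Real.sqrt_pos.2 (by linarith)
  have hid : Integrable (fun y : E3 => ‖y‖) (stdGaussian E3) := IsGaussian.integrable_id.norm
  -- With `Pₛ f(x)` written as the Gaussian mean of `f(x + √s y)`, the integrand is differentiated
  -- in `s`. Restricting to `s > t/2` keeps the factor `1/(2√s)` bounded, and `‖y‖` is integrable.
  have key := (hasDerivAt_integral_of_dominated_loc_of_deriv_le (μ := stdGaussian E3)
    (F := fun s y => f (x + √s • y))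
    (F' := fun s y => fderiv ℝ f (x + √s • y) ((1 / (2 * √s)) • y))
    (s := Ioi (t / 2)) (x₀ := t) (bound := fun y => M' * (1 / (2 * √(t / 2)) * ‖y‖))
    (Ioi_mem_nhds (by linarith)) (.of_forall fun s => ?_) ?_ ?_ ?_ ?_ ?_).2
  · have e0 : (fun s => ∫ y, f (x + √s • y) ∂(stdGaussian E3)) = fun s => heat s f x :=
      funext fun s => (heat_apply hf.continuous s x).symm
    rw [e0] at key
    refine key.congr_deriv (Eq.symm ?_)
    have e1 : ∀ y : E3, fderiv ℝ f (x + √t • y) ((1 / (2 * √t)) • y) =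
        ∑ i, (1 / (2 * √t)) * (y i * partialD i f (x + √t • y)) := by
      intro y
      rw [map_smul, fderiv_apply_eq_sum, smul_eq_mul, Finset.mul_sum]
    have hpos : 0 < √t := Real.sqrt_pos.2 ht
    simp only [e1]
    rw [integral_finsetSum]
    · simp only [integral_const_mul]
      -- Gaussian integration by parts trades `yᵢ` for a derivative; its factor `√t` cancels against
      -- `1/(2√t)` and leaves `1/2`.
      have e2 : ∀ i, ∫ y : E3, y i * partialD i f (x + √t • y) ∂(stdGaussian E3) =
          √t * heat t (partialD i (partialD i f)) x := by
        intro i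
        have hT := hf.partialD i
        rw [integral_coord_mul_stdGaussian (hT.comp_affine x hpos.ne'),
          heat_apply (hT.partialD i).continuous, ← integral_const_mul]
        simp only [partialD_comp_affine hT.differentiable]
      simp only [e2]
      rw [← Finset.mul_sum, ← Finset.mul_sum, ← mul_assoc]
      congr 1
      · field_simp
      · rw [heat_apply (isTestFunction_lap hf).continuous]
        unfold lap
        rw [integral_finsetSum]
        · exact Finset.sum_congr rfl fun i _ =>
            (heat_apply ((hf.partialD i).partialD i).continuous t x).symm
        · intro i _
          have hT := ((hf.partialD i).partialD i).comp_affine x hpos.ne'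
          obtain ⟨B, _, hB⟩ := hT.exists_bound
          exact .of_bound hT.continuous.aestronglyMeasurable B (.of_forall hB)
    · intro i _
      refine Integrable.const_mul ?_ _
      have hT := (hf.partialD i).comp_affine x hpos.ne'
      obtain ⟨B, _, hB⟩ := hT.exists_bound
      refine Integrable.mul_bdd (c := B) ?_ hT.continuous.aestronglyMeasurable (.of_forall hB)
      refine hid.mono' (by fun_prop) (.of_forall fun y => ?_)
      exact PiLp.norm_apply_le y i
  · have := hf.continuous
    exact Continuous.aestronglyMeasurable (by fun_prop)
  · have := hf.continuous
    exact .of_bound (Continuous.aestronglyMeasurable (by fun_prop)) M (.of_forall fun y => hM _)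
  · exact Continuous.aestronglyMeasurable (by fun_prop)
  · refine .of_forall fun y s hs => ?_
    have hs' : √(t / 2) ≤ √s := Real.sqrt_le_sqrt (le_of_lt hs)
    refine (ContinuousLinearMap.le_opNorm _ _).trans ?_
    rw [norm_smul, Real.norm_of_nonneg (by positivity)]
    have : 0 ≤ M' := (norm_nonneg _).trans (hM' 0)
    gcongr
    exact hM' _
  · exact (hid.const_mul _).const_mul _
  · refine .of_forall fun y s hs => ?_
    have hs0 : 0 < s := lt_trans (by linarith) (mem_Ioi.1 hs)
    have hd : HasDerivAt (fun s : ℝ => x + √s • y) ((1 / (2 * √s)) • y) s :=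
      ((Real.hasDerivAt_sqrt hs0.ne').smul_const y).const_add x
    exact ((h1.differentiable (by simp) _).hasFDerivAt).comp_hasDerivAt s hd

/-- Strict positivity keeps the flow in the open quadrant, where the Bellman function is smooth. -/
theorem heat_pos {f : E3 → ℝ} (hf : IsTestFunction f) (h0 : ∀ x, 0 ≤ f x) (hne : f ≠ 0) {t : ℝ}
    (ht : 0 < t) (x : E3) : 0 < heat t f x := by
  have hpos : 0 < √t := Real.sqrt_pos.2 ht
  have hT := hf.comp_affine x hpos.ne'
  rw [heat_apply hf.continuous, integral_stdGaussian]
  obtain ⟨z, hz⟩ := Function.ne_iff.1 hne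
  refine Continuous.integral_pos_of_hasCompactSupport_nonneg_nonzero
    (contDiff_gaussDensity.continuous.mul hT.continuous) hT.2.mul_left
    (fun y => mul_nonneg (gaussDensity_pos y).le (h0 _)) (x := (√t)⁻¹ • (z - x)) ?_
  refine mul_ne_zero (gaussDensity_pos _).ne' ?_
  rw [smul_inv_smul₀ hpos.ne']
  simpa using hz

/-- Decay of the heat semigroup. -/
theorem abs_heat_le {f : E3 → ℝ} (hf : IsTestFunction f) {t : ℝ} (ht : 0 < t) (x : E3) :
    |heat t f x| ≤ (√t)⁻¹ ^ 3 * ((2 * Real.pi) ^ (-(3 / 2) : ℝ) * ∫ y, |f y|) := by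
  have hpos : 0 < √t := Real.sqrt_pos.2 ht
  have hT := hf.comp_affine x hpos.ne'
  rw [heat_apply hf.continuous, integral_stdGaussian]
  calc _ ≤ ∫ y, (2 * Real.pi) ^ (-(3 / 2) : ℝ) * |f (x + √t • y)| := by
        refine norm_integral_le_of_norm_le (G := ℝ) (hT.integrable.abs.const_mul _) (.of_forall fun y => ?_)
        rw [norm_mul, Real.norm_of_nonneg (gaussDensity_pos y).le]
        exact mul_le_mul_of_nonneg_right (gaussDensity_le y) (norm_nonneg _)
    _ = _ := by
        rw [integral_const_mul,
          Measure.integral_comp_smul volume (fun y => |f (x + y)|) (√t),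
          integral_add_left_eq_self (fun y => |f y|) x]
        rw [smul_eq_mul, finrank_euclideanSpace, Fintype.card_fin, abs_of_pos (by positivity),
          inv_pow]
        ring

/-- Strong continuity of the heat semigroup at time zero, in the supremum norm. -/
theorem abs_heat_sub_le {f : E3 → ℝ} (hf : IsTestFunction f) : ∃ C, 0 ≤ C ∧ ∀ t x,
    |heat t f x - f x| ≤ C * √t := by
  have h1 : ContDiff ℝ 1 f := hf.1.of_le (by exact_mod_cast le_top)
  obtain ⟨M, hM0, hM⟩ := hf.exists_bound
  obtain ⟨M', hM'⟩ := (hf.2.fderiv (𝕜 := ℝ)).exists_bound_of_continuous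
    (h1.continuous_fderiv (by simp))
  have hM'0 : 0 ≤ M' := (norm_nonneg _).trans (hM' 0)
  have hid : Integrable (fun y : E3 => ‖y‖) (stdGaussian E3) := IsGaussian.integrable_id.norm
  refine ⟨M' * ∫ y, ‖y‖ ∂(stdGaussian E3),
    mul_nonneg hM'0 (integral_nonneg fun _ => norm_nonneg _), fun t x => ?_⟩
  have hc := hf.continuous
  have hi : Integrable (fun y => f (x + √t • y)) (stdGaussian E3) :=
    .of_bound (Continuous.aestronglyMeasurable (by fun_prop)) M (.of_forall fun y => hM _)
  have h2 : heat t f x - f x = ∫ y, (f (x + √t • y) - f x) ∂(stdGaussian E3) := by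
    rw [integral_sub hi (integrable_const _), heat_apply hc]
    simp
  rw [h2]
  calc _ ≤ ∫ y, M' * √t * ‖y‖ ∂(stdGaussian E3) := by
        refine norm_integral_le_of_norm_le (G := ℝ) (hid.const_mul _) (.of_forall fun y => ?_)
        have := Convex.norm_image_sub_le_of_norm_fderiv_le (𝕜 := ℝ) (s := univ) (f := f)
          (x := x) (y := x + √t • y)
          (fun z _ => h1.differentiable (by simp) z) (fun z _ => hM' z) convex_univ
          (mem_univ _) (mem_univ _)
        rwa [add_sub_cancel_left, norm_smul, Real.norm_of_nonneg (Real.sqrt_nonneg t),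
          ← mul_assoc] at this
    _ = _ := by
        rw [integral_const_mul]
        ring

/-! ### The Bellman function and its convexity -/

namespace Bellman

/-- The inner power sum of the Bellman function. -/
def S (p q x y : ℝ) : ℝ := x ^ p + y ^ q

/-- The small parameter of the Bellman function. -/
def δ (q : ℝ) : ℝ := q * (q - 1) / 32

/-- The exponent of the correction term. -/
def θ (p : ℝ) : ℝ := 1 - 2 / p

/-- A variant of the Nazarov-Treil Bellman function, smooth on the open quadrant. -/
def Q (p q x y : ℝ) : ℝ := S p q x y + δ q * (x ^ 2 * S p q x y ^ θ p)

/-- `∂Q/∂x`. -/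
def Qx (p q x y : ℝ) : ℝ :=
  p * x ^ (p - 1) + δ q * (2 * x * S p q x y ^ θ p +
    x ^ 2 * (θ p * S p q x y ^ (θ p - 1) * (p * x ^ (p - 1))))

/-- `∂Q/∂y`. -/
def Qy (p q x y : ℝ) : ℝ :=
  q * y ^ (q - 1) + δ q * (x ^ 2 * (θ p * S p q x y ^ (θ p - 1) * (q * y ^ (q - 1))))

/-- `∂²Q/∂x²`. -/
def Qxx (p q x y : ℝ) : ℝ :=
  p * ((p - 1) * x ^ (p - 1 - 1)) + δ q * (2 * S p q x y ^ θ p +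
    4 * x * (θ p * S p q x y ^ (θ p - 1) * (p * x ^ (p - 1))) +
    x ^ 2 * θ p * ((θ p - 1) * S p q x y ^ (θ p - 1 - 1) * (p * x ^ (p - 1)) ^ 2 +
      S p q x y ^ (θ p - 1) * (p * ((p - 1) * x ^ (p - 1 - 1)))))

/-- `∂²Q/∂x∂y`. -/
def Qxy (p q x y : ℝ) : ℝ :=
  δ q * (2 * x * (θ p * S p q x y ^ (θ p - 1) * (q * y ^ (q - 1))) +
    x ^ 2 * θ p * ((θ p - 1) * S p q x y ^ (θ p - 1 - 1) * (p * x ^ (p - 1)) * (q * y ^ (q - 1))))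

/-- `∂²Q/∂y²`. -/
def Qyy (p q x y : ℝ) : ℝ :=
  q * ((q - 1) * y ^ (q - 1 - 1)) + δ q * (x ^ 2 * θ p *
    ((θ p - 1) * S p q x y ^ (θ p - 1 - 1) * (q * y ^ (q - 1)) ^ 2 +
      S p q x y ^ (θ p - 1) * (q * ((q - 1) * y ^ (q - 1 - 1)))))

/-- The Hessian of `Q` as a quadratic form. -/
def hess (p q x y a b : ℝ) : ℝ :=
  Qxx p q x y * a ^ 2 + 2 * Qxy p q x y * (a * b) + Qyy p q x y * b ^ 2

section Derivatives

variable {E : Type*} [NormedAddCommGroup E] [NormedSpace ℝ E] {u v : E → ℝ} {u' v' : E →L[ℝ] ℝ}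
  {z : E} (p q : ℝ)

theorem S_pos {x y : ℝ} (hx : 0 < x) (hy : 0 < y) : 0 < S p q x y := by
  unfold S
  positivity

theorem hasFDerivAt_S (hu : HasFDerivAt u u' z) (hv : HasFDerivAt v v' z) (hu0 : 0 < u z)
    (hv0 : 0 < v z) : HasFDerivAt (fun w => S p q (u w) (v w))
      ((p * u z ^ (p - 1)) • u' + (q * v z ^ (q - 1)) • v') z :=
  (hu.rpow_const (.inl hu0.ne')).add (hv.rpow_const (.inl hv0.ne'))

theorem hasFDerivAt_Q (hu : HasFDerivAt u u' z) (hv : HasFDerivAt v v' z) (hu0 : 0 < u z)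
    (hv0 : 0 < v z) : HasFDerivAt (fun w => Q p q (u w) (v w))
      (Qx p q (u z) (v z) • u' + Qy p q (u z) (v z) • v') z := by
  have hS := hasFDerivAt_S p q hu hv hu0 hv0
  have hS' := hS.rpow_const (p := θ p) (.inl (S_pos p q hu0 hv0).ne')
  refine (hS.add (((hu.pow 2).mul hS').const_mul (δ q))).congr_fderiv ?_
  ext w
  simp [Qx, Qy]
  ring

theorem hasFDerivAt_Qx (hu : HasFDerivAt u u' z) (hv : HasFDerivAt v v' z) (hu0 : 0 < u z)
    (hv0 : 0 < v z) : HasFDerivAt (fun w => Qx p q (u w) (v w))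
      (Qxx p q (u z) (v z) • u' + Qxy p q (u z) (v z) • v') z := by
  have hS := hasFDerivAt_S p q hu hv hu0 hv0
  have hS' := hS.rpow_const (p := θ p) (.inl (S_pos p q hu0 hv0).ne')
  have hS'' := hS.rpow_const (p := θ p - 1) (.inl (S_pos p q hu0 hv0).ne')
  have hX := (hu.rpow_const (p := p - 1) (.inl hu0.ne')).const_mul p
  refine (hX.add ((((hu.const_mul 2).mul hS').add ((hu.pow 2).mul
    ((hS''.const_mul (θ p)).mul hX))).const_mul (δ q))).congr_fderiv ?_
  ext w
  simp [Qxx, Qxy]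
  ring

theorem hasFDerivAt_Qy (hu : HasFDerivAt u u' z) (hv : HasFDerivAt v v' z) (hu0 : 0 < u z)
    (hv0 : 0 < v z) : HasFDerivAt (fun w => Qy p q (u w) (v w))
      (Qxy p q (u z) (v z) • u' + Qyy p q (u z) (v z) • v') z := by
  have hS := hasFDerivAt_S p q hu hv hu0 hv0
  have hS'' := hS.rpow_const (p := θ p - 1) (.inl (S_pos p q hu0 hv0).ne')
  have hY := (hv.rpow_const (p := q - 1) (.inl hv0.ne')).const_mul q
  refine (hY.add (((hu.pow 2).mul ((hS''.const_mul (θ p)).mul hY)).const_mul (δ q))).congr_fderiv ?_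
  ext w
  simp [Qxy, Qyy]
  ring

theorem contDiff_Q {n : ℕ∞ω} (hu : ContDiff ℝ n u) (hv : ContDiff ℝ n v) (hu0 : ∀ w, 0 < u w)
    (hv0 : ∀ w, 0 < v w) : ContDiff ℝ n (fun w => Q p q (u w) (v w)) := by
  have hS : ContDiff ℝ n (fun w => S p q (u w) (v w)) :=
    (hu.rpow_const_of_ne fun w => (hu0 w).ne').add (hv.rpow_const_of_ne fun w => (hv0 w).ne')
  exact hS.add (contDiff_const.mul ((hu.pow 2).mul
    (hS.rpow_const_of_ne fun w => (S_pos p q (hu0 w) (hv0 w)).ne')))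

end Derivatives

section Convexity

variable {p q : ℝ}

/-- The right-hand side is the Hessian form of `x² S^t` divided by `x² S^t`, in the logarithmic
increments `α = a/x`, `β = b/y`, with `ξ = x^p/S` and `η = y^q/S`. The square is split by `(A + B)²
≤ 2A² + 2B²`. Because `p(1 - t) = 2` and `ξ² ≤ ξ`, its `α²` part is absorbed by `4tpξα²`. The mixed
term is absorbed by completing a square with one of the two `α²`. What remains is at most `16η²β²`,
since `q ≤ 2`. -/
theorem bracket_ge {p q t α β ξ η : ℝ} (ht0 : 0 ≤ t) (ht1 : t ≤ 1) (hp : 2 ≤ p)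
    (hpt : p * (1 - t) = 2) (hq1 : 1 < q) (hq2 : q ≤ 2) (hξ : 0 < ξ) (hη : 0 < η)
    (hsum : ξ + η = 1) :
    α ^ 2 - 16 * η ^ 2 * β ^ 2 ≤ 2 * α ^ 2 + 4 * t * α * (p * ξ * α + q * η * β)
      - t * (1 - t) * (p * ξ * α + q * η * β) ^ 2 + t * (p * (p - 1) * ξ * α ^ 2) +
      t * (q * (q - 1) * η * β ^ 2) := by
  have e1 : (p * ξ * α + q * η * β) ^ 2 ≤ 2 * (p * ξ * α) ^ 2 + 2 * (q * η * β) ^ 2 := by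
    nlinarith [sq_nonneg (p * ξ * α - q * η * β)]
  have e2 : t * (1 - t) * (p * ξ * α + q * η * β) ^ 2 ≤
      t * (1 - t) * (2 * (p * ξ * α) ^ 2 + 2 * (q * η * β) ^ 2) :=
    mul_le_mul_of_nonneg_left e1 (mul_nonneg ht0 (by linarith))
  have e3 : t * (1 - t) * (2 * (p * ξ * α) ^ 2) = 4 * t * p * ξ ^ 2 * α ^ 2 := by
    linear_combination (2 * t * p * ξ ^ 2 * α ^ 2) * hpt
  have e4 : 4 * t * p * ξ ^ 2 * α ^ 2 ≤ 4 * t * p * ξ * α ^ 2 := by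
    have : ξ ^ 2 ≤ ξ := by nlinarith
    have h4 : 0 ≤ 4 * t * p * α ^ 2 := by positivity
    nlinarith [mul_le_mul_of_nonneg_left this h4]
  have e5 : 0 ≤ t * (p * (p - 1) * ξ * α ^ 2) :=
    mul_nonneg ht0 (mul_nonneg (mul_nonneg (mul_nonneg (by linarith) (by linarith)) hξ.le)
      (sq_nonneg _))
  have e6 : 0 ≤ t * (q * (q - 1) * η * β ^ 2) :=
    mul_nonneg ht0 (mul_nonneg (mul_nonneg (mul_nonneg (by linarith) (by linarith)) hη.le)
      (sq_nonneg _))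
  have e7 : 0 ≤ (α + 2 * t * (q * η * β)) ^ 2 := sq_nonneg _
  have e8 : (4 * t ^ 2 + 2 * t * (1 - t)) * (q * η * β) ^ 2 ≤ 16 * η ^ 2 * β ^ 2 := by
    have h1 : 4 * t ^ 2 + 2 * t * (1 - t) ≤ 4 := by nlinarith
    have h2 : q ^ 2 ≤ 4 := by nlinarith
    have h3 : (q * η * β) ^ 2 ≤ 4 * (η ^ 2 * β ^ 2) := by
      have : (q * η * β) ^ 2 = q ^ 2 * (η ^ 2 * β ^ 2) := by ring
      rw [this]
      exact mul_le_mul_of_nonneg_right h2 (by positivity)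
    calc _ ≤ 4 * (q * η * β) ^ 2 := mul_le_mul_of_nonneg_right h1 (sq_nonneg _)
      _ ≤ _ := by linarith
  linear_combination e2 + e3 + e4 + e5 + e6 + e7 + e8

/-- The algebraic core of `hess_ge`: `X`, `Y`, `T` stand for `x^p`, `y^q`, `S^θ`, so that no real
powers occur. The constant 32 in `δ` is `16 + 16`: the main term `q(q-1)Yβ² = 32δYβ²` pays for the
loss `16δYβ²` of `bracket_ge` and leaves the same amount in the conclusion. -/
theorem hess_alg {p q t x y X Y T a b : ℝ} (ht0 : 0 ≤ t) (ht1 : t ≤ 1) (hp : 2 ≤ p)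
    (hpt : p * (1 - t) = 2) (hq1 : 1 < q) (hq2 : q ≤ 2) (hx : 0 < x) (hy : 0 < y) (hX : 0 < X)
    (hY : 0 < Y) (hT : 0 < T) (hxT : x ^ 2 * T ≤ X + Y) :
    δ q * (T * a ^ 2) + 16 * δ q * (Y / y ^ 2 * b ^ 2) ≤
      (p * ((p - 1) * (X / x ^ 2)) + δ q * (2 * T +
        4 * x * (t * (T / (X + Y)) * (p * (X / x))) +
        x ^ 2 * t * ((t - 1) * (T / (X + Y) ^ 2) * (p * (X / x)) ^ 2 +
        (T / (X + Y)) * (p * ((p - 1) * (X / x ^ 2)))))) * a ^ 2 +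
      2 * (δ q * (2 * x * (t * (T / (X + Y)) * (q * (Y / y))) +
        x ^ 2 * t * ((t - 1) * (T / (X + Y) ^ 2) * (p * (X / x)) * (q * (Y / y))))) * (a * b) +
      (q * ((q - 1) * (Y / y ^ 2)) + δ q * (x ^ 2 * t *
        ((t - 1) * (T / (X + Y) ^ 2) * (q * (Y / y)) ^ 2 +
        (T / (X + Y)) * (q * ((q - 1) * (Y / y ^ 2)))))) * b ^ 2 := by
  obtain ⟨α, rfl⟩ : ∃ α, a = x * α := ⟨a / x, by field_simp⟩
  obtain ⟨β, rfl⟩ : ∃ β, b = y * β := ⟨b / y, by field_simp⟩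
  obtain ⟨s, hs⟩ : ∃ s, s = X + Y := ⟨_, rfl⟩
  rw [← hs] at hxT ⊢
  have hs0 : 0 < s := by rw [hs]; positivity
  obtain ⟨ξ, rfl⟩ : ∃ ξ, X = s * ξ := ⟨X / s, by field_simp⟩
  obtain ⟨η, rfl⟩ : ∃ η, Y = s * η := ⟨Y / s, by field_simp⟩
  have hsum : ξ + η = 1 := by
    have : s * (ξ + η) = s * 1 := by linarith
    exact mul_left_cancel₀ hs0.ne' this
  have hξ : 0 < ξ := pos_of_mul_pos_right hX hs0.le
  have hη : 0 < η := pos_of_mul_pos_right hY hs0.le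
  have hδ : 0 < δ q := by unfold δ; nlinarith
  set W := x ^ 2 * T with hW
  have hW0 : 0 < W := by positivity
  have hbr := bracket_ge (α := α) (β := β) ht0 ht1 hp hpt hq1 hq2 hξ hη hsum
  -- This converts the loss `16η²β²` of the bracket, weighted by `W = x²T ≤ s`, into a multiple of
  -- `Yβ² = sηβ²`.
  have hWη : W * η ^ 2 ≤ s * η := by
    have : η ^ 2 ≤ η := by nlinarith
    calc W * η ^ 2 ≤ s * η ^ 2 := mul_le_mul_of_nonneg_right hxT (sq_nonneg _)
      _ ≤ _ := mul_le_mul_of_nonneg_left this hs0.le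
  have h5 : 16 * (W * η ^ 2) * β ^ 2 ≤ 16 * (s * η) * β ^ 2 :=
    mul_le_mul_of_nonneg_right (by linarith) (sq_nonneg _)
  have h6 := mul_le_mul_of_nonneg_left hbr hW0.le
  have h7 : 0 ≤ p * (p - 1) * (s * ξ) * α ^ 2 :=
    mul_nonneg (mul_nonneg (mul_nonneg (by linarith) (by linarith)) (by positivity)) (sq_nonneg _)
  have hδq : q * (q - 1) = 32 * δ q := by unfold δ; ring
  have hR : (p * ((p - 1) * (s * ξ / x ^ 2)) + δ q * (2 * T +
        4 * x * (t * (T / s) * (p * (s * ξ / x))) +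
        x ^ 2 * t * ((t - 1) * (T / s ^ 2) * (p * (s * ξ / x)) ^ 2 +
        (T / s) * (p * ((p - 1) * (s * ξ / x ^ 2)))))) * (x * α) ^ 2 +
      2 * (δ q * (2 * x * (t * (T / s) * (q * (s * η / y))) +
        x ^ 2 * t * ((t - 1) * (T / s ^ 2) * (p * (s * ξ / x)) * (q * (s * η / y)))))
          * (x * α * (y * β)) +
      (q * ((q - 1) * (s * η / y ^ 2)) + δ q * (x ^ 2 * t *
        ((t - 1) * (T / s ^ 2) * (q * (s * η / y)) ^ 2 +
        (T / s) * (q * ((q - 1) * (s * η / y ^ 2)))))) * (y * β) ^ 2 =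
      p * (p - 1) * (s * ξ) * α ^ 2 + q * (q - 1) * (s * η) * β ^ 2 + δ q * (W * (2 * α ^ 2 +
      4 * t * α * (p * ξ * α + q * η * β)
      - t * (1 - t) * (p * ξ * α + q * η * β) ^ 2 + t * (p * (p - 1) * ξ * α ^ 2) +
      t * (q * (q - 1) * η * β ^ 2))) := by
    rw [hW]
    field_simp
    ring
  have hL : δ q * (T * (x * α) ^ 2) + 16 * δ q * (s * η / y ^ 2 * (y * β) ^ 2) =
      δ q * (W * α ^ 2) + 16 * δ q * (s * η * β ^ 2) := by
    rw [hW]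
    field_simp
  rw [hR, hL]
  have h8 := mul_le_mul_of_nonneg_left h6 hδ.le
  have h9 := mul_le_mul_of_nonneg_left h5 hδ.le
  linear_combination h7 + h8 + h9 - (s * η * β ^ 2) * hδq

/-- `x² = (x^p)^(2/p) ≤ S^(2/p)`, and the exponents `2/p` and `θ` add up to one. -/
theorem sq_mul_S_rpow_le (hp : 2 ≤ p) {x y : ℝ} (hx : 0 < x) (hy : 0 < y) :
    x ^ 2 * S p q x y ^ θ p ≤ S p q x y := by
  have hS := S_pos p q hx hy
  have h1 : x ^ 2 ≤ S p q x y ^ (2 / p) := by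
    have : x ^ 2 = (x ^ p) ^ (2 / p) := by
      rw [← Real.rpow_mul hx.le, mul_div_cancel₀ _ (by linarith)]
      norm_num
    rw [this]
    refine Real.rpow_le_rpow (by positivity) ?_ (by positivity)
    unfold S
    linarith [Real.rpow_pos_of_pos hy q]
  calc _ ≤ S p q x y ^ (2 / p) * S p q x y ^ θ p :=
        mul_le_mul_of_nonneg_right h1 (by positivity)
    _ = S p q x y := by
        rw [← Real.rpow_add hS, θ]
        simp

theorem hess_ge (hp : 2 ≤ p) (hq1 : 1 < q) (hq2 : q ≤ 2) {x y : ℝ} (hx : 0 < x) (hy : 0 < y)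
    (a b : ℝ) : δ q * (S p q x y ^ θ p * a ^ 2) + 16 * δ q * (y ^ (q - 2) * b ^ 2) ≤
      hess p q x y a b := by
  have hS := S_pos p q hx hy
  have h2p : 2 / p ≤ 1 := (div_le_one (by linarith)).2 hp
  have e1 : ∀ {z : ℝ} (r : ℝ), 0 < z → z ^ (r - 1) = z ^ r / z := fun r hz => by
    rw [Real.rpow_sub_one hz.ne']
  have e2 : ∀ {z : ℝ} (r : ℝ), 0 < z → z ^ (r - 1 - 1) = z ^ r / z ^ 2 := fun r hz => by
    rw [Real.rpow_sub_one hz.ne', Real.rpow_sub_one hz.ne']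
    field_simp
  have key := hess_alg (p := p) (q := q) (t := θ p) (X := x ^ p) (Y := y ^ q)
    (T := S p q x y ^ θ p) (a := a) (b := b) (by unfold θ; linarith)
    (by unfold θ; have : 0 ≤ 2 / p := by positivity
        linarith) hp (by unfold θ; field_simp; ring) hq1 hq2 hx hy (by positivity) (by positivity)
    (by positivity) (sq_mul_S_rpow_le hp hx hy)
  rw [show q - 2 = q - 1 - 1 by ring, e2 q hy]
  unfold hess Qxx Qxy Qyy
  rw [e2 p hx, e2 q hy, e1 p hx, e1 q hy, e1 (θ p) hS, e2 (θ p) hS]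
  exact key

/-- Arithmetic–geometric mean: for conjugate exponents `qθ = 2 - q`, so `S^θ ≥ y^(2-q)` and the
product of the two weights `S^θ` and `y^(q-2)` is at least one. -/
theorem mul_abs_le (hpq : p.HolderConjugate q) (hp : 2 ≤ p) (hq1 : 1 < q) {x y : ℝ}
    (hx : 0 < x) (hy : 0 < y) (a b : ℝ) :
    8 * δ q * |a * b| ≤
      δ q * (S p q x y ^ θ p * a ^ 2) + 16 * δ q * (y ^ (q - 2) * b ^ 2) := by
  have hδ : 0 < δ q := by unfold δ; nlinarith
  have h2p : 2 / p ≤ 1 := (div_le_one (by linarith)).2 hp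
  have hθ : 0 ≤ θ p := by unfold θ; linarith
  have hp0 : p ≠ 0 := by linarith
  have h1 : 1 ≤ S p q x y ^ θ p * y ^ (q - 2) := by
    have h2 : (y ^ q) ^ θ p ≤ S p q x y ^ θ p := by
      refine Real.rpow_le_rpow (by positivity) ?_ hθ
      unfold S
      linarith [Real.rpow_pos_of_pos hx p]
    have h3 : (y ^ q) ^ θ p * y ^ (q - 2) = 1 := by
      rw [← Real.rpow_mul hy.le, ← Real.rpow_add hy]
      have : q * θ p + (q - 2) = 0 := by
        have := hpq.mul_eq_add
        unfold θ
        field_simp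
        linarith
      rw [this, Real.rpow_zero]
    rw [← h3]
    exact mul_le_mul_of_nonneg_right h2 (by positivity)
  set A := S p q x y ^ θ p
  set B := y ^ (q - 2) with hB
  have hA : 0 < A := Real.rpow_pos_of_pos (S_pos p q hx hy) _
  have hB0 : 0 < B := by positivity
  have h4 : 8 * |a * b| ≤ A * a ^ 2 + 16 * (B * b ^ 2) := by
    refine abs_le_of_sq_le_sq' (a := 8 * |a * b|) ?_ (by positivity) |>.2
    rw [mul_pow, sq_abs]
    have h5 : 0 ≤ (A * a ^ 2 - 16 * (B * b ^ 2)) ^ 2 := sq_nonneg _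
    have h6 : a ^ 2 * b ^ 2 * 1 ≤ a ^ 2 * b ^ 2 * (A * B) :=
      mul_le_mul_of_nonneg_left h1 (by positivity)
    nlinarith
  nlinarith

/-- Each summand has a nonnegative lower bound, so the `a`-term may be kept at index `i` and the
`b`-term at a different index `j`. This yields all mixed products of partial derivatives. -/
theorem hess_sum_ge (hpq : p.HolderConjugate q) (hp : 2 ≤ p) (hq1 : 1 < q) (hq2 : q ≤ 2)
    {x y : ℝ} (hx : 0 < x) (hy : 0 < y) (a b : Fin 3 → ℝ) (i j : Fin 3) :
    8 * δ q * |a i * b j| ≤ ∑ k, hess p q x y (a k) (b k) := by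
  have hδ : 0 < δ q := by unfold δ; nlinarith
  have hS := S_pos p q hx hy
  refine (mul_abs_le hpq hp hq1 hx hy (a i) (b j)).trans ?_
  calc _ ≤ ∑ k, δ q * (S p q x y ^ θ p * a k ^ 2) +
        ∑ k, 16 * δ q * (y ^ (q - 2) * b k ^ 2) := by
        gcongr
        · exact Finset.single_le_sum (f := fun k => δ q * (S p q x y ^ θ p * a k ^ 2))
            (fun k _ => by positivity) (Finset.mem_univ i)
        · exact Finset.single_le_sum (f := fun k => 16 * δ q * (y ^ (q - 2) * b k ^ 2))
            (fun k _ => by positivity) (Finset.mem_univ j)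
    _ = ∑ k, (δ q * (S p q x y ^ θ p * a k ^ 2) + 16 * δ q * (y ^ (q - 2) * b k ^ 2)) :=
        Finset.sum_add_distrib.symm
    _ ≤ _ := Finset.sum_le_sum fun k _ => hess_ge hp hq1 hq2 hx hy _ _

theorem Q_nonneg (hq1 : 1 < q) {x y : ℝ} (hx : 0 < x) (hy : 0 < y) : 0 ≤ Q p q x y := by
  have hδ : 0 < δ q := by unfold δ; nlinarith
  have := S_pos p q hx hy
  unfold Q
  positivity

theorem Q_le (hp : 2 ≤ p) (hq1 : 1 < q) (hq2 : q ≤ 2) {x y : ℝ} (hx : 0 < x) (hy : 0 < y) :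
    Q p q x y ≤ 2 * (x ^ p + y ^ q) := by
  have hδ : 0 < δ q := by unfold δ; nlinarith
  have hδ1 : δ q ≤ 1 := by unfold δ; nlinarith
  have h1 := sq_mul_S_rpow_le (q := q) hp hx hy
  have hS := S_pos p q hx hy
  have h2 : δ q * (x ^ 2 * S p q x y ^ θ p) ≤ 1 * S p q x y :=
    mul_le_mul hδ1 h1 (by positivity) zero_le_one
  unfold Q
  have : S p q x y = x ^ p + y ^ q := rfl
  linarith

end Convexity

end Bellman

/-! ### The Bellman function along the heat flow -/

theorem contDiff_heat {f : E3 → ℝ} (hf : IsTestFunction f) (t : ℝ) : ContDiff ℝ ∞ (heat t f) :=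
  contDiff_translateAvg _ hf.1 hf.2

theorem partialD_heat {f : E3 → ℝ} (hf : IsTestFunction f) (t : ℝ) (i : Fin 3) :
    partialD i (heat t f) = heat t (partialD i f) := partialD_translateAvg _ hf i

theorem continuous_uncurry_heat {f : E3 → ℝ} (hf : IsTestFunction f) :
    Continuous fun z : ℝ × E3 => heat z.1 f z.2 := by
  obtain ⟨M, _, hM⟩ := hf.exists_bound
  exact continuous_heat hf.continuous hM

theorem lap_heat {f : E3 → ℝ} (hf : IsTestFunction f) (t : ℝ) (x : E3) :
    heat t (lap f) x = ∑ i, heat t (partialD i (partialD i f)) x := by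
  have hc := continuous_uncurry_heat hf
  rw [heat_apply (isTestFunction_lap hf).continuous]
  unfold lap
  rw [integral_finsetSum]
  · exact Finset.sum_congr rfl fun i _ =>
      (heat_apply ((hf.partialD i).partialD i).continuous t x).symm
  · intro i _
    have hT := (hf.partialD i).partialD i
    obtain ⟨B, _, hB⟩ := hT.exists_bound
    have := hT.continuous
    exact .of_bound (Continuous.aestronglyMeasurable (by fun_prop)) B (.of_forall fun y => hB _)

/-- As `s > 0`, the product lives on the compact set `[s, T] × tsupport χ`, inside the region of
positive times where `F` is continuous. -/
theorem integrable_cutoff_mul {χ : E3 → ℝ} (hχ : IsTestFunction χ) {F : ℝ × E3 → ℝ}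
    (hF : ContinuousOn F (Ioi 0 ×ˢ univ)) {s : ℝ} (hs : 0 < s) (T : ℝ) :
    Integrable (fun z : ℝ × E3 => χ z.2 * F z) ((volume.restrict (Ioc s T)).prod volume) := by
  have hK : IsCompact (Icc s T ×ˢ tsupport χ) := isCompact_Icc.prod hχ.2
  have hc : ContinuousOn (fun z : ℝ × E3 => χ z.2 * F z) (Icc s T ×ˢ tsupport χ) := by
    refine (hχ.continuous.comp continuous_snd).continuousOn.mul (hF.mono ?_)
    exact prod_mono (fun t ht => lt_of_lt_of_le hs ht.1) (subset_univ _)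
  have h1 : IntegrableOn (fun z : ℝ × E3 => χ z.2 * F z) (Icc s T ×ˢ tsupport χ)
      (volume.prod volume) := hc.integrableOn_compact hK
  have h2 : IntegrableOn (fun z : ℝ × E3 => χ z.2 * F z) (Ioc s T ×ˢ univ)
      (volume.prod volume) := by
    refine h1.of_forall_sdiff_eq_zero (measurableSet_Ioc.prod MeasurableSet.univ) ?_
    rintro ⟨t, x⟩ ⟨⟨ht, -⟩, hn⟩
    have : x ∉ tsupport χ := fun hx => hn ⟨Ioc_subset_Icc_self ht, hx⟩
    simp [image_eq_zero_of_notMem_tsupport this]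
  rwa [IntegrableOn, ← Measure.prod_restrict, Measure.restrict_univ] at h2

/-- One factor is bounded, and the other has an `L^1` norm bounded uniformly in time. -/
theorem integrable_heat_mul_heat {f g : E3 → ℝ} (hf : IsTestFunction f) (hg : IsTestFunction g)
    (s T : ℝ) : Integrable (fun z : ℝ × E3 => heat z.1 f z.2 * heat z.1 g z.2)
      ((volume.restrict (Ioc s T)).prod volume) := by
  obtain ⟨M, _, hM⟩ := hf.exists_bound
  have hcg := continuous_uncurry_heat hg
  have h1 : Integrable (fun z : ℝ × E3 => heat z.1 g z.2)
      ((volume.restrict (Ioc s T)).prod volume) := by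
    rw [integrable_prod_iff hcg.aestronglyMeasurable]
    refine ⟨.of_forall fun t => integrable_translateAvg (gaussMeasure t) hg.continuous hg.integrable, ?_⟩
    refine (integrable_const (∫ x, |g x|)).mono'
      (hcg.norm.stronglyMeasurable.integral_prod_right).aestronglyMeasurable
      (.of_forall fun t => ?_)
    rw [Real.norm_of_nonneg (integral_nonneg fun _ => norm_nonneg _)]
    simpa [heat] using integral_abs_translateAvg_le (gaussMeasure t) hg.continuous hg.integrable
  refine h1.bdd_mul (c := M) (continuous_uncurry_heat hf).aestronglyMeasurable
    (.of_forall fun z => ?_)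
  simpa [heat] using norm_translateAvg_le (gaussMeasure z.1) hM z.2

theorem integral_cutoff_mul_lap {χ b : E3 → ℝ} (hχ : IsTestFunction χ) (hb : ContDiff ℝ 2 b) :
    ∫ x, χ x * lap b x = ∫ x, b x * lap χ x := by
  have hb1 : ContDiff ℝ 1 b := hb.of_le (by norm_num)
  have hd : ∀ i, ContDiff ℝ 1 (partialD i b) := fun i => contDiff_partialD (n := 1) hb i
  have hdd : ∀ i, Continuous (partialD i (partialD i b)) := fun i =>
    (contDiff_partialD (n := 0) (by simpa using hd i) i).continuous
  have h1 : ∀ {φ : E3 → ℝ}, IsTestFunction φ → ContDiff ℝ 1 φ := fun h =>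
    h.1.of_le (by exact_mod_cast le_top)
  unfold lap
  simp only [Finset.mul_sum]
  rw [integral_finsetSum, integral_finsetSum]
  · refine Finset.sum_congr rfl fun i _ => ?_
    have e1 := integral_mul_partialD (hd i) (h1 hχ) hχ.2 i
    have e2 := integral_mul_partialD hb1 (h1 (hχ.partialD i)) (hχ.partialD i).2 i
    rw [e2, e1, neg_neg]
    simp only [mul_comm]
  · intro i _
    have hT := (hχ.partialD i).partialD i
    exact (hb.continuous.mul hT.continuous).integrable_of_hasCompactSupport hT.2.mul_left
  · intro i _
    exact (hχ.continuous.mul (hdd i)).integrable_of_hasCompactSupport hχ.2.mul_right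

section Flow

variable {p q : ℝ} {f g : E3 → ℝ}

/-- The Bellman function evaluated along the heat flow. -/
def flow (p q : ℝ) (f g : E3 → ℝ) (t : ℝ) (x : E3) : ℝ :=
  Bellman.Q p q (heat t f x) (heat t g x)

/-- The time derivative of `flow`. -/
def flowDeriv (p q : ℝ) (f g : E3 → ℝ) (t : ℝ) (x : E3) : ℝ :=
  Bellman.Qx p q (heat t f x) (heat t g x) * (1 / 2 * heat t (lap f) x) +
    Bellman.Qy p q (heat t f x) (heat t g x) * (1 / 2 * heat t (lap g) x)

theorem hasDerivAt_flow (hf : IsTestFunction f) (hg : IsTestFunction g) (hf0 : ∀ x, 0 ≤ f x)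
    (hg0 : ∀ x, 0 ≤ g x) (hfne : f ≠ 0) (hgne : g ≠ 0) {t : ℝ} (ht : 0 < t) (x : E3) :
    HasDerivAt (fun s => flow p q f g s x) (flowDeriv p q f g t x) t := by
  have h := (Bellman.hasFDerivAt_Q p q (hasDerivAt_heat hf ht x).hasFDerivAt
    (hasDerivAt_heat hg ht x).hasFDerivAt (heat_pos hf hf0 hfne ht x)
    (heat_pos hg hg0 hgne ht x)).hasDerivAt
  refine h.congr_deriv ?_
  simp [flowDeriv]

theorem contDiff_flow (hf : IsTestFunction f) (hg : IsTestFunction g) (hf0 : ∀ x, 0 ≤ f x)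
    (hg0 : ∀ x, 0 ≤ g x) (hfne : f ≠ 0) (hgne : g ≠ 0) {t : ℝ} (ht : 0 < t) :
    ContDiff ℝ 2 (flow p q f g t) :=
  Bellman.contDiff_Q p q (contDiff_infty.1 (contDiff_heat hf t) 2)
    (contDiff_infty.1 (contDiff_heat hg t) 2) (heat_pos hf hf0 hfne ht)
    (heat_pos hg hg0 hgne ht)

/-- Chain rule. The terms with first derivatives of `Q` carry the Laplacians of the two heat
extensions, which by the heat equation form the time derivative; only the Hessian survives. -/
theorem lap_flow (hf : IsTestFunction f) (hg : IsTestFunction g) (hf0 : ∀ x, 0 ≤ f x)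
    (hg0 : ∀ x, 0 ≤ g x) (hfne : f ≠ 0) (hgne : g ≠ 0) {t : ℝ} (ht : 0 < t) (x : E3) :
    1 / 2 * lap (flow p q f g t) x = flowDeriv p q f g t x +
      1 / 2 * ∑ k, Bellman.hess p q (heat t f x) (heat t g x) (heat t (partialD k f) x)
        (heat t (partialD k g) x) := by
  have hd : ∀ {φ : E3 → ℝ}, IsTestFunction φ → ∀ y, HasFDerivAt (heat t φ)
      (fderiv ℝ (heat t φ) y) y := fun hφ y =>
    ((contDiff_heat hφ t).differentiable (by simp) y).hasFDerivAt
  have hpd : ∀ {φ : E3 → ℝ}, IsTestFunction φ → ∀ k y,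
      fderiv ℝ (heat t φ) y (EuclideanSpace.single k 1) = heat t (partialD k φ) y :=
    fun hφ k y => congrFun (partialD_heat hφ t k) y
  have hfp := heat_pos hf hf0 hfne ht
  have hgp := heat_pos hg hg0 hgne ht
  have h1 : ∀ k, partialD k (flow p q f g t) = fun y =>
      Bellman.Qx p q (heat t f y) (heat t g y) * heat t (partialD k f) y +
      Bellman.Qy p q (heat t f y) (heat t g y) * heat t (partialD k g) y := by
    intro k
    funext y
    have h := (Bellman.hasFDerivAt_Q p q (hd hf y) (hd hg y) (hfp y) (hgp y)).fderiv
    change fderiv ℝ (fun w => Bellman.Q p q (heat t f w) (heat t g w)) y _ = _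
    rw [h]
    simp [hpd hf, hpd hg]
  have h2 : ∀ k, partialD k (partialD k (flow p q f g t)) x =
      Bellman.hess p q (heat t f x) (heat t g x) (heat t (partialD k f) x)
        (heat t (partialD k g) x) +
      (Bellman.Qx p q (heat t f x) (heat t g x) * heat t (partialD k (partialD k f)) x +
      Bellman.Qy p q (heat t f x) (heat t g x) * heat t (partialD k (partialD k g)) x) := by
    intro k
    rw [h1 k]
    have h := (((Bellman.hasFDerivAt_Qx p q (hd hf x) (hd hg x) (hfp x) (hgp x)).mul
      (hd (hf.partialD k) x)).add
      ((Bellman.hasFDerivAt_Qy p q (hd hf x) (hd hg x) (hfp x) (hgp x)).mul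
      (hd (hg.partialD k) x))).fderiv
    change fderiv ℝ (fun y => Bellman.Qx p q (heat t f y) (heat t g y) * heat t (partialD k f) y +
      Bellman.Qy p q (heat t f y) (heat t g y) * heat t (partialD k g) y) x
        (EuclideanSpace.single k 1) = _
    erw [h]
    simp only [Bellman.hess, add_apply, smul_apply,
      smul_eq_mul, hpd hf, hpd hg, hpd (hf.partialD k), hpd (hg.partialD k)]
    ring
  have h3 : lap (flow p q f g t) x = ∑ k, partialD k (partialD k (flow p q f g t)) x := rfl
  rw [h3, Finset.sum_congr rfl fun k _ => h2 k, Finset.sum_add_distrib, Finset.sum_add_distrib,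
    ← Finset.mul_sum, ← Finset.mul_sum, ← lap_heat hf, ← lap_heat hg]
  unfold flowDeriv
  ring

theorem continuousOn_flowDeriv (hf : IsTestFunction f) (hg : IsTestFunction g)
    (hf0 : ∀ x, 0 ≤ f x) (hg0 : ∀ x, 0 ≤ g x) (hfne : f ≠ 0) (hgne : g ≠ 0) :
    ContinuousOn (fun z : ℝ × E3 => flowDeriv p q f g z.1 z.2) (Ioi 0 ×ˢ univ) := by
  rintro ⟨t, x⟩ ⟨ht, -⟩
  refine ContinuousAt.continuousWithinAt ?_
  have hu := (continuous_uncurry_heat hf).continuousAt (x := (t, x))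
  have hv := (continuous_uncurry_heat hg).continuousAt (x := (t, x))
  have hlu := (continuous_uncurry_heat (isTestFunction_lap hf)).continuousAt (x := (t, x))
  have hlv := (continuous_uncurry_heat (isTestFunction_lap hg)).continuousAt (x := (t, x))
  have hup := heat_pos hf hf0 hfne ht x
  have hvp := heat_pos hg hg0 hgne ht x
  have hup' : ∀ r : ℝ, ContinuousAt (fun z : ℝ × E3 => heat z.1 f z.2 ^ r) (t, x) :=
    fun r => hu.rpow_const (.inl hup.ne')
  have hvp' : ∀ r : ℝ, ContinuousAt (fun z : ℝ × E3 => heat z.1 g z.2 ^ r) (t, x) :=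
    fun r => hv.rpow_const (.inl hvp.ne')
  have hS : ∀ r : ℝ, ContinuousAt
      (fun z : ℝ × E3 => Bellman.S p q (heat z.1 f z.2) (heat z.1 g z.2) ^ r) (t, x) :=
    fun r => ((hup' p).add (hvp' q)).rpow_const (.inl (Bellman.S_pos p q hup hvp).ne')
  unfold flowDeriv Bellman.Qx Bellman.Qy
  fun_prop

/-- `Q ≤ 2(x^p + y^q)` together with the contraction of the heat semigroup in `L^p` and `L^q`. -/
theorem integrable_flow (hpq : p.HolderConjugate q) (hp : 2 ≤ p) (hq2 : q ≤ 2)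
    (hf : IsTestFunction f) (hg : IsTestFunction g)
    (hf0 : ∀ x, 0 ≤ f x) (hg0 : ∀ x, 0 ≤ g x) (hfne : f ≠ 0) (hgne : g ≠ 0) {t : ℝ} (ht : 0 < t) :
    Integrable (flow p q f g t) volume ∧
      ∫ x, flow p q f g t x ≤ 2 * ((∫ x, f x ^ p) + ∫ x, g x ^ q) := by
  have hq1 : 1 < q := hpq.symm.lt
  obtain ⟨i1, b1⟩ := integrable_rpow_translateAvg (gaussMeasure t) hf hf0 (p := p) (by linarith)
  obtain ⟨i2, b2⟩ := integrable_rpow_translateAvg (gaussMeasure t) hg hg0 (p := q) hq1.le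
  have hI : Integrable (fun x => 2 * (heat t f x ^ p + heat t g x ^ q)) volume :=
    (i1.add i2).const_mul 2
  have hle : ∀ x, flow p q f g t x ≤ 2 * (heat t f x ^ p + heat t g x ^ q) := fun x =>
    Bellman.Q_le hp hq1 hq2 (heat_pos hf hf0 hfne ht x) (heat_pos hg hg0 hgne ht x)
  have hint : Integrable (flow p q f g t) volume := by
    refine hI.mono'
      (contDiff_flow hf hg hf0 hg0 hfne hgne ht).continuous.aestronglyMeasurable
      (.of_forall fun x => ?_)
    rw [flow, Real.norm_of_nonneg (Bellman.Q_nonneg hq1 (heat_pos hf hf0 hfne ht x)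
      (heat_pos hg hg0 hgne ht x))]
    exact hle x
  refine ⟨hint, (integral_mono hint hI hle).trans ?_⟩
  unfold heat
  rw [integral_const_mul, integral_add i1 i2]
  linarith

/-- The Hessian bound at fixed time, localized. The Laplacian is moved from the flow onto the
cutoff, where it costs at most `3C` times half the mass of the flow. -/
theorem integral_cutoff_flowDeriv_le (hpq : p.HolderConjugate q) (hp : 2 ≤ p) (hq2 : q ≤ 2)
    (hf : IsTestFunction f) (hg : IsTestFunction g)
    (hf0 : ∀ x, 0 ≤ f x) (hg0 : ∀ x, 0 ≤ g x) (hfne : f ≠ 0) (hgne : g ≠ 0) {t : ℝ} (ht : 0 < t)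
    (i j : Fin 3) {χ : E3 → ℝ} (hχ : IsTestFunction χ) (hχ0 : ∀ x, 0 ≤ χ x) {C : ℝ} (hC : 0 ≤ C)
    (hχC : ∀ x k, |partialD k (partialD k χ) x| ≤ C) :
    4 * Bellman.δ q * ∫ x, χ x * |heat t (partialD i f) x * heat t (partialD j g) x| ≤
      3 * C * ((∫ x, f x ^ p) + ∫ x, g x ^ q) - ∫ x, χ x * flowDeriv p q f g t x := by
  have hq1 : 1 < q := hpq.symm.lt
  have hb := contDiff_flow (p := p) (q := q) hf hg hf0 hg0 hfne hgne ht
  obtain ⟨hint, hle⟩ := integrable_flow hpq hp hq2 hf hg hf0 hg0 hfne hgne ht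
  have hci : ∀ {F : E3 → ℝ}, Continuous F → Integrable (fun x => χ x * F x) volume := fun hF =>
    (hχ.continuous.mul hF).integrable_of_hasCompactSupport hχ.2.mul_right
  have hlapc : Continuous (lap (flow p q f g t)) := by
    unfold lap
    refine continuous_finsetSum _ fun k _ => ?_
    exact (contDiff_partialD (n := 0) (by simpa using contDiff_partialD (n := 1) hb k)
      k).continuous
  have hfd : Continuous (flowDeriv p q f g t) := by
    have := (continuousOn_flowDeriv (p := p) (q := q) hf hg hf0 hg0 hfne hgne)
    exact this.comp_continuous (f := fun x => (t, x)) (by fun_prop) fun x => ⟨ht, mem_univ _⟩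
  have hhc : Continuous fun x => |heat t (partialD i f) x * heat t (partialD j g) x| :=
    ((contDiff_heat (hf.partialD i) t).continuous.mul
      (contDiff_heat (hg.partialD j) t).continuous).abs
  have key : ∀ x, 4 * Bellman.δ q *
      (χ x * |heat t (partialD i f) x * heat t (partialD j g) x|) ≤
      1 / 2 * (χ x * lap (flow p q f g t) x) - χ x * flowDeriv p q f g t x := by
    intro x
    have h1 := lap_flow (p := p) (q := q) hf hg hf0 hg0 hfne hgne ht x
    have h2 := Bellman.hess_sum_ge hpq hp hq1 hq2 (heat_pos hf hf0 hfne ht x)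
      (heat_pos hg hg0 hgne ht x) (fun k => heat t (partialD k f) x)
      (fun k => heat t (partialD k g) x) i j
    have h3 : 4 * Bellman.δ q * |heat t (partialD i f) x * heat t (partialD j g) x| ≤
      1 / 2 * lap (flow p q f g t) x - flowDeriv p q f g t x := by linarith
    have h4 := mul_le_mul_of_nonneg_left h3 (hχ0 x)
    linarith
  have hmono := integral_mono ((hci hhc).const_mul (4 * Bellman.δ q))
    (((hci hlapc).const_mul (1 / 2)).sub (hci hfd)) key
  rw [integral_const_mul, integral_sub' ((hci hlapc).const_mul (1 / 2)) (hci hfd),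
    integral_const_mul, integral_cutoff_mul_lap hχ hb] at hmono
  refine hmono.trans (sub_le_sub_right ?_ _)
  have hlapχ : ∀ x, |lap χ x| ≤ 3 * C := by
    intro x
    calc |lap χ x| ≤ ∑ k, |partialD k (partialD k χ) x| := Finset.abs_sum_le_sum_abs _ _
      _ ≤ ∑ _k : Fin 3, C := Finset.sum_le_sum fun k _ => hχC x k
      _ = 3 * C := by simp
  have h5 : ∫ x, flow p q f g t x * lap χ x ≤ ∫ x, flow p q f g t x * (3 * C) := by
    refine integral_mono ?_ (hint.mul_const _) fun x => ?_
    · exact (hb.continuous.mul (isTestFunction_lap hχ).continuous).integrable_of_hasCompactSupport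
        (isTestFunction_lap hχ).2.mul_left
    · exact mul_le_mul_of_nonneg_left ((le_abs_self _).trans (hlapχ x))
        (Bellman.Q_nonneg hq1 (heat_pos hf hf0 hfne ht x) (heat_pos hg hg0 hgne ht x))
  rw [integral_mul_const] at h5
  have h6 : (∫ x, flow p q f g t x) * (3 * C) ≤
      2 * ((∫ x, f x ^ p) + ∫ x, g x ^ q) * (3 * C) :=
    mul_le_mul_of_nonneg_right hle (by linarith)
  linarith

/-- Bilinear embedding for the heat flow of nonnegative functions. -/
theorem integral_heat_mul_heat_le (hpq : p.HolderConjugate q) (hp : 2 ≤ p)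
    (hf : IsTestFunction f) (hg : IsTestFunction g)
    (hf0 : ∀ x, 0 ≤ f x) (hg0 : ∀ x, 0 ≤ g x) (hfne : f ≠ 0) (hgne : g ≠ 0) {s T : ℝ} (hs : 0 < s)
    (hsT : s ≤ T) (i j : Fin 3) :
    2 * Bellman.δ q * ∫ z : ℝ × E3, |heat z.1 (partialD i f) z.2 * heat z.1 (partialD j g) z.2|
      ∂((volume.restrict (Ioc s T)).prod volume) ≤ (∫ x, f x ^ p) + ∫ x, g x ^ q := by
  have hq1 : 1 < q := hpq.symm.lt
  have hq2 : q ≤ 2 := by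
    have := hpq.mul_eq_add
    nlinarith
  set M := (∫ x, f x ^ p) + ∫ x, g x ^ q with hM
  have hM0 : 0 ≤ M := add_nonneg (integral_nonneg fun x => Real.rpow_nonneg (hf0 x) _)
    (integral_nonneg fun x => Real.rpow_nonneg (hg0 x) _)
  obtain ⟨χ, hχ⟩ := exists_isCutoffSeq
  obtain ⟨C, hC0, hC⟩ := hχ.deriv2_le
  set H : ℝ × E3 → ℝ := fun z => |heat z.1 (partialD i f) z.2 * heat z.1 (partialD j g) z.2|
    with hH
  set μ : Measure (ℝ × E3) := (volume.restrict (Ioc s T)).prod volume with hμ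
  have hHc : Continuous H := ((continuous_uncurry_heat (hf.partialD i)).mul
    (continuous_uncurry_heat (hg.partialD j))).abs
  have hHi : Integrable H μ := (integrable_heat_mul_heat (hf.partialD i) (hg.partialD j) s T).abs
  have hlim : Tendsto (fun n => ∫ z, χ n z.2 * H z ∂μ) atTop (𝓝 (∫ z, H z ∂μ)) := by
    refine tendsto_integral_of_dominated_convergence (fun z => ‖H z‖)
      (fun n => ((hχ.test n).continuous.comp continuous_snd).aestronglyMeasurable.mul hHi.1)
      hHi.norm ?_ ?_
    · intro n
      filter_upwards with z
      rw [norm_mul, Real.norm_of_nonneg (hχ.nonneg n _)]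
      exact mul_le_of_le_one_left (norm_nonneg _) (hχ.le_one n _)
    · filter_upwards with z
      simpa using (hχ.tendsto z.2).mul_const (H z)
  -- `2M` bounds the mass of the flow at time `s`, the nonnegative mass at time `T` being dropped.
  -- The other term is the cost of the cutoff over a time `T - s`; it vanishes as `n → ∞` with `s`
  -- and `T` fixed.
  have hbound : ∀ n, 4 * Bellman.δ q * ∫ z, χ n z.2 * H z ∂μ ≤
      2 * M + 3 * (C / ((n : ℝ) + 1)) * M * (T - s) := by
    intro n
    have hχn := hχ.test n
    have i1 : Integrable (fun z : ℝ × E3 => χ n z.2 * H z) μ :=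
      integrable_cutoff_mul hχn hHc.continuousOn hs T
    have i2 : Integrable (fun z : ℝ × E3 => χ n z.2 * flowDeriv p q f g z.1 z.2) μ :=
      integrable_cutoff_mul hχn (continuousOn_flowDeriv hf hg hf0 hg0 hfne hgne) hs T
    have e1 : ∫ z, χ n z.2 * flowDeriv p q f g z.1 z.2 ∂μ =
        ∫ x, χ n x * (flow p q f g T x - flow p q f g s x) := by
      rw [hμ, integral_prod_symm _ i2]
      congr 1
      funext x
      change ∫ t, χ n x * flowDeriv p q f g t x ∂(volume.restrict (Ioc s T)) = _
      rw [integral_const_mul, ← intervalIntegral.integral_of_le hsT,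
        intervalIntegral.integral_eq_sub_of_hasDerivAt (f := fun t => flow p q f g t x)]
      · intro t ht
        rw [uIcc_of_le hsT] at ht
        exact hasDerivAt_flow hf hg hf0 hg0 hfne hgne (lt_of_lt_of_le hs ht.1) x
      · refine ContinuousOn.intervalIntegrable ?_
        rw [uIcc_of_le hsT]
        refine (continuousOn_flowDeriv (p := p) (q := q) hf hg hf0 hg0 hfne hgne).comp
          (f := fun t : ℝ => (t, x)) (by fun_prop) fun t ht => ⟨lt_of_lt_of_le hs ht.1, mem_univ _⟩
    have hsl : ∀ t, 0 < t → Integrable (fun x => χ n x * flow p q f g t x) volume := fun t ht =>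
      (hχn.continuous.mul (contDiff_flow hf hg hf0 hg0 hfne
        hgne ht).continuous).integrable_of_hasCompactSupport hχn.2.mul_right
    have e2 : - (2 * M) ≤ ∫ z, χ n z.2 * flowDeriv p q f g z.1 z.2 ∂μ := by
      rw [e1]
      simp only [mul_sub]
      rw [integral_sub (hsl T (by linarith)) (hsl s hs)]
      have hpos : ∀ t, 0 < t → ∀ x, 0 ≤ flow p q f g t x := fun t ht x =>
        Bellman.Q_nonneg hq1 (heat_pos hf hf0 hfne ht x) (heat_pos hg hg0 hgne ht x)
      have h1 : 0 ≤ ∫ x, χ n x * flow p q f g T x :=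
        integral_nonneg fun x => mul_nonneg (hχ.nonneg n x) (hpos T (by linarith) x)
      obtain ⟨hint, hle⟩ := integrable_flow hpq hp hq2 hf hg hf0 hg0 hfne hgne hs
      have h2 : ∫ x, χ n x * flow p q f g s x ≤ ∫ x, flow p q f g s x :=
        integral_mono (hsl s hs) hint fun x =>
          mul_le_of_le_one_left (hpos s hs x) (hχ.le_one n x)
      linarith
    have hI1 := i1.integral_prod_left
    have hI2 := i2.integral_prod_left
    have e3 : 4 * Bellman.δ q * ∫ z, χ n z.2 * H z ∂μ ≤
        (∫ _t in Ioc s T, (3 * (C / ((n : ℝ) + 1)) * M)) -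
          ∫ z, χ n z.2 * flowDeriv p q f g z.1 z.2 ∂μ := by
      rw [hμ, integral_prod _ i1, integral_prod _ i2, ← integral_const_mul,
        ← integral_sub (integrable_const _) hI2]
      refine setIntegral_mono_on (hI1.const_mul _) ((integrable_const _).sub hI2)
        measurableSet_Ioc fun t ht => ?_
      exact integral_cutoff_flowDeriv_le hpq hp hq2 hf hg hf0 hg0 hfne hgne (hs.trans ht.1) i j
        hχn (hχ.nonneg n) (by positivity) fun x k => hC n x k
    have e4 : ∫ _t in Ioc s T, (3 * (C / ((n : ℝ) + 1)) * M) =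
        3 * (C / ((n : ℝ) + 1)) * M * (T - s) := by
      rw [setIntegral_const, Real.volume_real_Ioc_of_le hsT, smul_eq_mul]
      ring
    linarith
  have hr : Tendsto (fun n : ℕ => 2 * M + 3 * (C / ((n : ℝ) + 1)) * M * (T - s)) atTop
      (𝓝 (2 * M + 3 * 0 * M * (T - s))) :=
    ((((IsCutoffSeq.tendsto_div_add_one C).const_mul 3).mul_const M).mul_const (T - s)).const_add _
  have := le_of_tendsto_of_tendsto' (hlim.const_mul (4 * Bellman.δ q)) hr hbound
  linarith

end Flow

/-! ### The bilinear estimate for signed functions -/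

section Linear

variable {f g : E3 → ℝ}

theorem heat_sub (hf : IsTestFunction f) (hg : IsTestFunction g) (t : ℝ) (x : E3) :
    heat t (fun y => f y - g y) x = heat t f x - heat t g x := by
  obtain ⟨M, _, hM⟩ := hf.exists_bound
  obtain ⟨M', _, hM'⟩ := hg.exists_bound
  exact integral_sub (integrable_translate _ hf.continuous hM x)
    (integrable_translate _ hg.continuous hM' x)

theorem heat_partialD_sub (hf : IsTestFunction f) (hg : IsTestFunction g) (t : ℝ) (i : Fin 3)
    (x : E3) : heat t (partialD i fun y => f y - g y) x =
      heat t (partialD i f) x - heat t (partialD i g) x := by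
  rw [← heat_sub (hf.partialD i) (hg.partialD i)]
  congr 1
  funext y
  exact partialD_sub hf.differentiable hg.differentiable i y

theorem heat_partialD_const_mul (c : ℝ) (hf : IsTestFunction f) (t : ℝ) (i : Fin 3) (x : E3) :
    heat t (partialD i fun y => c * f y) x = c * heat t (partialD i f) x := by
  have h : (partialD i fun y => c * f y) = fun y => c * partialD i f y := by
    funext y
    unfold partialD
    rw [fderiv_const_mul (hf.differentiable y)]
    simp
  rw [h]
  exact integral_const_mul _ _

theorem heat_partialD_zero (t : ℝ) (i : Fin 3) (x : E3) : heat t (partialD i 0) x = 0 := by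
  have : partialD i (0 : E3 → ℝ) = 0 := by
    funext y
    simp [partialD]
  rw [this]
  simp [heat, translateAvg]

/-- The bilinear functional `∫_s^T ∫ |∂ᵢ Pₜ f| |∂ⱼ Pₜ g|`. -/
def heatPairing (s T : ℝ) (i j : Fin 3) (f g : E3 → ℝ) : ℝ :=
  ∫ z : ℝ × E3, |heat z.1 (partialD i f) z.2 * heat z.1 (partialD j g) z.2|
    ∂((volume.restrict (Ioc s T)).prod volume)

theorem heatPairing_comm (s T : ℝ) (i j : Fin 3) (f g : E3 → ℝ) :
    heatPairing s T i j f g = heatPairing s T j i g f := by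
  unfold heatPairing
  simp only [mul_comm]

theorem heatPairing_sub_left_le {f₁ f₂ : E3 → ℝ} (h₁ : IsTestFunction f₁) (h₂ : IsTestFunction f₂)
    (hg : IsTestFunction g) (s T : ℝ) (i j : Fin 3) :
    heatPairing s T i j (fun x => f₁ x - f₂ x) g ≤
      heatPairing s T i j f₁ g + heatPairing s T i j f₂ g := by
  unfold heatPairing
  have i1 := (integrable_heat_mul_heat (h₁.partialD i) (hg.partialD j) s T).abs
  have i2 := (integrable_heat_mul_heat (h₂.partialD i) (hg.partialD j) s T).abs
  have i3 := (integrable_heat_mul_heat ((h₁.sub h₂).partialD i) (hg.partialD j) s T).abs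
  rw [← integral_add i1 i2]
  refine integral_mono i3 (i1.add i2) fun z => ?_
  simp only [heat_partialD_sub h₁ h₂, sub_mul]
  exact abs_sub _ _

theorem heatPairing_const_mul (hf : IsTestFunction f) (hg : IsTestFunction g) (a b : ℝ) (s T : ℝ)
    (i j : Fin 3) : heatPairing s T i j (fun x => a * f x) (fun x => b * g x) =
      |a * b| * heatPairing s T i j f g := by
  unfold heatPairing
  rw [← integral_const_mul]
  congr 1
  funext z
  rw [heat_partialD_const_mul a hf, heat_partialD_const_mul b hg, ← abs_mul]
  congr 1
  ring

/-- The `L^p` norm as a real number. -/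
def lpn (p : ℝ≥0∞) (f : E3 → ℝ) : ℝ := (eLpNorm f p volume).toReal

theorem lpn_nonneg (p : ℝ≥0∞) (f : E3 → ℝ) : 0 ≤ lpn p f := ENNReal.toReal_nonneg

theorem ofReal_lpn (p : ℝ≥0∞) (hf : IsTestFunction f) :
    ENNReal.ofReal (lpn p f) = eLpNorm f p volume :=
  ENNReal.ofReal_toReal (hf.memLp p).2.ne

theorem lpn_sub_le {p : ℝ≥0∞} (hp : 1 ≤ p) (hf : IsTestFunction f) (hg : IsTestFunction g) :
    lpn p (fun x => f x - g x) ≤ lpn p f + lpn p g := by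
  unfold lpn
  rw [← ENNReal.toReal_add (hf.memLp p).2.ne (hg.memLp p).2.ne]
  exact ENNReal.toReal_mono (ENNReal.add_ne_top.2 ⟨(hf.memLp p).2.ne, (hg.memLp p).2.ne⟩)
    (eLpNorm_sub_le (hf.memLp p).1 (hg.memLp p).1 hp)

theorem lpn_const_mul (p : ℝ≥0∞) (c : ℝ) (f : E3 → ℝ) :
    lpn p (fun x => c * f x) = |c| * lpn p f := by
  have : (fun x => c * f x) = c • f := rfl
  unfold lpn
  rw [this, eLpNorm_const_smul, ENNReal.toReal_mul]
  simp

theorem eq_zero_of_lpn_eq_zero {p : ℝ≥0∞} (hp : 1 ≤ p) (hf : IsTestFunction f)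
    (h : lpn p f = 0) : f = 0 := by
  have h1 : eLpNorm f p volume = 0 := by rw [← ofReal_lpn p hf, h, ENNReal.ofReal_zero]
  rw [eLpNorm_eq_zero_iff (hf.memLp p).1 (by positivity)] at h1
  exact (hf.continuous.ae_eq_iff_eq volume continuous_zero).1 h1

theorem lpn_rpow {p : ℝ≥0∞} (hp : 1 ≤ p) (hp' : p ≠ ⊤) (hf : IsTestFunction f) :
    ∫ x, |f x| ^ p.toReal = lpn p f ^ p.toReal := by
  have h0 : p ≠ 0 := by positivity
  have h1 : 0 ≤ ∫ x, ‖f x‖ ^ p.toReal := integral_nonneg fun x => by positivity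
  unfold lpn
  rw [(hf.memLp p).eLpNorm_eq_integral_rpow_norm h0 hp', ENNReal.toReal_ofReal (by positivity),
    Real.rpow_inv_rpow h1 (ENNReal.toReal_pos h0 hp').ne']
  simp

end Linear

/-- Homogeneity: after normalizing both norms to one, the additive bound `‖f‖^p + ‖g‖^q` equals `2`
and becomes a product. Zero functions are treated apart, since the flow needs strict positivity. -/
theorem heatPairing_le_of_nonneg {p q : ℝ≥0∞} (hpq : p.toReal.HolderConjugate q.toReal)
    (hp1 : 1 ≤ p) (hp' : p ≠ ⊤) (hq1 : 1 ≤ q) (hq' : q ≠ ⊤) (hp : 2 ≤ p.toReal) {f g : E3 → ℝ}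
    (hf : IsTestFunction f) (hg : IsTestFunction g)
    (hf0 : ∀ x, 0 ≤ f x) (hg0 : ∀ x, 0 ≤ g x) {s T : ℝ} (hs : 0 < s)
    (hsT : s ≤ T) (i j : Fin 3) :
    heatPairing s T i j f g ≤ (Bellman.δ q.toReal)⁻¹ * (lpn p f * lpn q g) := by
  have hδ : 0 < Bellman.δ q.toReal := by
    have := hpq.symm.lt
    unfold Bellman.δ
    nlinarith
  have hC := inv_pos.2 hδ
  have hnn : 0 ≤ (Bellman.δ q.toReal)⁻¹ * (lpn p f * lpn q g) :=
    mul_nonneg hC.le (mul_nonneg (lpn_nonneg _ _) (lpn_nonneg _ _))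
  by_cases hfne : f = 0
  · subst hfne
    simpa [heatPairing, heat_partialD_zero] using hnn
  by_cases hgne : g = 0
  · subst hgne
    simpa [heatPairing, heat_partialD_zero] using hnn
  have ha : 0 < lpn p f := (lpn_nonneg _ _).lt_of_ne fun h =>
    hfne (eq_zero_of_lpn_eq_zero hp1 hf h.symm)
  have hb : 0 < lpn q g := (lpn_nonneg _ _).lt_of_ne fun h =>
    hgne (eq_zero_of_lpn_eq_zero hq1 hg h.symm)
  have nrm : ∀ {r : ℝ≥0∞} {F : E3 → ℝ}, 1 ≤ r → r ≠ ⊤ → IsTestFunction F → (∀ x, 0 ≤ F x) →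
      0 < lpn r F → ∫ x, ((lpn r F)⁻¹ * F x) ^ r.toReal = 1 := by
    intro r F hr hr' hF hF0 hpos
    have h1 := lpn_rpow hr hr' (hF.const_mul (lpn r F)⁻¹)
    rw [lpn_const_mul, abs_of_pos (inv_pos.2 hpos), inv_mul_cancel₀ hpos.ne', Real.one_rpow] at h1
    rw [← h1]
    congr 1
    funext x
    rw [abs_of_nonneg (mul_nonneg (inv_pos.2 hpos).le (hF0 x))]
  have hne : ∀ {r : ℝ≥0∞} {F : E3 → ℝ}, F ≠ 0 → 0 < lpn r F →
      (fun x => (lpn r F)⁻¹ * F x) ≠ 0 := by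
    intro r F hF hpos h
    refine hF (funext fun x => ?_)
    have := congrFun h x
    simpa [hpos.ne'] using this
  have key := integral_heat_mul_heat_le hpq hp (hf.const_mul (lpn p f)⁻¹)
    (hg.const_mul (lpn q g)⁻¹) (fun x => mul_nonneg (inv_pos.2 ha).le (hf0 x))
    (fun x => mul_nonneg (inv_pos.2 hb).le (hg0 x)) (hne hfne ha) (hne hgne hb) hs hsT i j
  rw [nrm hp1 hp' hf hf0 ha, nrm hq1 hq' hg hg0 hb] at key
  have h2 := heatPairing_const_mul hf hg (lpn p f)⁻¹ (lpn q g)⁻¹ s T i j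
  rw [heatPairing] at h2
  rw [h2, abs_of_pos (mul_pos (inv_pos.2 ha) (inv_pos.2 hb))] at key
  have h3 : Bellman.δ q.toReal * heatPairing s T i j f g ≤ lpn p f * lpn q g := by
    have h4 := mul_le_mul_of_nonneg_left key (mul_pos ha hb).le
    have h5 : lpn p f * lpn q g * (2 * Bellman.δ q.toReal *
        ((lpn p f)⁻¹ * (lpn q g)⁻¹ * heatPairing s T i j f g)) =
        2 * (Bellman.δ q.toReal * heatPairing s T i j f g) := by
      field_simp
    rw [h5] at h4
    linarith
  rw [inv_mul_eq_div, le_div_iff₀ hδ]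
  linarith

/-- `|f|` is not smooth; `√(f² + ε²)` is, and is cut off by a bump equal to one on the support of
`f`. -/
theorem exists_majorant {p : ℝ≥0∞} (hp : 1 ≤ p) {f : E3 → ℝ} (hf : IsTestFunction f) :
    ∃ φ, IsTestFunction φ ∧ (∀ x, |f x| ≤ φ x) ∧ lpn p φ ≤ 2 * lpn p f := by
  by_cases hfne : f = 0
  · subst hfne
    exact ⟨0, hf, by simp, by linarith [lpn_nonneg p (0 : E3 → ℝ)]⟩
  have ha : 0 < lpn p f := (lpn_nonneg _ _).lt_of_ne fun h =>
    hfne (eq_zero_of_lpn_eq_zero hp hf h.symm)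
  obtain ⟨R, hR⟩ := hf.2.isBounded.subset_closedBall (0 : E3)
  let b : ContDiffBump (0 : E3) := ⟨max R 1, max R 1 + 1, by positivity, by linarith⟩
  have hb : IsTestFunction b := ⟨b.contDiff, b.hasCompactSupport⟩
  have hb1 : ∀ x, f x ≠ 0 → b x = 1 := fun x hx => b.one_of_mem_closedBall
    (Metric.closedBall_subset_closedBall (le_max_left _ _) (hR (subset_tsupport _ hx)))
  -- Chosen so that `ε‖b‖ ≤ ‖f‖`; the added one keeps the denominator positive.
  set ε := lpn p f / (lpn p b + 1) with hε
  have hb0 := lpn_nonneg p b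
  have hε0 : 0 < ε := by positivity
  have hs : ContDiff ℝ ∞ fun x => √(f x ^ 2 + ε ^ 2) :=
    ((hf.1.pow 2).add contDiff_const).sqrt fun x => by positivity
  have hφ : IsTestFunction fun x => b x * √(f x ^ 2 + ε ^ 2) := hb.mul_right hs
  obtain ⟨M, hM0, hM⟩ := hf.exists_bound
  refine ⟨_, hφ, fun x => ?_, ?_⟩
  · by_cases hx : f x = 0
    · simp only [hx, abs_zero]
      exact mul_nonneg b.nonneg (Real.sqrt_nonneg _)
    · rw [hb1 x hx, one_mul]
      exact Real.abs_le_sqrt (by nlinarith)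
  · have h1 : ∀ x, |b x * √(f x ^ 2 + ε ^ 2)| ≤ |f x| + ε * b x := by
      intro x
      have h2 : √(f x ^ 2 + ε ^ 2) ≤ |f x| + ε := by
        refine Real.sqrt_le_iff.2 ⟨by positivity, ?_⟩
        nlinarith [sq_abs (f x), abs_nonneg (f x)]
      rw [abs_of_nonneg (mul_nonneg b.nonneg (Real.sqrt_nonneg _))]
      calc _ ≤ b x * (|f x| + ε) := mul_le_mul_of_nonneg_left h2 b.nonneg
        _ ≤ _ := by nlinarith [abs_nonneg (f x), b.le_one (x := x)]
    have hfm := hf.memLp p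
    have hεb := (hb.const_mul ε)
    have h3 : eLpNorm (fun x => b x * √(f x ^ 2 + ε ^ 2)) p volume ≤
        eLpNorm f p volume + eLpNorm (fun x => ε * b x) p volume := by
      refine (eLpNorm_mono_real h1).trans ?_
      refine (eLpNorm_add_le hfm.1.norm (hεb.memLp p).1 hp).trans_eq ?_
      rw [eLpNorm_norm]
    have h4 : lpn p (fun x => b x * √(f x ^ 2 + ε ^ 2)) ≤ lpn p f + lpn p (fun x => ε * b x) := by
      unfold lpn
      rw [← ENNReal.toReal_add hfm.2.ne (hεb.memLp p).2.ne]
      exact ENNReal.toReal_mono (ENNReal.add_ne_top.2 ⟨hfm.2.ne, (hεb.memLp p).2.ne⟩) h3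
    rw [lpn_const_mul, abs_of_pos hε0] at h4
    have h5 : ε * lpn p b ≤ lpn p f := by
      rw [hε, div_mul_eq_mul_div, div_le_iff₀ (by positivity)]
      nlinarith
    linarith

/-- Write `f = φ - (φ - f)` with a majorant `φ` of `|f|`, and `g` likewise. The nonnegative pieces
have norms at most 2 and 3 times the original, and `25 = (2 + 3)²`. -/
theorem heatPairing_le_of_two_le {p q : ℝ≥0∞} (hpq : p.toReal.HolderConjugate q.toReal)
    (hp1 : 1 ≤ p) (hp' : p ≠ ⊤) (hq1 : 1 ≤ q) (hq' : q ≠ ⊤) (hp : 2 ≤ p.toReal) {f g : E3 → ℝ}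
    (hf : IsTestFunction f) (hg : IsTestFunction g) {s T : ℝ} (hs : 0 < s)
    (hsT : s ≤ T) (i j : Fin 3) :
    heatPairing s T i j f g ≤ 25 * (Bellman.δ q.toReal)⁻¹ * (lpn p f * lpn q g) := by
  have hC : 0 < (Bellman.δ q.toReal)⁻¹ := by
    have := hpq.symm.lt
    refine inv_pos.2 ?_
    unfold Bellman.δ
    nlinarith
  obtain ⟨φ, hφ, hφf, hφn⟩ := exists_majorant hp1 hf
  obtain ⟨ψ, hψ, hψg, hψn⟩ := exists_majorant hq1 hg
  have hφ' := hφ.sub hf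
  have hψ' := hψ.sub hg
  have hnf : lpn p (fun x => φ x - f x) ≤ 3 * lpn p f := by linarith [lpn_sub_le hp1 hφ hf]
  have hng : lpn q (fun x => ψ x - g x) ≤ 3 * lpn q g := by linarith [lpn_sub_le hq1 hψ hg]
  have hpos : ∀ {a b : E3 → ℝ}, (∀ x, |a x| ≤ b x) → ∀ x, 0 ≤ b x := fun h x =>
    (abs_nonneg _).trans (h x)
  have hpos' : ∀ {a b : E3 → ℝ}, (∀ x, |a x| ≤ b x) → ∀ x, 0 ≤ b x - a x := fun h x =>
    sub_nonneg.2 ((le_abs_self _).trans (h x))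
  have main : ∀ {F G : E3 → ℝ}, IsTestFunction F → IsTestFunction G → (∀ x, 0 ≤ F x) →
      (∀ x, 0 ≤ G x) → ∀ {a b : ℝ}, 0 ≤ a → lpn p F ≤ a → lpn q G ≤ b →
      heatPairing s T i j F G ≤ (Bellman.δ q.toReal)⁻¹ * (a * b) := by
    intro F G hF hG hF0 hG0 a b ha hFa hGb
    refine (heatPairing_le_of_nonneg hpq hp1 hp' hq1 hq' hp hF hG hF0 hG0 hs hsT i j).trans ?_
    gcongr
    exact lpn_nonneg _ _
  have e1 : heatPairing s T i j f g ≤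
      heatPairing s T i j φ g + heatPairing s T i j (fun x => φ x - f x) g := by
    have := heatPairing_sub_left_le hφ hφ' hg s T i j
    simpa only [sub_sub_cancel] using this
  have e2 : ∀ {F : E3 → ℝ}, IsTestFunction F → heatPairing s T i j F g ≤
      heatPairing s T i j F ψ + heatPairing s T i j F (fun x => ψ x - g x) := by
    intro F hF
    have := heatPairing_sub_left_le hψ hψ' hF s T j i
    rw [heatPairing_comm s T i j F, heatPairing_comm s T i j F, heatPairing_comm s T i j F]
    simpa only [sub_sub_cancel] using this
  have hf0 := lpn_nonneg p f
  have hg0 := lpn_nonneg q g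
  have m1 := main hφ hψ (hpos hφf) (hpos hψg) (by positivity) hφn hψn
  have m2 := main hφ hψ' (hpos hφf) (hpos' hψg) (by positivity) hφn hng
  have m3 := main hφ' hψ (hpos' hφf) (hpos hψg) (by positivity) hnf hψn
  have m4 := main hφ' hψ' (hpos' hφf) (hpos' hψg) (by positivity) hnf hng
  linear_combination e1 + e2 hφ + e2 hφ' + m1 + m2 + m3 + m4

/-- One of two conjugate exponents is at least 2, and the pairing is symmetric. The constant does
not depend on `s` and `T`. -/
theorem exists_heatPairing_le {p q : ℝ≥0∞} (hpq : p.HolderConjugate q) (hp1 : 1 < p)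
    (hp' : p ≠ ⊤) : ∃ C, 0 ≤ C ∧ ∀ f g : E3 → ℝ, IsTestFunction f → IsTestFunction g →
      ∀ s T : ℝ, 0 < s → s ≤ T → ∀ i j : Fin 3,
        heatPairing s T i j f g ≤ C * (lpn p f * lpn q g) := by
  have hq1 : 1 ≤ q := ENNReal.HolderConjugate.one_le q p
  have hq' : q ≠ ⊤ := by
    intro h
    subst h
    have := (ENNReal.HolderConjugate.eq_top_iff_eq_one (p := ⊤) (q := p)).1 rfl
    exact hp1.ne' this
  have hr : p.toReal.HolderConjugate q.toReal := by
    have := ENNReal.HolderConjugate.toReal_of_ne_top (p := p) (q := q) hp' hq'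
    exact this
  have hδ : ∀ r : ℝ, 1 < r → 0 ≤ 25 * (Bellman.δ r)⁻¹ := fun r h => by
    have : 0 < Bellman.δ r := by unfold Bellman.δ; nlinarith
    positivity
  rcases le_total 2 p.toReal with h | h
  · exact ⟨_, hδ _ hr.symm.lt, fun f g hf hg s T hs hsT i j =>
      heatPairing_le_of_two_le hr hp1.le hp' hq1 hq' h hf hg hs hsT i j⟩
  · refine ⟨_, hδ _ hr.lt, fun f g hf hg s T hs hsT i j => ?_⟩
    rw [heatPairing_comm, mul_comm (lpn p f)]
    refine heatPairing_le_of_two_le hr.symm hq1 hq' hp1.le hp' ?_ hg hf hs hsT j i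
    have h1 := hr.mul_eq_add
    have h2 := hr.lt
    nlinarith

/-! ### The truncated inverse Laplacian -/

/-- The distribution of `√(2t) y` for `t` uniform on `(s, T]` and `y` Gaussian. -/
def timeMeasure (s T : ℝ) : Measure E3 :=
  ((volume.restrict (Ioc s T)).prod (stdGaussian E3)).map (fun z : ℝ × E3 => √(2 * z.1) • z.2)

instance (s T : ℝ) : IsFiniteMeasure (timeMeasure s T) := by
  unfold timeMeasure
  infer_instance

/-- The truncated inverse of the Laplacian, `∫_s^T P_{2t} f dt`. -/
def heatInt (s T : ℝ) (f : E3 → ℝ) : E3 → ℝ := translateAvg (timeMeasure s T) f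

theorem heatInt_apply {f : E3 → ℝ} (hf : IsTestFunction f) (s T : ℝ) (x : E3) :
    heatInt s T f x = ∫ t in Ioc s T, heat (2 * t) f x := by
  have hc := hf.continuous
  obtain ⟨M, _, hM⟩ := hf.exists_bound
  unfold heatInt translateAvg timeMeasure
  rw [integral_map (by fun_prop)
    (by fun_prop : Continuous fun y => f (x + y)).aestronglyMeasurable, integral_prod]
  · simp only [heat_apply hc]
  · exact .of_bound (by fun_prop : Continuous fun z : ℝ × E3 =>
      f (x + √(2 * z.1) • z.2)).aestronglyMeasurable M (.of_forall fun _ => hM _)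

theorem heatInt_lap {f : E3 → ℝ} (hf : IsTestFunction f) {s T : ℝ} (hs : 0 < s) (hsT : s ≤ T)
    (x : E3) : heatInt s T (lap f) x = heat (2 * T) f x - heat (2 * s) f x := by
  rw [heatInt_apply (isTestFunction_lap hf), ← intervalIntegral.integral_of_le hsT]
  refine intervalIntegral.integral_eq_sub_of_hasDerivAt (f := fun t => heat (2 * t) f x) ?_ ?_
  · intro t ht
    rw [uIcc_of_le hsT] at ht
    have ht0 : 0 < t := lt_of_lt_of_le hs ht.1
    have h := (hasDerivAt_heat hf (t := 2 * t) (by linarith) x).comp t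
      ((hasDerivAt_id t).const_mul 2)
    refine h.congr_deriv ?_
    ring
  · have hc : Continuous fun t : ℝ => heat (2 * t) (lap f) x :=
      (continuous_uncurry_heat (isTestFunction_lap hf)).comp
        (by fun_prop : Continuous fun t : ℝ => ((2 * t, x) : ℝ × E3))
    exact hc.intervalIntegrable _ _

/-- This is the reason for the time `2t`: the semigroup law and self-adjointness distribute `P_{2t}
= Pₜ Pₜ` evenly over both functions. -/
theorem integral_heatInt_mul {f g : E3 → ℝ} (hf : IsTestFunction f) (hg : IsTestFunction g)
    {s : ℝ} (hs : 0 < s) (T : ℝ) : ∫ x, heatInt s T f x * g x =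
      ∫ z : ℝ × E3, heat z.1 f z.2 * heat z.1 g z.2
        ∂((volume.restrict (Ioc s T)).prod volume) := by
  obtain ⟨M, _, hM⟩ := hf.exists_bound
  have hc : Continuous fun z : ℝ × E3 => heat (2 * z.1) f z.2 :=
    (continuous_uncurry_heat hf).comp
      (by fun_prop : Continuous fun z : ℝ × E3 => ((2 * z.1, z.2) : ℝ × E3))
  have hI : Integrable (fun z : ℝ × E3 => heat (2 * z.1) f z.2 * g z.2)
      ((volume.restrict (Ioc s T)).prod volume) := by
    refine (hg.integrable.comp_snd _).bdd_mul (c := M) hc.aestronglyMeasurable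
      (.of_forall fun z => ?_)
    simpa [heat] using norm_translateAvg_le (gaussMeasure (2 * z.1)) hM z.2
  rw [integral_prod _ (integrable_heat_mul_heat hf hg s T)]
  simp only [heatInt_apply hf, ← integral_mul_const]
  rw [integral_integral_swap (f := fun x t => heat (2 * t) f x * g x) hI.swap]
  refine setIntegral_congr_fun measurableSet_Ioc fun t ht => ?_
  have ht0 : 0 ≤ t := (hs.trans ht.1).le
  have hb : ∀ x, ‖heat t f x‖ ≤ M := fun x => by
    simpa [heat] using norm_translateAvg_le (gaussMeasure t) hM x
  change ∫ x, heat (2 * t) f x * g x = ∫ x, heat t f x * heat t g x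
  rw [two_mul, ← heat_heat hf.continuous hM ht0 ht0]
  exact integral_translateAvg_mul (gaussMeasure t) (contDiff_heat hf t).continuous hb
    hg.continuous hg.integrable (gaussMeasure_neg t)

/-- The derivative `∂ᵢ` is moved onto `g`, so that each function carries one derivative, as in the
bilinear embedding. -/
theorem abs_integral_heatInt_mul_le {f g : E3 → ℝ} (hf : IsTestFunction f) (hg : IsTestFunction g)
    {s : ℝ} (hs : 0 < s) (T : ℝ) (i j : Fin 3) :
    |∫ x, heatInt s T (partialD i (partialD j f)) x * g x| ≤ heatPairing s T j i f g := by
  have h1 := integral_mul_partialD (f := heatInt s T (partialD j f)) (φ := g)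
    ((contDiff_translateAvg _ (hf.partialD j).1 (hf.partialD j).2).of_le
      (by exact_mod_cast le_top)) (hg.1.of_le (by exact_mod_cast le_top)) hg.2 i
  have h2 : partialD i (heatInt s T (partialD j f)) = heatInt s T (partialD i (partialD j f)) :=
    partialD_translateAvg _ (hf.partialD j) i
  rw [h2] at h1
  rw [← abs_neg, ← h1, integral_heatInt_mul (hf.partialD j) (hg.partialD i) hs]
  exact abs_integral_le_integral_abs

/-! ### Explicit gradients and divergence-free fields, and their orthogonality -/

/-- The classical gradient field of a function. -/
def gradField (ψ : E3 → ℝ) (x : E3) : E3 := WithLp.toLp 2 fun i => partialD i ψ x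

/-- The divergence of a matrix field, row by row. -/
def rowDiv (A : Fin 3 → Fin 3 → E3 → ℝ) (x : E3) : E3 :=
  WithLp.toLp 2 fun i => ∑ j, partialD j (A i j) x

theorem rowDiv_apply (A : Fin 3 → Fin 3 → E3 → ℝ) (i : Fin 3) :
    (fun x => rowDiv A x i) = fun x => ∑ j, partialD j (A i j) x := rfl

/-- Second derivatives are symmetric and `A` is antisymmetric, so the sum equals its own negative.
-/
theorem sum_partialD_partialD_antisymm {A : Fin 3 → Fin 3 → E3 → ℝ}
    (hA : ∀ i j, ContDiff ℝ ∞ (A i j)) (hanti : ∀ i j x, A i j x = - A j i x) (x : E3) :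
    ∑ i, ∑ j, partialD i (partialD j (A i j)) x = 0 := by
  have h : ∀ i j, partialD i (partialD j (A i j)) x = - partialD j (partialD i (A j i)) x := by
    intro i j
    have e1 : A i j = fun y => - A j i y := funext fun y => hanti i j y
    have e2 : partialD j (A i j) = fun y => - partialD j (A j i) y := by
      funext y
      rw [e1, partialD_neg]
    rw [e2, partialD_neg, partialD_comm (contDiff_infty.1 (hA j i) 2) i j]
  have h2 : ∑ i, ∑ j, partialD i (partialD j (A i j)) x =
      - ∑ i, ∑ j, partialD i (partialD j (A i j)) x := by
    conv_lhs =>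
      rw [Finset.sum_comm]
    rw [← Finset.sum_neg_distrib]
    refine Finset.sum_congr rfl fun i _ => ?_
    rw [← Finset.sum_neg_distrib]
    exact Finset.sum_congr rfl fun j _ => h j i
  linarith

theorem partialD_rowDiv {A : Fin 3 → Fin 3 → E3 → ℝ} (hA : ∀ i j, ContDiff ℝ ∞ (A i j))
    (i : Fin 3) (x : E3) :
    partialD i (fun y => rowDiv A y i) x = ∑ j, partialD i (partialD j (A i j)) x :=
  partialD_sum Finset.univ (fun j _ => (contDiff_infty_partialD (hA i j) j).differentiable (by simp)) i x

theorem isDivFreeTestField_rowDiv {A : Fin 3 → Fin 3 → E3 → ℝ}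
    (hA : ∀ i j, IsTestFunction (A i j)) (hanti : ∀ i j x, A i j x = - A j i x) :
    IsDivFreeTestField (rowDiv A) := by
  refine ⟨contDiff_euclidean.2 fun i => ?_, ?_, fun x => ?_⟩
  · rw [rowDiv_apply]
    exact ContDiff.sum fun j _ => ((hA i j).partialD j).1
  · refine HasCompactSupport.intro
      (K := ⋃ i : Fin 3, ⋃ j : Fin 3, tsupport (partialD j (A i j)))
      (isCompact_iUnion fun i => isCompact_iUnion fun j => ((hA i j).partialD j).2) fun x hx => ?_
    ext i
    change ∑ j, partialD j (A i j) x = 0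
    refine Finset.sum_eq_zero fun j _ => image_eq_zero_of_notMem_tsupport fun h => hx ?_
    exact mem_iUnion.2 ⟨i, mem_iUnion.2 ⟨j, h⟩⟩
  · simp only [partialD_rowDiv fun i j => (hA i j).1]
    exact sum_partialD_partialD_antisymm (fun i j => (hA i j).1) hanti x

theorem IsDivFreeTestField.isTestFunction {w : E3 → E3} (hw : IsDivFreeTestField w) (i : Fin 3) :
    IsTestFunction fun x => w x i := by
  refine ⟨contDiff_euclidean.1 hw.1 i, hw.2.1.mono fun x hx h => hx ?_⟩
  simp [h]

theorem isWeakGradientField_gradField {ψ : E3 → ℝ} (hψ : ContDiff ℝ ∞ ψ) :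
    IsWeakGradientField (gradField ψ) := by
  intro w hw
  have hwi := fun i => hw.isTestFunction i
  have h1 : ∀ {φ : E3 → ℝ}, ContDiff ℝ ∞ φ → ContDiff ℝ 1 φ := fun h =>
    h.of_le (by exact_mod_cast le_top)
  change ∫ x, ∑ i, partialD i ψ x * w x i = 0
  rw [integral_finsetSum]
  · have e : ∀ i, ∫ x, partialD i ψ x * w x i = - ∫ x, ψ x * partialD i (fun y => w y i) x := by
      intro i
      rw [integral_mul_partialD (h1 hψ) (h1 (hwi i).1) (hwi i).2, neg_neg]
    simp only [e]
    rw [Finset.sum_neg_distrib, ← integral_finsetSum]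
    · simp only [← Finset.mul_sum, hw.2.2, mul_zero, integral_zero, neg_zero]
    · intro i _
      exact (hψ.continuous.mul ((hwi i).partialD i).continuous).integrable_of_hasCompactSupport
        ((hwi i).partialD i).2.mul_left
  · intro i _
    exact ((contDiff_infty_partialD hψ i).continuous.mul
      (hwi i).continuous).integrable_of_hasCompactSupport (hwi i).2.mul_left

theorem isWeaklyDivFree_rowDiv {A : Fin 3 → Fin 3 → E3 → ℝ} (hA : ∀ i j, ContDiff ℝ ∞ (A i j))
    (hanti : ∀ i j x, A i j x = - A j i x) : IsWeaklyDivFree (rowDiv A) := by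
  intro φ hφ
  have h1 : ∀ {φ : E3 → ℝ}, ContDiff ℝ ∞ φ → ContDiff ℝ 1 φ := fun h =>
    h.of_le (by exact_mod_cast le_top)
  have hr : ∀ i, ContDiff ℝ ∞ fun x => rowDiv A x i := fun i => by
    rw [rowDiv_apply]
    exact ContDiff.sum fun j _ => contDiff_infty_partialD (hA i j) j
  rw [integral_finsetSum]
  · simp only [integral_mul_partialD (h1 (hr _)) (h1 hφ.1) hφ.2]
    rw [Finset.sum_neg_distrib, ← integral_finsetSum]
    · simp only [← Finset.sum_mul, partialD_rowDiv hA, sum_partialD_partialD_antisymm hA hanti,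
        zero_mul, integral_zero, neg_zero]
    · intro i _
      exact ((contDiff_infty_partialD (hr i) i).continuous.mul
        hφ.continuous).integrable_of_hasCompactSupport hφ.2.mul_left
  · intro i _
    exact ((hr i).continuous.mul (hφ.partialD i).continuous).integrable_of_hasCompactSupport
      (hφ.partialD i).2.mul_left

section Pairing

variable {p q : ℝ≥0∞} [hpq : q.HolderConjugate p]

theorem integrable_mul_of_memLp {f g : E3 → ℝ} (hf : MemLp f q volume) (hg : MemLp g p volume) :
    Integrable (fun x => f x * g x) volume := hf.integrable_mul hg

/-- A divergence-free field in `L^q` is orthogonal to gradients of functions in `W^{1,q'}`. -/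
theorem integral_mul_gradField_eq_zero {a : E3 → E3} (ha : MemLp a q volume)
    (hdiv : IsWeaklyDivFree a) {ψ : E3 → ℝ} (hψ : ContDiff ℝ ∞ ψ) (hψp : MemLp ψ p volume)
    (hψp' : ∀ i, MemLp (partialD i ψ) p volume) :
    ∫ x, ∑ i, a x i * gradField ψ x i = 0 := by
  obtain ⟨χ, hχ⟩ := exists_isCutoffSeq
  have i1 : ∀ i, Integrable (fun x => a x i * partialD i ψ x) volume := fun i =>
    integrable_mul_of_memLp (ha.eval_piLp i) (hψp' i)
  have i2 : ∀ i, Integrable (fun x => a x i * ψ x) volume := fun i =>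
    integrable_mul_of_memLp (ha.eval_piLp i) hψp
  have hF : Integrable (fun x => ∑ i, a x i * partialD i ψ x) volume :=
    integrable_finsetSum _ fun i _ => i1 i
  have hlim := (hχ.tendsto_integral_mul hF).add (tendsto_finsetSum Finset.univ fun i _ =>
    hχ.tendsto_integral_partialD_mul (i2 i) i)
  -- By the Leibniz rule this is the definition of divergence-free with test function `χₙψ`. The
  -- terms with `∂χₙ` vanish in the limit because `aψ` is integrable.
  have hz : ∀ n, (∫ x, χ n x * ∑ i, a x i * partialD i ψ x) +
      ∑ i, ∫ x, partialD i (χ n) x * (a x i * ψ x) = 0 := by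
    intro n
    have i3 : ∀ i, Integrable (fun x => partialD i (χ n) x * (a x i * ψ x)) volume := fun i => by
      obtain ⟨M, _, hM⟩ := ((hχ.test n).partialD i).exists_bound
      exact (i2 i).bdd_mul (c := M) ((hχ.test n).partialD i).continuous.aestronglyMeasurable
        (.of_forall hM)
    have i4 : Integrable (fun x => χ n x * ∑ i, a x i * partialD i ψ x) volume := by
      obtain ⟨M, _, hM⟩ := (hχ.test n).exists_bound
      exact hF.bdd_mul (c := M) (hχ.test n).continuous.aestronglyMeasurable (.of_forall hM)
    rw [← integral_finsetSum _ fun i _ => i3 i,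
      ← integral_add i4 (integrable_finsetSum _ fun i _ => i3 i)]
    rw [← hdiv _ ((hχ.test n).mul_right hψ)]
    congr 1
    funext x
    rw [Finset.mul_sum, ← Finset.sum_add_distrib]
    refine Finset.sum_congr rfl fun i _ => ?_
    rw [partialD_mul (hχ.test n).differentiable (hψ.differentiable (by simp))]
    ring
  have := tendsto_nhds_unique (tendsto_const_nhds.congr fun n => (hz n).symm) hlim
  simpa [gradField] using this.symm

/-- A gradient field in `L^q` is orthogonal to divergences of antisymmetric fields in
`W^{1,q'}`. -/
theorem integral_mul_rowDiv_eq_zero {g : E3 → E3} (hg : MemLp g q volume)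
    (hgrad : IsWeakGradientField g) {A : Fin 3 → Fin 3 → E3 → ℝ} (hA : ∀ i j, ContDiff ℝ ∞ (A i j))
    (hanti : ∀ i j x, A i j x = - A j i x) (hAp : ∀ i j, MemLp (A i j) p volume)
    (hAp' : ∀ i j k, MemLp (partialD k (A i j)) p volume) :
    ∫ x, ∑ i, g x i * rowDiv A x i = 0 := by
  obtain ⟨χ, hχ⟩ := exists_isCutoffSeq
  have i1 : ∀ i j, Integrable (fun x => g x i * partialD j (A i j) x) volume := fun i j =>
    integrable_mul_of_memLp (hg.eval_piLp i) (hAp' i j j)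
  have i2 : ∀ i j, Integrable (fun x => g x i * A i j x) volume := fun i j =>
    integrable_mul_of_memLp (hg.eval_piLp i) (hAp i j)
  have hF : Integrable (fun x => ∑ i, ∑ j, g x i * partialD j (A i j) x) volume :=
    integrable_finsetSum _ fun i _ => integrable_finsetSum _ fun j _ => i1 i j
  have hlim := (hχ.tendsto_integral_mul hF).add (tendsto_finsetSum Finset.univ fun i _ =>
    tendsto_finsetSum Finset.univ fun j _ => hχ.tendsto_integral_partialD_mul (i2 i j) j)
  -- The cutoff is applied to the potential `A`, not to its divergence: `χₙA` is still
  -- antisymmetric, so its row divergence is an admissible divergence-free test field.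
  have hz : ∀ n, (∫ x, χ n x * ∑ i, ∑ j, g x i * partialD j (A i j) x) +
      ∑ i, ∑ j, ∫ x, partialD j (χ n) x * (g x i * A i j x) = 0 := by
    intro n
    have i3 : ∀ i j, Integrable (fun x => partialD j (χ n) x * (g x i * A i j x)) volume :=
      fun i j => by
        obtain ⟨M, _, hM⟩ := ((hχ.test n).partialD j).exists_bound
        exact (i2 i j).bdd_mul (c := M) ((hχ.test n).partialD j).continuous.aestronglyMeasurable
          (.of_forall hM)
    have i4 : Integrable (fun x => χ n x * ∑ i, ∑ j, g x i * partialD j (A i j) x) volume := by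
      obtain ⟨M, _, hM⟩ := (hχ.test n).exists_bound
      exact hF.bdd_mul (c := M) (hχ.test n).continuous.aestronglyMeasurable (.of_forall hM)
    have i5 : ∀ i, Integrable (fun x => ∑ j, partialD j (χ n) x * (g x i * A i j x)) volume :=
      fun i => integrable_finsetSum _ fun j _ => i3 i j
    have e1 : ∑ i, ∑ j, ∫ x, partialD j (χ n) x * (g x i * A i j x) =
        ∫ x, ∑ i, ∑ j, partialD j (χ n) x * (g x i * A i j x) := by
      rw [integral_finsetSum _ fun i _ => i5 i]
      exact Finset.sum_congr rfl fun i _ => (integral_finsetSum _ fun j _ => i3 i j).symm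
    rw [e1, ← integral_add i4 (integrable_finsetSum _ fun i _ => i5 i)]
    rw [← hgrad _ (isDivFreeTestField_rowDiv (A := fun i j x => χ n x * A i j x)
      (fun i j => (hχ.test n).mul_right (hA i j)) (fun i j x => by rw [hanti i j]; ring))]
    congr 1
    funext x
    rw [Finset.mul_sum, ← Finset.sum_add_distrib]
    refine Finset.sum_congr rfl fun i _ => ?_
    change _ = g x i * ∑ j, partialD j (fun x => χ n x * A i j x) x
    rw [Finset.mul_sum, Finset.mul_sum, ← Finset.sum_add_distrib]
    refine Finset.sum_congr rfl fun j _ => ?_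
    rw [partialD_mul (hχ.test n).differentiable ((hA i j).differentiable (by simp))]
    ring
  have := tendsto_nhds_unique (tendsto_const_nhds.congr fun n => (hz n).symm) hlim
  simpa [rowDiv, Finset.mul_sum] using this.symm

end Pairing

/-! ### Explicit Helmholtz splitting of regularized test fields -/

section Components

variable {f : E3 → ℝ} {s T : ℝ}

/-- The potential of the gradient part of `(P_{2s} f - P_{2T} f) eₖ`. -/
def helmPot (s T : ℝ) (k : Fin 3) (f : E3 → ℝ) (x : E3) : ℝ := - heatInt s T (partialD k f) x

/-- The antisymmetric potential of the divergence-free part of `(P_{2s} f - P_{2T} f) eₖ`. -/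
def helmMat (s T : ℝ) (k : Fin 3) (f : E3 → ℝ) (i j : Fin 3) (x : E3) : ℝ :=
  (if j = k then heatInt s T (partialD i f) x else 0) -
    (if i = k then heatInt s T (partialD j f) x else 0)

theorem contDiff_heatInt (hf : IsTestFunction f) : ContDiff ℝ ∞ (heatInt s T f) :=
  contDiff_translateAvg _ hf.1 hf.2

theorem partialD_heatInt (hf : IsTestFunction f) (i : Fin 3) :
    partialD i (heatInt s T f) = heatInt s T (partialD i f) := partialD_translateAvg _ hf i

theorem memLp_translateAvg (ν : Measure E3) [IsFiniteMeasure ν] (hf : IsTestFunction f)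
    {r : ℝ≥0∞} (hr : 1 ≤ r) (hr' : r ≠ ⊤) : MemLp (translateAvg ν f) r volume := by
  obtain ⟨M, _, hM⟩ := hf.exists_bound
  exact memLp_of_integrable_of_bound (integrable_translateAvg _ hf.continuous hf.integrable)
    (norm_translateAvg_le _ hM) hr hr'

theorem memLp_heatInt (hf : IsTestFunction f) {r : ℝ≥0∞} (hr : 1 ≤ r) (hr' : r ≠ ⊤) :
    MemLp (heatInt s T f) r volume := memLp_translateAvg _ hf hr hr'

theorem helmMat_antisymm (k i j : Fin 3) (x : E3) :
    helmMat s T k f i j x = - helmMat s T k f j i x := by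
  simp [helmMat]

theorem contDiff_helmMat (hf : IsTestFunction f) (k i j : Fin 3) :
    ContDiff ℝ ∞ (helmMat s T k f i j) := by
  unfold helmMat
  refine ContDiff.sub ?_ ?_
  · by_cases h : j = k
    · simpa only [h, if_true] using contDiff_heatInt (hf.partialD i)
    · simpa only [h, if_false] using contDiff_const
  · by_cases h : i = k
    · simpa only [h, if_true] using contDiff_heatInt (hf.partialD j)
    · simpa only [h, if_false] using contDiff_const

theorem partialD_ite (hf : IsTestFunction f) (c : Prop) [Decidable c] (l : Fin 3) (x : E3) :
    partialD l (fun y => if c then heatInt s T f y else 0) x =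
      if c then heatInt s T (partialD l f) x else 0 := by
  by_cases h : c
  · simp only [h, if_true]
    exact congrFun (partialD_heatInt hf l) x
  · simp [h, partialD]

theorem partialD_helmMat (hf : IsTestFunction f) (k i j l : Fin 3) :
    partialD l (helmMat s T k f i j) = fun x =>
      (if j = k then heatInt s T (partialD l (partialD i f)) x else 0) -
      (if i = k then heatInt s T (partialD l (partialD j f)) x else 0) := by
  funext x
  have hd : ∀ (c : Prop) [Decidable c] (m : Fin 3), Differentiable ℝ fun y =>
      if c then heatInt s T (partialD m f) y else 0 := by
    intro c _ m
    by_cases h : c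
    · simpa only [h, if_true] using (contDiff_heatInt (hf.partialD m)).differentiable (by simp)
    · simpa only [h, if_false] using differentiable_const _
  unfold helmMat
  rw [partialD_sub (hd _ _) (hd _ _), partialD_ite (hf.partialD i), partialD_ite (hf.partialD j)]

theorem memLp_ite (c : Prop) [Decidable c] (hf : IsTestFunction f) {r : ℝ≥0∞} (hr : 1 ≤ r)
    (hr' : r ≠ ⊤) : MemLp (fun x => if c then heatInt s T f x else 0) r volume := by
  by_cases h : c
  · simpa only [h, if_true] using memLp_heatInt hf hr hr'
  · simpa only [h, if_false] using MemLp.zero'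

theorem memLp_helmMat (hf : IsTestFunction f) (k i j : Fin 3) {r : ℝ≥0∞} (hr : 1 ≤ r)
    (hr' : r ≠ ⊤) : MemLp (helmMat s T k f i j) r volume :=
  (memLp_ite _ (hf.partialD i) hr hr').sub (memLp_ite _ (hf.partialD j) hr hr')

theorem memLp_partialD_helmMat (hf : IsTestFunction f) (k i j l : Fin 3) {r : ℝ≥0∞} (hr : 1 ≤ r)
    (hr' : r ≠ ⊤) : MemLp (partialD l (helmMat s T k f i j)) r volume := by
  rw [partialD_helmMat hf]
  exact (memLp_ite _ ((hf.partialD i).partialD l) hr hr').sub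
    (memLp_ite _ ((hf.partialD j).partialD l) hr hr')

theorem contDiff_helmPot (hf : IsTestFunction f) (k : Fin 3) : ContDiff ℝ ∞ (helmPot s T k f) :=
  (contDiff_heatInt (hf.partialD k)).neg

theorem partialD_helmPot (hf : IsTestFunction f) (k i : Fin 3) :
    partialD i (helmPot s T k f) = fun x => - heatInt s T (partialD i (partialD k f)) x := by
  funext x
  unfold helmPot
  rw [partialD_neg, partialD_heatInt (hf.partialD k)]

theorem memLp_helmPot (hf : IsTestFunction f) (k : Fin 3) {r : ℝ≥0∞} (hr : 1 ≤ r)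
    (hr' : r ≠ ⊤) : MemLp (helmPot s T k f) r volume :=
  (memLp_heatInt (hf.partialD k) hr hr').neg

theorem memLp_partialD_helmPot (hf : IsTestFunction f) (k i : Fin 3) {r : ℝ≥0∞} (hr : 1 ≤ r)
    (hr' : r ≠ ⊤) : MemLp (partialD i (helmPot s T k f)) r volume := by
  rw [partialD_helmPot hf]
  exact (memLp_heatInt ((hf.partialD k).partialD i) hr hr').neg

theorem heatInt_lap_eq_sum (hf : IsTestFunction f) (x : E3) :
    heatInt s T (lap f) x = ∑ i, heatInt s T (partialD i (partialD i f)) x := by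
  unfold heatInt translateAvg lap
  refine integral_finsetSum _ fun i _ => ?_
  obtain ⟨M, _, hM⟩ := ((hf.partialD i).partialD i).exists_bound
  exact integrable_translate _ ((hf.partialD i).partialD i).continuous hM x

/-- Helmholtz decomposition of `(P_{2s} f - P_{2T} f) eₖ`. -/
theorem rowDiv_add_gradField (hf : IsTestFunction f) (hs : 0 < s) (hsT : s ≤ T) (k i : Fin 3)
    (x : E3) : rowDiv (helmMat s T k f) x i + gradField (helmPot s T k f) x i =
      if i = k then heat (2 * s) f x - heat (2 * T) f x else 0 := by
  have h1 : rowDiv (helmMat s T k f) x i = ∑ j, partialD j (helmMat s T k f i j) x := rfl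
  have h2 : gradField (helmPot s T k f) x i = partialD i (helmPot s T k f) x := rfl
  rw [h1, h2, partialD_helmPot hf]
  simp only [partialD_helmMat hf, Finset.sum_sub_distrib, Finset.sum_ite_eq', Finset.mem_univ,
    if_true]
  -- With `h` the truncated potential of `f`, the row divergence is `∂ₖ∂ᵢh - δᵢₖΔh` and the gradient
  -- is `-∂ᵢ∂ₖh`; only the Laplacian remains.
  rw [partialD_comm (contDiff_infty.1 hf.1 2) k i]
  by_cases h : i = k
  · simp only [h, if_true]
    have := heatInt_lap hf hs hsT x
    rw [heatInt_lap_eq_sum hf] at this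
    linarith
  · simp [h]

end Components

/-! ### Convergence of the regularization -/

/-- The approximation of the identity `P_{2/(n+1)} - P_{2(n+1)}`. -/
def heatDiff (n : ℕ) (f : E3 → ℝ) (x : E3) : ℝ :=
  heat (2 * ((n : ℝ) + 1)⁻¹) f x - heat (2 * ((n : ℝ) + 1)) f x

theorem tendsto_eLpNorm_heatDiff_sub {f : E3 → ℝ} (hf : IsTestFunction f) {r : ℝ≥0∞} (hr : 1 < r)
    (hr' : r ≠ ⊤) :
    Tendsto (fun n => eLpNorm (fun x => heatDiff n f x - f x) r volume) atTop (𝓝 0) := by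
  obtain ⟨C, hC0, hC⟩ := abs_heat_sub_le hf
  set C' : ℝ := (2 * Real.pi) ^ (-(3 / 2) : ℝ) * ∫ y, |f y|
  have hr1 : 1 < r.toReal := by
    rw [← ENNReal.toReal_one]
    exact (ENNReal.toReal_lt_toReal ENNReal.one_ne_top hr').2 hr
  -- Supremum bounds: the first term is continuity at time zero, the second the decay for large
  -- times. The `L^1` norms only stay bounded, so interpolation gives convergence for `r > 1`.
  set M : ℕ → ℝ := fun n => C * √(2 * ((n : ℝ) + 1)⁻¹) + (√(2 * ((n : ℝ) + 1)))⁻¹ ^ 3 * C'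
  have hM : ∀ n x, ‖heatDiff n f x - f x‖ ≤ M n := by
    intro n x
    have h1 := hC (2 * ((n : ℝ) + 1)⁻¹) x
    have h2 := abs_heat_le hf (t := 2 * ((n : ℝ) + 1)) (by positivity) x
    have h3 : heatDiff n f x - f x = (heat (2 * ((n : ℝ) + 1)⁻¹) f x - f x) -
      heat (2 * ((n : ℝ) + 1)) f x := by
      unfold heatDiff
      ring
    rw [h3, Real.norm_eq_abs]
    exact (abs_sub _ _).trans (add_le_add h1 h2)
  have hMlim : Tendsto M atTop (𝓝 0) := by
    have hinf : Tendsto (fun n : ℕ => (n : ℝ) + 1) atTop atTop :=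
      tendsto_atTop_add_const_right _ _ tendsto_natCast_atTop_atTop
    have h1 : Tendsto (fun n : ℕ => √(2 * ((n : ℝ) + 1)⁻¹)) atTop (𝓝 (√(2 * 0))) :=
      ((tendsto_inv_atTop_zero.comp hinf).const_mul 2).sqrt
    have h2 : Tendsto (fun n : ℕ => (√(2 * ((n : ℝ) + 1)))⁻¹) atTop (𝓝 0) :=
      tendsto_inv_atTop_zero.comp
        (Real.tendsto_sqrt_atTop.comp (hinf.const_mul_atTop (by norm_num : (0 : ℝ) < 2)))
    have h3 := (h1.const_mul C).add ((h2.pow 3).mul_const C')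
    have h4 : C * √(2 * 0) + 0 ^ 3 * C' = 0 := by simp
    rw [h4] at h3
    exact h3
  have hL1 : ∀ n, eLpNorm (fun x => heatDiff n f x - f x) 1 volume ≤
      ENNReal.ofReal (3 * ∫ x, |f x|) := by
    intro n
    have i1 := integrable_translateAvg (gaussMeasure (2 * ((n : ℝ) + 1)⁻¹)) hf.continuous
      hf.integrable
    have i2 := integrable_translateAvg (gaussMeasure (2 * ((n : ℝ) + 1))) hf.continuous
      hf.integrable
    have b1 := integral_abs_translateAvg_le (gaussMeasure (2 * ((n : ℝ) + 1)⁻¹)) hf.continuous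
      hf.integrable
    have b2 := integral_abs_translateAvg_le (gaussMeasure (2 * ((n : ℝ) + 1))) hf.continuous
      hf.integrable
    simp only [probReal_univ, one_mul] at b1 b2
    have hI : Integrable (fun x => heatDiff n f x - f x) volume := (i1.sub i2).sub hf.integrable
    rw [eLpNorm_one_eq_lintegral_enorm, ← ofReal_integral_norm_eq_lintegral_enorm hI]
    refine ENNReal.ofReal_le_ofReal ?_
    have hI2 := (i1.abs.add i2.abs).add hf.integrable.abs
    calc _ ≤ ∫ x, (|translateAvg (gaussMeasure (2 * ((n : ℝ) + 1)⁻¹)) f x| +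
          |translateAvg (gaussMeasure (2 * ((n : ℝ) + 1))) f x|) + |f x| := by
          refine integral_mono hI.norm hI2 fun x => ?_
          exact (abs_sub _ _).trans (add_le_add_left (abs_sub _ _) _)
      _ ≤ _ := by
          have e : ∫ x, (|translateAvg (gaussMeasure (2 * ((n : ℝ) + 1)⁻¹)) f x| +
            |translateAvg (gaussMeasure (2 * ((n : ℝ) + 1))) f x|) + |f x| =
            (∫ x, |translateAvg (gaussMeasure (2 * ((n : ℝ) + 1)⁻¹)) f x|) +
            (∫ x, |translateAvg (gaussMeasure (2 * ((n : ℝ) + 1))) f x|) + ∫ x, |f x| := by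
            rw [← integral_add i1.abs i2.abs]
            exact integral_add (i1.abs.add i2.abs) hf.integrable.abs
          rw [e]
          linarith
  have hup : Tendsto (fun n => (ENNReal.ofReal (M n) ^ (r.toReal - 1) *
      ENNReal.ofReal (3 * ∫ x, |f x|)) ^ (1 / r.toReal)) atTop (𝓝 0) := by
    have h1 : Tendsto (fun n => ENNReal.ofReal (M n)) atTop (𝓝 0) := by
      simpa using ENNReal.tendsto_ofReal hMlim
    have h2 := h1.ennrpow_const (r.toReal - 1)
    rw [ENNReal.zero_rpow_of_pos (by linarith)] at h2
    have h3 := ENNReal.Tendsto.mul_const h2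
      (b := ENNReal.ofReal (3 * ∫ x, |f x|)) (.inr ENNReal.ofReal_ne_top)
    rw [zero_mul] at h3
    have h4 := h3.ennrpow_const (1 / r.toReal)
    rwa [ENNReal.zero_rpow_of_pos (by positivity)] at h4
  refine tendsto_of_tendsto_of_tendsto_of_le_of_le tendsto_const_nhds hup
    (fun _ => bot_le) fun n => ?_
  refine (eLpNorm_le_of_bound (hM n) hr.le hr').trans ?_
  gcongr
  exact hL1 n

/-! ### Duality with test functions -/

section Duality

variable {p q : ℝ≥0∞} [hpq : q.HolderConjugate p]

theorem abs_integral_mul_le {F w : E3 → ℝ} (hF : MemLp F p volume) (hw : MemLp w q volume) :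
    |∫ x, w x * F x| ≤ (eLpNorm w q volume).toReal * (eLpNorm F p volume).toReal := by
  have h1 : eLpNorm (fun x => w x * F x) 1 volume ≤ eLpNorm w q volume * eLpNorm F p volume :=
    eLpNorm_smul_le_mul_eLpNorm (f := F) (φ := w) hF.1 hw.1
  have hI := integrable_mul_of_memLp hw hF
  calc |∫ x, w x * F x| ≤ ∫ x, ‖w x * F x‖ := abs_integral_le_integral_abs
    _ = (eLpNorm (fun x => w x * F x) 1 volume).toReal := by
        rw [eLpNorm_one_eq_lintegral_enorm, integral_norm_eq_lintegral_enorm hI.1]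
    _ ≤ (eLpNorm w q volume * eLpNorm F p volume).toReal :=
        ENNReal.toReal_mono (ENNReal.mul_ne_top hw.2.ne hF.2.ne) h1
    _ = _ := ENNReal.toReal_mul

/-- Density of test functions in `L^q`. The norm of `F` enters only the approximation error, so the
resulting constant is still `M`. -/
theorem abs_integral_mul_le_of_test {F w : E3 → ℝ} (hF : MemLp F p volume)
    (hw : MemLp w q volume) (hq1 : 1 ≤ q) (hq' : q ≠ ⊤) {M : ℝ} (hM0 : 0 ≤ M)
    (hM : ∀ k, IsTestFunction k → |∫ x, k x * F x| ≤ M * lpn q k) :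
    |∫ x, w x * F x| ≤ M * (eLpNorm w q volume).toReal := by
  set N := (eLpNorm F p volume).toReal with hN
  have hN0 : 0 ≤ N := ENNReal.toReal_nonneg
  refine le_of_forall_pos_le_add fun ε hε => ?_
  have hε' : 0 < ε / (M + N + 1) := by positivity
  obtain ⟨k, hk1, hk2, hk3⟩ := hw.exist_eLpNorm_sub_le hq' hq1 hε'
  have hk : IsTestFunction k := ⟨hk2, hk1⟩
  have hkm := hk.memLp q
  have hd := hw.sub hkm
  have hdn : (eLpNorm (w - k) q volume).toReal ≤ ε / (M + N + 1) :=
    ENNReal.toReal_le_of_le_ofReal hε'.le hk3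
  have hkn : lpn q k ≤ (eLpNorm w q volume).toReal + ε / (M + N + 1) := by
    refine le_trans ?_ (add_le_add_right hdn _)
    rw [lpn, ← ENNReal.toReal_add hw.2.ne hd.2.ne]
    refine ENNReal.toReal_mono (ENNReal.add_ne_top.2 ⟨hw.2.ne, hd.2.ne⟩) ?_
    have : k = w - (w - k) := by simp
    conv_lhs => rw [this]
    exact eLpNorm_sub_le hw.1 hd.1 hq1
  have e1 : ∫ x, w x * F x = (∫ x, k x * F x) + ∫ x, (w - k) x * F x := by
    rw [← integral_add (integrable_mul_of_memLp hkm hF) (integrable_mul_of_memLp hd hF)]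
    congr 1
    funext x
    simp only [Pi.sub_apply]
    ring
  have e2 := abs_integral_mul_le hF hd
  have e3 : (M + N) * (ε / (M + N + 1)) ≤ ε := by
    rw [mul_div_assoc', div_le_iff₀ (by positivity)]
    nlinarith
  rw [e1]
  calc _ ≤ |∫ x, k x * F x| + |∫ x, (w - k) x * F x| := abs_add_le _ _
    _ ≤ M * ((eLpNorm w q volume).toReal + ε / (M + N + 1)) + ε / (M + N + 1) * N := by
        refine add_le_add ((hM k hk).trans ?_) (e2.trans ?_)
        · gcongr
        · gcongr
    _ ≤ _ := by linarith

/-- The `L^q` norm is controlled by duality with test functions. -/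
theorem toReal_eLpNorm_le_of_test {g : E3 → ℝ} (hg : MemLp g q volume) (hq1 : 1 < q)
    (hq' : q ≠ ⊤) (hp1 : 1 ≤ p) (hp' : p ≠ ⊤) {M : ℝ} (hM0 : 0 ≤ M)
    (hM : ∀ k, IsTestFunction k → |∫ x, k x * g x| ≤ M * lpn p k) :
    (eLpNorm g q volume).toReal ≤ M := by
  have : p.HolderConjugate q := hpq.symm
  have hr : q.toReal.HolderConjugate p.toReal :=
    ENNReal.HolderConjugate.toReal_of_ne_top (p := q) (q := p) hq' hp'
  have hq0 : q ≠ 0 := by positivity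
  have hp0 : p ≠ 0 := by positivity
  set N := (eLpNorm g q volume).toReal with hN
  have hN0 : 0 ≤ N := ENNReal.toReal_nonneg
  by_cases hNz : N = 0
  · rw [hNz]
    exact hM0
  have hNpos : 0 < N := lt_of_le_of_ne hN0 (Ne.symm hNz)
  -- The extremal function of Hölder's inequality: `|h|^p = |g|^q` and `hg = |g|^q`, so the bound
  -- reads `N^q ≤ M N^(q/p)`, where `q = 1 + q/p`.
  set h : E3 → ℝ := fun x => SignType.sign (g x) * |g x| ^ (q.toReal - 1) with hh
  have hr1 := hr.lt
  have hsign : Measurable fun y : ℝ => ((SignType.sign y : SignType) : ℝ) := by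
    have : (fun y : ℝ => ((SignType.sign y : SignType) : ℝ)) =
        fun y => if 0 < y then 1 else if y < 0 then -1 else 0 := by
      funext y
      rw [sign_apply]
      split_ifs <;> simp
    rw [this]
    exact Measurable.ite measurableSet_Ioi measurable_const
      (Measurable.ite measurableSet_Iio measurable_const measurable_const)
  have hmeas : AEStronglyMeasurable h volume := by
    have hgm := hg.1.aemeasurable
    exact ((hsign.comp_aemeasurable hgm).mul (hgm.abs.pow_const _)).aestronglyMeasurable
  have habs : ∀ x, ‖h x‖ ^ p.toReal = ‖g x‖ ^ q.toReal := by
    intro x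
    rw [hh]
    simp only [norm_mul]
    by_cases hx : g x = 0
    · simp [hx, Real.zero_rpow hr.symm.ne_zero, Real.zero_rpow hr.ne_zero]
    · have h1 : ‖((SignType.sign (g x) : SignType) : ℝ)‖ = 1 := by
        rcases lt_or_gt_of_ne hx with h | h
        · simp [sign_neg h]
        · simp [sign_pos h]
      rw [h1, one_mul, Real.norm_of_nonneg (by positivity), ← Real.rpow_mul (abs_nonneg _),
        Real.norm_eq_abs]
      congr 1
      have := hr.mul_eq_add
      linarith
  have hgp : Integrable (fun x => ‖g x‖ ^ q.toReal) volume := hg.integrable_norm_rpow hq0 hq'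
  have hhm : MemLp h p volume := by
    rw [← integrable_norm_rpow_iff hmeas hp0 hp']
    simpa only [habs] using hgp
  have hIg : ∫ x, ‖g x‖ ^ q.toReal = N ^ q.toReal := by
    have h1 : 0 ≤ ∫ x, ‖g x‖ ^ q.toReal := integral_nonneg fun x => by positivity
    rw [hN, hg.eLpNorm_eq_integral_rpow_norm hq0 hq', ENNReal.toReal_ofReal (by positivity),
      Real.rpow_inv_rpow h1 hr.ne_zero]
  have hhn : (eLpNorm h p volume).toReal = N ^ (q.toReal / p.toReal) := by
    rw [hhm.eLpNorm_eq_integral_rpow_norm hp0 hp', ENNReal.toReal_ofReal (by positivity)]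
    simp only [habs]
    rw [hIg, ← Real.rpow_mul hN0, div_eq_mul_inv]
  have hprod : ∫ x, h x * g x = N ^ q.toReal := by
    rw [← hIg]
    congr 1
    funext x
    rw [hh]
    by_cases hx : g x = 0
    · simp [hx, Real.zero_rpow hr.ne_zero]
    · have h1 : ((SignType.sign (g x) : SignType) : ℝ) * g x = |g x| := sign_mul_self (g x)
      have h2 : |g x| ^ q.toReal = |g x| ^ (q.toReal - 1) * |g x| := by
        rw [Real.rpow_sub_one (abs_pos.2 hx).ne', div_mul_cancel₀ _ (abs_pos.2 hx).ne']
      simp only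
      rw [Real.norm_eq_abs, h2, mul_right_comm, h1, mul_comm]
  have key := abs_integral_mul_le_of_test (p := q) (q := p) hg hhm hp1 hp' hM0 hM
  rw [hprod, hhn, abs_of_nonneg (by positivity)] at key
  have h3 : N ^ q.toReal = N * N ^ (q.toReal / p.toReal) := by
    rw [← Real.rpow_one_add' hN0]
    · congr 1
      have := hr.mul_eq_add
      have hp0' := hr.symm.ne_zero
      field_simp
      linarith
    · have := hr.pos
      have := hr.symm.pos
      positivity
  rw [h3] at key
  exact le_of_mul_le_mul_right key (by positivity)

end Duality

/-! ### A priori bound and existence of the Helmholtz decomposition -/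

theorem norm_le_sum_abs (v : E3) : ‖v‖ ≤ ∑ i, |v i| := by
  rw [EuclideanSpace.norm_eq, Fin.sum_univ_three, Fin.sum_univ_three]
  refine Real.sqrt_le_iff.2 ⟨by positivity, ?_⟩
  simp only [Real.norm_eq_abs]
  nlinarith [abs_nonneg (v 0), abs_nonneg (v 1), abs_nonneg (v 2),
    mul_nonneg (abs_nonneg (v 0)) (abs_nonneg (v 1)),
    mul_nonneg (abs_nonneg (v 0)) (abs_nonneg (v 2)),
    mul_nonneg (abs_nonneg (v 1)) (abs_nonneg (v 2))]

theorem eLpNorm_le_sum_coord {g : E3 → E3} {q : ℝ≥0∞} (hq : 1 ≤ q) (hg : MemLp g q volume) :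
    eLpNorm g q volume ≤ ∑ i, eLpNorm (fun x => g x i) q volume := by
  have h1 : eLpNorm g q volume ≤ eLpNorm (fun x => ∑ i, |g x i|) q volume :=
    eLpNorm_mono_real fun x => norm_le_sum_abs (g x)
  have h2 : (fun x => ∑ i, |g x i|) = ∑ i, fun x => |g x i| := by
    funext x
    simp
  refine h1.trans ?_
  rw [h2]
  refine (eLpNorm_sum_le (fun i _ => (hg.eval_piLp i).1.norm) hq).trans_eq ?_
  exact Finset.sum_congr rfl fun i _ => eLpNorm_norm _

theorem eLpNorm_coord_le (g : E3 → E3) (q : ℝ≥0∞) (i : Fin 3) :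
    eLpNorm (fun x => g x i) q volume ≤ eLpNorm g q volume :=
  eLpNorm_mono fun x => PiLp.norm_apply_le (g x) i

section

variable {p q : ℝ≥0∞} [hpq : q.HolderConjugate p]

theorem memLp_rowDiv {A : Fin 3 → Fin 3 → E3 → ℝ} {r : ℝ≥0∞}
    (hA : ∀ i j k, MemLp (partialD k (A i j)) r volume) : MemLp (rowDiv A) r volume :=
  MemLp.of_eval_piLp fun i => by
    rw [rowDiv_apply]
    exact memLp_finsetSum _ fun j _ => hA i j j

theorem memLp_gradField {ψ : E3 → ℝ} {r : ℝ≥0∞}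
    (hψ : ∀ i, MemLp (partialD i ψ) r volume) : MemLp (gradField ψ) r volume :=
  MemLp.of_eval_piLp fun i => hψ i

theorem tendsto_integral_mul_heatDiff {w f : E3 → ℝ} (hw : MemLp w q volume)
    (hf : IsTestFunction f) (hp1 : 1 < p) (hp' : p ≠ ⊤) :
    Tendsto (fun n => ∫ x, w x * heatDiff n f x) atTop (𝓝 (∫ x, w x * f x)) := by
  have hm : ∀ n, MemLp (heatDiff n f) p volume := fun n =>
    (memLp_translateAvg _ hf hp1.le hp').sub (memLp_translateAvg _ hf hp1.le hp')
  rw [tendsto_iff_norm_sub_tendsto_zero]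
  have h1 := (ENNReal.tendsto_toReal (by simp)).comp (tendsto_eLpNorm_heatDiff_sub hf hp1 hp')
  have h2 := h1.const_mul (eLpNorm w q volume).toReal
  simp only [ENNReal.toReal_zero, mul_zero] at h2
  refine squeeze_zero (fun _ => norm_nonneg _) (fun n => ?_) h2
  rw [← integral_sub (integrable_mul_of_memLp hw (hm n))
    (integrable_mul_of_memLp hw (hf.memLp p))]
  simp only [← mul_sub]
  exact abs_integral_mul_le ((hm n).sub (hf.memLp p)) hw

/-- The test field `heatDiff n f · eₖ` is split into its two parts. The field `g` does not see the
divergence-free part and `a` does not see the gradient part, so `a` may be added for free, and only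
the sum `a + g` appears on the right. -/
theorem integral_coord_mul_heatDiff {a g : E3 → E3} (ha : MemLp a q volume)
    (hg : MemLp g q volume) (hdiv : IsWeaklyDivFree a) (hgrad : IsWeakGradientField g)
    {f : E3 → ℝ} (hf : IsTestFunction f) (hp1 : 1 ≤ p) (hp' : p ≠ ⊤) (k : Fin 3) (n : ℕ) :
    ∫ x, g x k * heatDiff n f x = - ∑ i, ∫ x, (a x i + g x i) *
      heatInt ((n : ℝ) + 1)⁻¹ ((n : ℝ) + 1) (partialD i (partialD k f)) x := by
  set s : ℝ := ((n : ℝ) + 1)⁻¹ with hs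
  set T : ℝ := (n : ℝ) + 1 with hT
  have hT1 : 1 ≤ T := by simp [hT]
  have hs0 : 0 < s := inv_pos.2 (by linarith)
  have hsT : s ≤ T := (inv_le_one_of_one_le₀ hT1).trans hT1
  have hR : MemLp (rowDiv (helmMat s T k f)) p volume :=
    memLp_rowDiv fun i j l => memLp_partialD_helmMat hf k i j l hp1 hp'
  have hG : MemLp (gradField (helmPot s T k f)) p volume :=
    memLp_gradField fun i => memLp_partialD_helmPot hf k i hp1 hp'
  have hsum : ∀ {b : E3 → E3} {V : E3 → E3}, MemLp b q volume → MemLp V p volume →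
      Integrable (fun x => ∑ i, b x i * V x i) volume := fun hb hV =>
    integrable_finsetSum _ fun i _ => integrable_mul_of_memLp (hb.eval_piLp i) (hV.eval_piLp i)
  have e1 := integral_mul_gradField_eq_zero ha hdiv (contDiff_helmPot hf k)
    (memLp_helmPot (s := s) (T := T) hf k hp1 hp')
    fun i => memLp_partialD_helmPot hf k i hp1 hp'
  have e2 := integral_mul_rowDiv_eq_zero hg hgrad (A := helmMat s T k f)
    (fun i j => contDiff_helmMat hf k i j) (fun i j x => helmMat_antisymm k i j x)
    (fun i j => memLp_helmMat hf k i j hp1 hp')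
    fun i j l => memLp_partialD_helmMat hf k i j l hp1 hp'
  have e3 : ∫ x, g x k * heatDiff n f x = (∫ x, ∑ i, a x i * gradField (helmPot s T k f) x i) +
      ((∫ x, ∑ i, g x i * rowDiv (helmMat s T k f) x i) +
      ∫ x, ∑ i, g x i * gradField (helmPot s T k f) x i) := by
    rw [e1, zero_add, ← integral_add (hsum hg hR) (hsum hg hG)]
    congr 1
    funext x
    simp only [← Finset.sum_add_distrib, ← mul_add, rowDiv_add_gradField hf hs0 hsT]
    simp [heatDiff, hs, hT]
  rw [e3, e2, zero_add, ← integral_add (hsum ha hG) (hsum hg hG), ← Finset.sum_neg_distrib]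
  have e4 : ∀ x, ((∑ i, a x i * gradField (helmPot s T k f) x i) +
      ∑ i, g x i * gradField (helmPot s T k f) x i) =
      ∑ i, - ((a x i + g x i) * heatInt s T (partialD i (partialD k f)) x) := by
    intro x
    rw [← Finset.sum_add_distrib]
    refine Finset.sum_congr rfl fun i _ => ?_
    have : gradField (helmPot s T k f) x i = partialD i (helmPot s T k f) x := rfl
    rw [this, partialD_helmPot hf]
    ring
  simp only [e4]
  rw [integral_finsetSum]
  · simp only [integral_neg]
  · intro i _
    exact (integrable_mul_of_memLp ((ha.eval_piLp i).add (hg.eval_piLp i))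
      (memLp_heatInt ((hf.partialD k).partialD i) hp1 hp')).neg

/-- A priori bound for the gradient part of a Helmholtz decomposition. -/
theorem exists_gradient_part_bound (hq1 : 1 < q) (hq' : q ≠ ⊤) (hp1 : 1 < p) (hp' : p ≠ ⊤) :
    ∃ C : ℝ, 0 ≤ C ∧ ∀ a g : E3 → E3, MemLp a q volume → MemLp g q volume →
      IsWeaklyDivFree a → IsWeakGradientField g →
      eLpNorm g q volume ≤ ENNReal.ofReal C * eLpNorm (fun x => a x + g x) q volume := by
  obtain ⟨C, hC0, hC⟩ := exists_heatPairing_le hpq.symm hp1 hp'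
  -- Three second derivatives `∂ᵢ∂ₖ` for each of the three components of `g`.
  refine ⟨9 * C, by positivity, fun a g ha hg hdiv hgrad => ?_⟩
  have hw : MemLp (fun x => a x + g x) q volume := ha.add hg
  set N := (eLpNorm (fun x => a x + g x) q volume).toReal with hN
  have hN0 : 0 ≤ N := ENNReal.toReal_nonneg
  have hwi : ∀ i, (eLpNorm (fun x => a x i + g x i) q volume).toReal ≤ N := fun i =>
    ENNReal.toReal_mono hw.2.ne (eLpNorm_coord_le (fun x => a x + g x) q i)
  have hk : ∀ k, (eLpNorm (fun x => g x k) q volume).toReal ≤ 3 * C * N := by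
    intro k
    refine toReal_eLpNorm_le_of_test (p := p) (hg.eval_piLp k) hq1 hq' hp1.le hp' (by positivity)
      fun f hf => ?_
    have hlim := (tendsto_integral_mul_heatDiff (p := p) (hg.eval_piLp k) hf hp1 hp').abs
    have hb : ∀ n, |∫ x, g x k * heatDiff n f x| ≤ 3 * C * N * lpn p f := by
      intro n
      rw [integral_coord_mul_heatDiff ha hg hdiv hgrad hf hp1.le hp' k n, abs_neg]
      have hT1 : (1 : ℝ) ≤ (n : ℝ) + 1 := by simp
      have hs0 : 0 < ((n : ℝ) + 1)⁻¹ := inv_pos.2 (by linarith)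
      have hsT : ((n : ℝ) + 1)⁻¹ ≤ (n : ℝ) + 1 := (inv_le_one_of_one_le₀ hT1).trans hT1
      -- For test functions in place of `a + g` this is the bilinear embedding, uniform in `n`;
      -- density extends it to `L^q`.
      have hi : ∀ i, |∫ x, (a x i + g x i) *
          heatInt ((n : ℝ) + 1)⁻¹ ((n : ℝ) + 1) (partialD i (partialD k f)) x| ≤
          C * lpn p f * N := by
        intro i
        have h1 := abs_integral_mul_le_of_test (p := p) (q := q)
          (F := heatInt ((n : ℝ) + 1)⁻¹ ((n : ℝ) + 1) (partialD i (partialD k f)))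
          (w := fun x => a x i + g x i)
          (memLp_heatInt ((hf.partialD k).partialD i) hp1.le hp')
          ((ha.eval_piLp i).add (hg.eval_piLp i)) hq1.le hq'
          (mul_nonneg hC0 (lpn_nonneg p f)) fun h hh => ?_
        · exact h1.trans (mul_le_mul_of_nonneg_left (hwi i) (mul_nonneg hC0 (lpn_nonneg p f)))
        · simp only [mul_comm (h _)]
          refine (abs_integral_heatInt_mul_le hf hh hs0 _ i k).trans ?_
          refine (hC f h hf hh _ _ hs0 hsT k i).trans_eq ?_
          ring
      refine (Finset.abs_sum_le_sum_abs _ _).trans ((Finset.sum_le_sum fun i _ => hi i).trans_eq ?_)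
      simp
      ring
    have := le_of_tendsto' hlim hb
    simpa only [mul_comm (f _)] using this
  have hk' : ∀ k, eLpNorm (fun x => g x k) q volume ≤ ENNReal.ofReal (3 * C * N) := fun k =>
    (ENNReal.le_ofReal_iff_toReal_le (hg.eval_piLp k).2.ne (by positivity)).2 (hk k)
  calc eLpNorm g q volume ≤ ∑ i, eLpNorm (fun x => g x i) q volume :=
        eLpNorm_le_sum_coord hq1.le hg
    _ ≤ ∑ _i : Fin 3, ENNReal.ofReal (3 * C * N) := Finset.sum_le_sum fun i _ => hk' i
    _ = ENNReal.ofReal (9 * C) * eLpNorm (fun x => a x + g x) q volume := by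
        rw [← ENNReal.ofReal_toReal hw.2.ne, ← ENNReal.ofReal_mul (by positivity), ← hN]
        simp only [Finset.sum_const, Finset.card_univ, Fintype.card_fin, nsmul_eq_mul]
        rw [← ENNReal.ofReal_natCast, ← ENNReal.ofReal_mul (by positivity)]
        congr 1
        push_cast
        ring

/-- An intersection of kernels of functionals that are continuous by Hölder's inequality. Both the
divergence-free fields and the gradients are of this form. -/
theorem exists_closed_submodule [Fact (1 ≤ q)] [Fact (1 ≤ p)] {ι : Type} (V : ι → E3 → E3)
    (hV : ∀ i, MemLp (V i) p volume) :
    ∃ S : Submodule ℝ (Lp E3 q (volume : Measure E3)), IsClosed (S : Set (Lp E3 q (volume : Measure E3))) ∧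
      ∀ w : Lp E3 q (volume : Measure E3), w ∈ S ↔ ∀ i, ∫ x, ∑ j, w x j * V i x j = 0 := by
  have : p.HolderConjugate q := hpq.symm
  let ℓ : ι → Lp E3 q (volume : Measure E3) →L[ℝ] ℝ := fun i =>
    (innerSL ℝ).lpPairing volume p q ((hV i).toLp (V i))
  have hℓ : ∀ i w, ℓ i w = ∫ x, ∑ j, w x j * V i x j := by
    intro i w
    rw [ContinuousLinearMap.lpPairing_eq_integral]
    refine integral_congr_ae ?_
    filter_upwards [(hV i).coeFn_toLp] with x hx
    rw [hx]
    exact PiLp.inner_apply (𝕜 := ℝ) (V i x) (w x)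
  refine ⟨⨅ i, (ℓ i).toLinearMap.ker, ?_, fun w => ?_⟩
  · rw [Submodule.coe_iInf]
    exact isClosed_iInter fun i => (ℓ i).isClosed_ker
  · simp only [Submodule.mem_iInf, ← hℓ]
    rfl

theorem isDivFree_congr {a a' : E3 → E3} (h : a =ᵐ[volume] a') (ha : IsWeaklyDivFree a) :
    IsWeaklyDivFree a' := by
  intro φ hφ
  rw [← ha φ hφ]
  refine integral_congr_ae ?_
  filter_upwards [h] with x hx
  rw [hx]

theorem isWeakGradientField_congr {g g' : E3 → E3} (h : g =ᵐ[volume] g')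
    (hg : IsWeakGradientField g) : IsWeakGradientField g' := by
  intro w hw
  rw [← hg w hw]
  refine integral_congr_ae ?_
  filter_upwards [h] with x hx
  rw [hx]

/-- The bound makes the `G`-parts of a convergent sequence of sums Cauchy. Their limit and the limit
of the `D`-parts stay in the closed subspaces. -/
theorem exists_add_eq_of_dense {E : Type*} [NormedAddCommGroup E] [NormedSpace ℝ E]
    [CompleteSpace E] {D G : Submodule ℝ E} (hD : IsClosed (D : Set E)) (hG : IsClosed (G : Set E))
    {C : ℝ} (hC0 : 0 ≤ C) (hC : ∀ a ∈ D, ∀ g ∈ G, ‖g‖ ≤ C * ‖a + g‖) {w : E}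
    (hw : w ∈ closure ((D ⊔ G : Submodule ℝ E) : Set E)) : ∃ a ∈ D, ∃ g ∈ G, a + g = w := by
  obtain ⟨u, hu, hlim⟩ := mem_closure_iff_seq_limit.1 hw
  choose a ha g hg hag using fun n => Submodule.mem_sup.1 (hu n)
  have hcau : CauchySeq g := by
    rw [Metric.cauchySeq_iff]
    intro ε hε
    obtain ⟨N, hN⟩ := Metric.cauchySeq_iff.1 hlim.cauchySeq (ε / (C + 1)) (by positivity)
    refine ⟨N, fun m hm n hn => ?_⟩
    have h1 := hC _ (D.sub_mem (ha m) (ha n)) _ (G.sub_mem (hg m) (hg n))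
    have h2 : a m - a n + (g m - g n) = u m - u n := by
      rw [← hag m, ← hag n]
      abel
    rw [h2, ← dist_eq_norm, ← dist_eq_norm] at h1
    have h3 := hN m hm n hn
    rw [lt_div_iff₀ (by positivity)] at h3
    nlinarith [dist_nonneg (x := u m) (y := u n)]
  obtain ⟨g₀, hg₀⟩ := cauchySeq_tendsto_of_complete hcau
  have ha₀ : Tendsto a atTop (𝓝 (w - g₀)) := by
    have := hlim.sub hg₀
    refine this.congr fun n => ?_
    rw [← hag n]
    abel
  exact ⟨w - g₀, hD.mem_of_tendsto ha₀ (.of_forall ha), g₀, hG.mem_of_tendsto hg₀ (.of_forall hg),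
    sub_add_cancel _ _⟩

/-- The explicit splittings of `heatDiff n f · eₖ` have both parts in `L^q`, and these fields
converge to `f eₖ`. -/
theorem mem_topologicalClosure_of_test [Fact (1 ≤ q)] (hq1 : 1 < q) (hq' : q ≠ ⊤)
    {D G : Submodule ℝ (Lp E3 q (volume : Measure E3))}
    (hD : ∀ w : Lp E3 q volume, IsWeaklyDivFree w → w ∈ D)
    (hG : ∀ w : Lp E3 q volume, IsWeakGradientField w → w ∈ G) {f : E3 → ℝ}
    (hf : IsTestFunction f) (k : Fin 3)
    (hm : MemLp (fun x => EuclideanSpace.single k (f x)) q volume) :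
    hm.toLp ∈ (D ⊔ G).topologicalClosure := by
  have hR : ∀ n : ℕ, MemLp (rowDiv (helmMat ((n : ℝ) + 1)⁻¹ ((n : ℝ) + 1) k f)) q volume :=
    fun n => memLp_rowDiv fun i j l => memLp_partialD_helmMat hf k i j l hq1.le hq'
  have hGr : ∀ n : ℕ, MemLp (gradField (helmPot ((n : ℝ) + 1)⁻¹ ((n : ℝ) + 1) k f)) q volume :=
    fun n => memLp_gradField fun i => memLp_partialD_helmPot hf k i hq1.le hq'
  have hmem : ∀ n, (hR n).toLp + (hGr n).toLp ∈ D ⊔ G := fun n => by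
    refine Submodule.add_mem_sup (hD _ ?_) (hG _ ?_)
    · exact isDivFree_congr (hR n).coeFn_toLp.symm (isWeaklyDivFree_rowDiv
        (fun i j => contDiff_helmMat hf k i j) fun i j x => helmMat_antisymm k i j x)
    · exact isWeakGradientField_congr (hGr n).coeFn_toLp.symm
        (isWeakGradientField_gradField (contDiff_helmPot hf k))
  refine mem_closure_of_tendsto (f := fun n => (hR n).toLp + (hGr n).toLp) (b := atTop) ?_
    (.of_forall hmem)
  simp only [← MemLp.toLp_add]
  rw [Lp.tendsto_Lp_iff_tendsto_eLpNorm'']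
  refine (tendsto_eLpNorm_heatDiff_sub hf hq1 hq').congr fun n => ?_
  refine eLpNorm_congr_norm_ae (.of_forall fun x => ?_)
  have hT1 : (1 : ℝ) ≤ (n : ℝ) + 1 := by simp
  have hs0 : 0 < ((n : ℝ) + 1)⁻¹ := inv_pos.2 (by linarith)
  have hsT : ((n : ℝ) + 1)⁻¹ ≤ (n : ℝ) + 1 := (inv_le_one_of_one_le₀ hT1).trans hT1
  have hx : (rowDiv (helmMat ((n : ℝ) + 1)⁻¹ ((n : ℝ) + 1) k f) +
      gradField (helmPot ((n : ℝ) + 1)⁻¹ ((n : ℝ) + 1) k f) -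
      fun x => EuclideanSpace.single k (f x)) x =
      EuclideanSpace.single k (heatDiff n f x - f x) := by
    ext i
    have := rowDiv_add_gradField hf hs0 hsT k i x
    simp only [Pi.sub_apply, Pi.add_apply, PiLp.sub_apply, PiLp.add_apply, this]
    by_cases h : i = k
    · simp [h, heatDiff]
    · simp [h]
  rw [hx, PiLp.norm_single]

theorem topologicalClosure_sup_eq_top [Fact (1 ≤ q)] (hq1 : 1 < q) (hq' : q ≠ ⊤)
    {D G : Submodule ℝ (Lp E3 q (volume : Measure E3))}
    (hD : ∀ w : Lp E3 q volume, IsWeaklyDivFree w → w ∈ D)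
    (hG : ∀ w : Lp E3 q volume, IsWeakGradientField w → w ∈ G) (w : Lp E3 q (volume : Measure E3)) :
    w ∈ closure ((D ⊔ G : Submodule ℝ _) : Set (Lp E3 q (volume : Measure E3))) := by
  have hdense := Lp.dense_hasCompactSupport_contDiff (E := E3) (F := E3) (p := q)
    (μ := volume) hq'
  suffices h : {f : Lp E3 q (volume : Measure E3) | ∃ g : E3 → E3, f =ᵐ[volume] g ∧
      HasCompactSupport g ∧ ContDiff ℝ ∞ g} ⊆ (D ⊔ G).topologicalClosure by
    exact closure_minimal h (Submodule.isClosed_topologicalClosure _) (hdense w)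
  rintro f ⟨g, hfg, hgc, hgs⟩
  have hgk : ∀ k, IsTestFunction fun x => g x k := fun k =>
    ⟨contDiff_euclidean.1 hgs k, hgc.mono fun x hx h => hx (by simp [h])⟩
  have hm : ∀ k, MemLp (fun x => EuclideanSpace.single k (g x k)) q (volume : Measure E3) := by
    intro k
    refine MemLp.of_eval_piLp fun i => ?_
    by_cases h : i = k
    · simpa [h] using (hgk k).memLp q
    · simp [h]
  have hf : f = ∑ k, (hm k).toLp := by
    refine Lp.ext ?_
    have h1 := Lp.coeFn_finsetSum (s := Finset.univ) (f := fun k => (hm k).toLp)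
    have h2 : ∀ᵐ x ∂(volume : Measure E3), ∀ k, (hm k).toLp _ x = EuclideanSpace.single k (g x k) :=
      ae_all_iff.2 fun k => (hm k).coeFn_toLp
    filter_upwards [hfg, h1, h2] with x hx h1x h2x
    rw [hx, h1x]
    simp only [Finset.sum_apply, h2x]
    ext i
    simp [Finset.sum_apply]
  rw [hf]
  exact Submodule.sum_mem _ fun k _ => mem_topologicalClosure_of_test hq1 hq' hD hG (hgk k) k _

end

/-- Existence of the Helmholtz decomposition in `L^q`, `1 < q < ∞`. -/
theorem exists_isHelmholtzConstant {q : ℝ≥0∞} (hq1 : 1 < q) (hq' : q ≠ ⊤) :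
    ∃ C : ℝ≥0, IsHelmholtzConstant q C := by
  have : Fact (1 ≤ q) := ⟨hq1.le⟩
  obtain ⟨p, hpq⟩ : ∃ p, q.HolderConjugate p := ⟨_, ENNReal.HolderConjugate.conjExponent hq1.le⟩
  have hqp : p.HolderConjugate q := hpq.symm
  have hp1' : 1 ≤ p := ENNReal.HolderConjugate.one_le p q
  have : Fact (1 ≤ p) := ⟨hp1'⟩
  have hp' : p ≠ ⊤ := fun h =>
    hq1.ne' ((ENNReal.HolderConjugate.eq_top_iff_eq_one (p := p) (q := q)).1 h)
  have hp1 : 1 < p := hp1'.lt_of_ne fun h =>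
    hq' ((ENNReal.HolderConjugate.eq_top_iff_eq_one (p := q) (q := p)).2 h.symm)
  obtain ⟨C, hC0, hC⟩ := exists_gradient_part_bound (p := p) hq1 hq' hp1 hp'
  obtain ⟨D, hDc, hD⟩ := exists_closed_submodule (p := p) (q := q)
    (fun φ : {φ : E3 → ℝ // IsTestFunction φ} => gradField φ.1)
    fun φ => memLp_gradField fun i => (φ.2.partialD i).memLp p
  obtain ⟨G, hGc, hG⟩ := exists_closed_submodule (p := p) (q := q)
    (fun w : {w : E3 → E3 // IsDivFreeTestField w} => w.1)
    fun w => MemLp.of_eval_piLp fun i => (w.2.isTestFunction i).memLp p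
  have hD' : ∀ w : Lp E3 q (volume : Measure E3), w ∈ D ↔ IsWeaklyDivFree w := fun w =>
    (hD w).trans ⟨fun h φ hφ => h ⟨φ, hφ⟩, fun h φ => h φ.1 φ.2⟩
  have hG' : ∀ w : Lp E3 q (volume : Measure E3), w ∈ G ↔ IsWeakGradientField w := fun w =>
    (hG w).trans ⟨fun h φ hφ => h ⟨φ, hφ⟩, fun h φ => h φ.1 φ.2⟩
  have hbd : ∀ a ∈ D, ∀ g ∈ G, ‖g‖ ≤ C * ‖a + g‖ := by
    intro a ha g hg
    have h := hC a g (Lp.memLp a) (Lp.memLp g) ((hD' a).1 ha) ((hG' g).1 hg)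
    have e : eLpNorm (fun x => a x + g x) q volume = eLpNorm (a + g : Lp E3 q volume) q volume :=
      eLpNorm_congr_ae (Lp.coeFn_add a g).symm
    rw [e] at h
    have h2 := ENNReal.toReal_mono
      (ENNReal.mul_ne_top ENNReal.ofReal_ne_top (Lp.memLp (a + g)).2.ne) h
    rwa [ENNReal.toReal_mul, ENNReal.toReal_ofReal hC0] at h2
  have hCC : ((Real.toNNReal C + 1 : ℝ≥0) : ℝ≥0∞) = ENNReal.ofReal C + 1 := by
    rw [ENNReal.coe_add, ENNReal.coe_one]
    rfl
  -- `C` serves for `g`; for `a = w - g` the triangle inequality adds one, which also makes the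
  -- constant at least one.
  refine ⟨Real.toNNReal C + 1, by simp, fun w hw => ?_⟩
  obtain ⟨a, ha, g, hg, hag⟩ := exists_add_eq_of_dense hDc hGc hC0 hbd
    (topologicalClosure_sup_eq_top hq1 hq' (fun w => (hD' w).2) (fun w => (hG' w).2) hw.toLp)
  have hwe : w =ᵐ[volume] fun x => a x + g x := by
    refine hw.coeFn_toLp.symm.trans ?_
    rw [← hag]
    exact Lp.coeFn_add a g
  have hgn : eLpNorm g q volume ≤ ENNReal.ofReal C * eLpNorm w q volume := by
    rw [eLpNorm_congr_ae hwe]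
    exact hC a g (Lp.memLp a) (Lp.memLp g) ((hD' a).1 ha) ((hG' g).1 hg)
  refine ⟨a, g, ⟨Lp.memLp a, Lp.memLp g, (hD' a).1 ha, (hG' g).1 hg, hwe⟩, ?_, ?_, ?_⟩
  · intro a' g' h'
    set b := h'.memLp_divFree.toLp with hb
    set c := h'.memLp_gradient.toLp with hc
    have hbD : b ∈ D :=
      (hD' b).2 (isDivFree_congr h'.memLp_divFree.coeFn_toLp.symm h'.divFree)
    have hcG : c ∈ G :=
      (hG' c).2 (isWeakGradientField_congr h'.memLp_gradient.coeFn_toLp.symm h'.gradient)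
    have hbc : b + c = a + g := by
      rw [hag, hb, hc, ← MemLp.toLp_add]
      exact (MemLp.toLp_eq_toLp_iff _ _).2 h'.sum_eq.symm
    -- The difference of two decompositions decomposes zero, so the a priori bound forces its
    -- gradient part to vanish.
    have h1 := hbd _ (D.sub_mem hbD ha) _ (G.sub_mem hcG hg)
    have h2 : b - a + (c - g) = 0 := by
      rw [sub_add_sub_comm, hbc, sub_self]
    rw [h2, norm_zero, mul_zero] at h1
    have h3 : c = g := sub_eq_zero.1 (norm_le_zero_iff.1 h1)
    have h4 : b = a := by
      rw [h3] at hbc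
      exact add_right_cancel hbc
    constructor
    · rw [← h4]
      exact h'.memLp_divFree.coeFn_toLp.symm
    · rw [← h3]
      exact h'.memLp_gradient.coeFn_toLp.symm
  · have h1 : (a : E3 → E3) =ᵐ[volume] fun x => w x - g x := by
      filter_upwards [hwe] with x hx
      rw [hx, add_sub_cancel_right]
    rw [hCC, add_mul, one_mul, eLpNorm_congr_ae h1]
    refine (eLpNorm_sub_le hw.1 (Lp.memLp g).1 hq1.le).trans ?_
    rw [add_comm]
    gcongr
  · rw [hCC, add_mul]
    exact hgn.trans le_self_add

/-! ### The two Helmholtz decompositions attached to `u` and `v` -/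

theorem LocallyIntegrable.integrable_mul_testFunction {f φ : E3 → ℝ}
    (hf : LocallyIntegrable f volume) (hφ : IsTestFunction φ) :
    Integrable (fun x => f x * φ x) volume :=
  hf.integrable_smul_right_of_hasCompactSupport hφ.continuous hφ.2

theorem IsWeakPartial.sum_const_mul {j : Fin 3} {f g : Fin 3 → E3 → ℝ}
    (h : ∀ i, IsWeakPartial j (f i) (g i)) (c : Fin 3 → ℝ) :
    IsWeakPartial j (fun x => ∑ i, c i * f i x) (fun x => ∑ i, c i * g i x) where
  locInt := locallyIntegrable_finsetSum _ fun i _ => (h i).locInt.smul (c i)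
  locInt_deriv := locallyIntegrable_finsetSum _ fun i _ => (h i).locInt_deriv.smul (c i)
  integral_eq φ hφ := by
    simp only [Finset.sum_mul, mul_assoc]
    rw [integral_finsetSum _ fun i _ =>
        ((LocallyIntegrable.integrable_mul_testFunction (h i).locInt (hφ.partialD j)).const_mul _),
      integral_finsetSum _ fun i _ =>
        ((LocallyIntegrable.integrable_mul_testFunction (h i).locInt_deriv hφ).const_mul _),
      ← Finset.sum_neg_distrib]
    refine Finset.sum_congr rfl fun i _ => ?_
    rw [integral_const_mul, integral_const_mul, (h i).integral_eq φ hφ, mul_neg]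

theorem isWeakGradientField_weakGrad {f : E3 → ℝ}
    (h : ∀ j, IsWeakPartial j f (weakPartial j f)) : IsWeakGradientField (weakGrad f) := by
  intro w hw
  have hwi := hw.isTestFunction
  simp only [weakGrad]
  rw [integral_finsetSum _ fun j _ =>
    LocallyIntegrable.integrable_mul_testFunction (h j).locInt_deriv (hwi j)]
  have hj : ∀ j, ∫ x, weakPartial j f x * w x j =
      -∫ x, f x * partialD j (fun y => w y j) x := fun j => by
    rw [(h j).integral_eq _ (hwi j), neg_neg]
  simp only [hj]
  rw [Finset.sum_neg_distrib, ← integral_finsetSum _ fun j _ =>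
    LocallyIntegrable.integrable_mul_testFunction (h j).locInt ((hwi j).partialD j)]
  simp only [← Finset.mul_sum, hw.2.2]
  simp

/-- Moving `∂ⱼ` to the test function leaves `∫ u · ∇(∂ⱼφ)`, which vanishes because `∂ⱼφ` is again a
test function. As `v` is constant, the combination over `j` causes no further terms. -/
theorem isWeaklyDivFree_dirDeriv {u : E3 → E3} (hu : IsWeaklyDivFree u)
    (h : ∀ i j, IsWeakPartial j (fun x => u x i) (weakPartial j fun x => u x i)) (v : E3) :
    IsWeaklyDivFree (dirDeriv v u) := by
  intro φ hφ
  have hint : ∀ i j, Integrable (fun x => weakPartial j (fun y => u y i) x * partialD i φ x)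
      volume := fun i j =>
    LocallyIntegrable.integrable_mul_testFunction (h i j).locInt_deriv (hφ.partialD i)
  have hj : ∀ j, ∑ i, ∫ x, weakPartial j (fun y => u y i) x * partialD i φ x = 0 := by
    intro j
    have hi : ∀ i, ∫ x, weakPartial j (fun y => u y i) x * partialD i φ x =
        -∫ x, u x i * partialD i (partialD j φ) x := fun i => by
      have := (h i j).integral_eq _ (hφ.partialD i)
      rw [← partialD_comm (hφ.1.of_le (by norm_cast)) j i, this, neg_neg]
    simp only [hi]
    rw [Finset.sum_neg_distrib, ← integral_finsetSum _ fun i _ =>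
      LocallyIntegrable.integrable_mul_testFunction (h i j).locInt ((hφ.partialD j).partialD i),
      hu _ (hφ.partialD j), neg_zero]
  calc ∫ x, ∑ i, dirDeriv v u x i * partialD i φ x
      = ∫ x, ∑ j, ∑ i, v j * (weakPartial j (fun y => u y i) x * partialD i φ x) := by
        simp only [dirDeriv, Finset.sum_mul, mul_assoc]
        congr 1 with x
        exact Finset.sum_comm
    _ = ∑ j, v j * ∑ i, ∫ x, weakPartial j (fun y => u y i) x * partialD i φ x := by
        rw [integral_finsetSum _ fun j _ =>
          integrable_finsetSum _ fun i _ => (hint i j).const_mul _]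
        refine Finset.sum_congr rfl fun j _ => ?_
        rw [integral_finsetSum _ fun i _ => (hint i j).const_mul _, Finset.mul_sum]
        exact Finset.sum_congr rfl fun i _ => integral_const_mul _ _
    _ = 0 := by simp [hj]

theorem isWeaklyDivFree_neg {a : E3 → E3} (ha : IsWeaklyDivFree a) :
    IsWeaklyDivFree fun x => -a x := by
  intro φ hφ
  simpa [integral_neg] using ha φ hφ

/-- A Helmholtz constant bounds both parts of any Helmholtz decomposition. -/
theorem IsHelmholtzConstant.eLpNorm_le {q : ℝ≥0∞} {C : ℝ≥0} (hC : IsHelmholtzConstant q C)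
    {w a g : E3 → E3} (h : IsHelmholtzDecomposition q w a g) :
    eLpNorm a q volume ≤ C * eLpNorm w q volume ∧ eLpNorm g q volume ≤ C * eLpNorm w q volume := by
  have hw : MemLp w q volume := (h.memLp_divFree.add h.memLp_gradient).ae_eq h.sum_eq.symm
  obtain ⟨a', g', -, huniq, ha, hg⟩ := hC.2 w hw
  obtain ⟨h1, h2⟩ := huniq a g h
  rw [eLpNorm_congr_ae h1, eLpNorm_congr_ae h2]
  exact ⟨ha, hg⟩

section

variable {q : ℝ≥0∞} {u : E3 → E3}

theorem WeakGradMemLp.weakPartial (h : WeakGradMemLp q u) (i j : Fin 3) :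
    IsWeakPartial j (fun x => u x i) (weakPartial j fun x => u x i) ∧
      MemLp (weakPartial j fun x => u x i) q volume := by
  obtain ⟨g, hg, hm⟩ := h i j
  exact ⟨hg.weakPartial_spec, hm.ae_eq hg.weakPartial_ae_eq.symm⟩

theorem memLp_dirDeriv (h : WeakGradMemLp q u) (v : E3) : MemLp (dirDeriv v u) q volume :=
  MemLp.of_eval_piLp fun i =>
    memLp_finsetSum Finset.univ fun j _ => ((h.weakPartial i j).2.const_mul (v j))

theorem isWeakPartial_inner (h : WeakGradMemLp q u) (v : E3) (j : Fin 3) :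
    IsWeakPartial j (fun x => inner ℝ (u x) v)
      (fun x => ∑ i, v i * weakPartial j (fun y => u y i) x) := by
  simpa [PiLp.inner_apply] using
    IsWeakPartial.sum_const_mul (fun i => (h.weakPartial i j).1) fun i => v i

theorem weakGrad_inner_ae_eq (h : WeakGradMemLp q u) (v : E3) :
    (weakGrad fun x => inner ℝ (u x) v) =ᵐ[volume]
      fun x => WithLp.toLp 2 fun j => ∑ i, v i * weakPartial j (fun y => u y i) x := by
  filter_upwards [ae_all_iff.2 fun j => (isWeakPartial_inner h v j).weakPartial_ae_eq] with x hx
  simp only [weakGrad, hx]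

theorem memLp_weakGrad_inner (h : WeakGradMemLp q u) (v : E3) :
    MemLp (weakGrad fun x => inner ℝ (u x) v) q volume := by
  refine MemLp.ae_eq (weakGrad_inner_ae_eq h v).symm (MemLp.of_eval_piLp fun j => ?_)
  exact memLp_finsetSum Finset.univ fun i _ => ((h.weakPartial i j).2.const_mul (v i))

/-- `v × ω = ∇(u · v) - (v · ∇)u`. -/
theorem crossVorticity_ae_eq (h : WeakGradMemLp q u) (v : E3) :
    crossVorticity u v =ᵐ[volume]
      fun x => -dirDeriv v u x + weakGrad (fun y => inner ℝ (u y) v) x := by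
  filter_upwards [weakGrad_inner_ae_eq h v] with x hx
  rw [hx]
  ext i
  fin_cases i <;>
  · simp [crossVorticity, vorticity, dirDeriv, cross_apply, Fin.sum_univ_three]
    ring

/-- `2 S v = ∇(u · v) + (v · ∇)u`. -/
theorem two_smul_strainApply_ae_eq (h : WeakGradMemLp q u) (v : E3) :
    (fun x => (2 : ℝ) • strainApply u v x) =ᵐ[volume]
      fun x => dirDeriv v u x + weakGrad (fun y => inner ℝ (u y) v) x := by
  filter_upwards [weakGrad_inner_ae_eq h v] with x hx
  rw [hx]
  ext i
  fin_cases i <;>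
  · simp [strainApply, strain, dirDeriv, Matrix.mulVec, dotProduct, Fin.sum_univ_three]
    ring

theorem isHelmholtzDecomposition_two_smul_strainApply (hu : IsWeaklyDivFree u)
    (h : WeakGradMemLp q u) (v : E3) :
    IsHelmholtzDecomposition q (fun x => (2 : ℝ) • strainApply u v x) (dirDeriv v u)
      (weakGrad fun x => inner ℝ (u x) v) where
  memLp_divFree := memLp_dirDeriv h v
  memLp_gradient := memLp_weakGrad_inner h v
  divFree := isWeaklyDivFree_dirDeriv hu (fun i j => (h.weakPartial i j).1) v
  gradient := isWeakGradientField_weakGrad fun j => (isWeakPartial_inner h v j).weakPartial_spec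
  sum_eq := two_smul_strainApply_ae_eq h v

theorem isHelmholtzDecomposition_crossVorticity (hu : IsWeaklyDivFree u)
    (h : WeakGradMemLp q u) (v : E3) :
    IsHelmholtzDecomposition q (crossVorticity u v) (fun x => -dirDeriv v u x)
      (weakGrad fun x => inner ℝ (u x) v) where
  memLp_divFree := (memLp_dirDeriv h v).neg
  memLp_gradient := memLp_weakGrad_inner h v
  divFree := isWeaklyDivFree_neg
    (isWeaklyDivFree_dirDeriv hu (fun i j => (h.weakPartial i j).1) v)
  gradient := isWeakGradientField_weakGrad fun j => (isWeakPartial_inner h v j).weakPartial_spec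
  sum_eq := crossVorticity_ae_eq h v

theorem IsHelmholtzDecomposition.eLpNorm_le_add {w a g : E3 → E3} (hq : 1 ≤ q)
    (h : IsHelmholtzDecomposition q w a g) :
    eLpNorm w q volume ≤ eLpNorm a q volume + eLpNorm g q volume := by
  rw [eLpNorm_congr_ae h.sum_eq]
  exact eLpNorm_add_le h.memLp_divFree.1 h.memLp_gradient.1 hq

end

end

theorem mainTheorem2 (q : ℝ≥0∞) (hq_one : 1 < q) (hq_top : q < ⊤) :
    (∃ C : ℝ≥0, IsHelmholtzConstant q C) ∧
    ∀ C : ℝ≥0, IsHelmholtzConstant q C →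
      ∀ u : E3 → E3, LocallyIntegrable u volume → IsWeaklyDivFree u → WeakGradMemLp q u →
        ∀ v : E3, ‖v‖ = 1 →
          eLpNorm (dirDeriv v u) q volume ≤ C * eLpNorm (crossVorticity u v) q volume ∧
          eLpNorm (dirDeriv v u) q volume
            ≤ C * eLpNorm (fun x => (2 : ℝ) • strainApply u v x) q volume ∧
          eLpNorm (weakGrad fun x => inner ℝ (u x) v) q volume
            ≤ C * eLpNorm (crossVorticity u v) q volume ∧
          eLpNorm (weakGrad fun x => inner ℝ (u x) v) q volume
            ≤ C * eLpNorm (fun x => (2 : ℝ) • strainApply u v x) q volume ∧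
          (1 / (2 * C : ℝ≥0∞)) * eLpNorm (crossVorticity u v) q volume
            ≤ eLpNorm (fun x => (2 : ℝ) • strainApply u v x) q volume ∧
          eLpNorm (fun x => (2 : ℝ) • strainApply u v x) q volume
            ≤ 2 * C * eLpNorm (crossVorticity u v) q volume := by
  refine ⟨exists_isHelmholtzConstant hq_one hq_top.ne, fun C hC u _ hdiv hu v _ => ?_⟩
  have hS := isHelmholtzDecomposition_two_smul_strainApply hdiv hu v
  have hV := isHelmholtzDecomposition_crossVorticity hdiv hu v
  have hneg : eLpNorm (fun x => -dirDeriv v u x) q volume = eLpNorm (dirDeriv v u) q volume :=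
    eLpNorm_neg _ _ _
  obtain ⟨hS1, hS2⟩ := hC.eLpNorm_le hS
  obtain ⟨hV1, hV2⟩ := hC.eLpNorm_le hV
  have hSle := hS.eLpNorm_le_add hq_one.le
  have hVle := hV.eLpNorm_le_add hq_one.le
  rw [hneg] at hV1 hVle
  refine ⟨hV1, hS1, hV2, hS2, ?_, ?_⟩
  · have hC0 : (2 * C : ℝ≥0∞) ≠ 0 := by
      have := (zero_lt_one.trans_le hC.1).ne'
      simp [this]
    have hCt : (2 * C : ℝ≥0∞) ≠ ⊤ := ENNReal.mul_ne_top (by simp) (by simp)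
    rw [one_div, ENNReal.inv_mul_le_iff hC0 hCt]
    calc _ ≤ _ := hVle
      _ ≤ _ := add_le_add hS1 hS2
      _ = _ := by ring
  · calc _ ≤ _ := hSle
      _ ≤ _ := add_le_add hV1 hV2
      _ = _ := by ring
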